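/- **Setting.** Let $E$ be a real vector space (of any dimension) with a pre-symplectic form $\sigma$, i.e. an alternating, possibly degenerate, real bilinear form $\sigma:E\times E\to\mathbb R$. Equip $E$ with its finest locally convex topology and the corresponding Borel $\sigma$-algebra, and the space of complex Borel measures on $E$ with the total variation norm $\|\mu\|_1=|\mu|(E)$. For a finite dimensional subspace $E_\alpha\subseteq E$ let $\mathcal M(E_\alpha)$ be the complex Borel measures on $E$ concentrated on $E_\alpha$, and let $\mathcal M(E_\alpha)_d$, $\mathcal M(E_\alpha)_c$, $\mathcal M(E_\alpha)_a$ be its subspaces of discrete measures (concentrated on a countable set), of continuous measures (without atoms), and of measures absolutely continuous with respect to the Haar measure of $E_\alpha$. Let $$\mathcal M(E)=\overline{\textstyle\bigcup_\alpha\mathcal M(E_\alpha)}^{\|\cdot\|_1},\quad \mathcal M(E)_d=\overline{\textstyle\bigcup_\alpha\mathcal M(E_\alpha)_d}^{\|\cdot\|_1},\quad \mathcal M(E)_c=\overline{\textstyle\bigcup_\alpha\mathcal M(E_\alpha)_c}^{\|\cdot\|_1},$$ and let $\mathcal M(E)_{df}$ be the linear span of the point measures. For $\hbar\in\mathbb R$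 and $\mu,\nu\in\mathcal M(E)$ put $$(\mu\star_\hbar\nu)(\Lambda)=\int_E d\mu(f)\int_E d\nu(g)\,e^{-\frac i2\hbar\sigma(f,g)}\,1_\Lambda(f+g),\qquad \mu^*(\Lambda)=\overline{\mu(-\Lambda)},$$ and, for $\hbar\ne0$, $\{\mu,\nu\}_\hbar=\frac i\hbar(\mu\star_\hbar\nu-\nu\star_\hbar\mu)$. For a seminorm $\kappa$ on $E$ and $n\in\mathbb N\cup\{0,\infty\}$ let $\mathcal M^n_\kappa(E)$ be the set of $\mu\in\mathcal M(E)$ with $\int_E\kappa(f)^m\,d|\mu|(f)<\infty$ for all integers $0\le m\le n$. Below, $\varsigma$ denotes any seminorm on $E$ for which there is $c>0$ with $|\sigma(f,g)|\le c\,\varsigma(f)\varsigma(g)$ for all $f,g\in E$. For $\mu,\nu\in\mathcal M^1_\varsigma(E)$ put $$\{\mu,\nu\}_0(\Lambda)=\int_E d\mu(f)\int_E d\nu(g)\,\sigma(f,g)\,1_\Lambda(f+g).$$ A *measure Poisson algebra belonging to $\varsigma$* is one of the following subspaces $\mathcal P$ of $\mathcal M(E)$: (I) $\mathcal M^\infty_\kappa(E)$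 for a seminorm $\kappa$ with $\varsigma\le C\kappa$ for some constant $C$; (II) $\bigcap_{\beta\in B}\mathcal M^\infty_{\kappa_\beta}(E)$ for a collection of seminorms with $\varsigma\le\sum_{\beta\in\Gamma}c_\beta\kappa_\beta$ for some finite $\Gamma\subseteq B$ and constants $c_\beta$; (III) intersections of listed spaces with $\mathcal M(E)_d$, $\mathcal M(E)_c$, or $\mathcal M(E_\alpha)_a$ for a finite dimensional subspace $E_\alpha$; (IV) $\mathcal M(E)_{df}$. **Theorem.** The formulas above define elements $\mu\star_\hbar\nu$, $\mu^*$ of $\mathcal M(E)$ for all $\mu,\nu\in\mathcal M(E)$, $\hbar\in\mathbb R$, and $\{\mu,\nu\}_0\in\mathcal M(E)$ for all $\mu,\nu\in\mathcal M^1_\varsigma(E)$. For each $\hbar\in\mathbb R$, $(\mathcal M(E),\star_\hbar,{}^*,\|\cdot\|_1)$ is a Banach-$*$-algebra (an associative complete normed algebra with submultiplicative norm and isometric antilinear antimultiplicative involution). Moreover: 1. (von Neumann's condition) $\lim_{\hbar\to0}\|\mu\star_\hbar\nu-\mu\star_0\nu\|_1=0$ for all $\mu,\nu\in\mathcal M(E)$.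 2. (Dirac's condition) $\lim_{0\ne\hbar\to0}\|\{\mu,\nu\}_\hbar-\{\mu,\nu\}_0\|_1=0$ for all $\mu,\nu\in\mathcal M^1_\varsigma(E)$. 3. (Strict deformation quantization) Let $\mathcal P$ be any measure Poisson algebra belonging to $\varsigma$. Then $\mathcal P\subseteq\mathcal M^\infty_\varsigma(E)$, and the identical embeddings $Q^B_\hbar:\mathcal P\to(\mathcal M(E),\star_\hbar)$, $\mu\mapsto\mu$, $\hbar\in\mathbb R$, form a Banach-$*$-type strict deformation quantization of $(\mathcal P,\star_0,\{\cdot,\cdot\}_0)$. That is: $(\mathcal P,\star_0,{}^*,\{\cdot,\cdot\}_0)$ is a Poisson algebra (a commutative $*$-algebra with a bilinear, anticommutative, real bracket satisfying the Jacobi identity and the Leibniz rule), dense in a commutative Banach-$*$-algebra, namely in its $\|\cdot\|_1$-closure in $(\mathcal M(E),\star_0)$; the maps $Q^B_\hbar$ are linear and $*$-preserving and $Q^B_0$ is the identical embedding; for all $\mu,\nu\in\mathcal P$ one has Dirac's condition $\lim_{0\ne\hbar\to0}\|\{Q^B_\hbar\mu,Q^B_\hbar\nu\}_\hbar-Q^B_\hbar(\{\mu,\nu\}_0)\|_1=0$,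 von Neumann's condition $\lim_{\hbar\to0}\|Q^B_\hbar\mu\star_\hbar Q^B_\hbar\nu-Q^B_\hbar(\mu\star_0\nu)\|_1=0$ and Rieffel's condition that $\hbar\mapsto\|Q^B_\hbar\mu\|_1$ is continuous; each $Q^B_\hbar$ is injective and its image is a sub-$*$-algebra of $(\mathcal M(E),\star_\hbar)$. 4. (Functoriality) Let $T:E\to E'$ be a linear map into a real vector space $E'$, also with its finest locally convex topology. The push-forward $(T_*\mu)(\Lambda)=\mu(T^{-1}(\Lambda))$ maps $\mathcal M(E)$ to $\mathcal M(E')$, with $\mathrm{id}_*=\mathrm{id}$ and $(ST)_*=S_*T_*$. If $\sigma'$ is a pre-symplectic form on $E'$ with $\sigma'(Tf,Tg)=\sigma(f,g)$ for all $f,g\in E$, then $T_*$ is linear, norm-contractive, satisfies $T_*(\mu^*)=(T_*\mu)^*$ and $T_*(\mu\star_\hbar\nu)=T_*\mu\star_\hbar T_*\nu$ for all $\mu,\nu\in\mathcal M(E)$ and $\hbar\in\mathbb R$, and $T_*\{\mu,\nu\}_0=\{T_*\mu,T_*\nu\}_0$ for all $\mu,\nu\in\mathcal M^1_\varsigma(E)$;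 it maps $\mathcal M^n_\kappa(E)$ into $\mathcal M^n_{\kappa'}(E')$ whenever the seminorms $\kappa$, $\kappa'$ satisfy $\kappa'\circ T\le C\kappa$ for some constant $C$, $\mathcal M(E)_d$ into $\mathcal M(E')_d$, $\mathcal M(E)_{df}$ into $\mathcal M(E')_{df}$, $\mathcal M(E_\alpha)_a$ into $\mathcal M(TE_\alpha)_a$ and, if $T$ is injective, $\mathcal M(E)_c$ into $\mathcal M(E')_c$. -/

import Mathlib

open MeasureTheory Filter Topology
open scoped ENNReal NNReal

noncomputable section

/-! ## Abstract notions: Banach-star-algebras, Poisson algebras, strict deformation quantizations -/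

/-- The complex normed space `A` is a Banach-star-algebra with the product `mul` and the
involution `star'`. -/
structure IsBanachStarAlgebra {A : Type*} [NormedAddCommGroup A] [NormedSpace ℂ A]
    (mul : A → A → A) (star' : A → A) : Prop where
  complete : CompleteSpace A
  add_mul : ∀ a b c, mul (a + b) c = mul a c + mul b c
  mul_add : ∀ a b c, mul a (b + c) = mul a b + mul a c
  smul_mul : ∀ (z : ℂ) (a b), mul (z • a) b = z • mul a b
  mul_smul : ∀ (z : ℂ) (a b), mul a (z • b) = z • mul a b
  mul_assoc : ∀ a b c, mul (mul a b) c = mul a (mul b c)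
  norm_mul_le : ∀ a b, ‖mul a b‖ ≤ ‖a‖ * ‖b‖
  star_add : ∀ a b, star' (a + b) = star' a + star' b
  star_smul : ∀ (z : ℂ) (a), star' (z • a) = (starRingEnd ℂ) z • star' a
  star_star : ∀ a, star' (star' a) = a
  star_mul : ∀ a b, star' (mul a b) = mul (star' b) (star' a)
  norm_star : ∀ a, ‖star' a‖ = ‖a‖

/-- The linear subspace `P` of the complex vector space `A` is a Poisson algebra with respect to
the restrictions of `mul`, `star'` and `br`: a commutative complex star-algebra with a Poisson
bracket. -/
structure IsPoissonAlgebra {A : Type*} [AddCommGroup A] [Module ℂ A] (P : Submodule ℂ A)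
    (mul : A → A → A) (star' : A → A) (br : A → A → A) : Prop where
  mul_mem : ∀ a ∈ P, ∀ b ∈ P, mul a b ∈ P
  star_mem : ∀ a ∈ P, star' a ∈ P
  br_mem : ∀ a ∈ P, ∀ b ∈ P, br a b ∈ P
  add_mul : ∀ a ∈ P, ∀ b ∈ P, ∀ c ∈ P, mul (a + b) c = mul a c + mul b c
  smul_mul : ∀ z : ℂ, ∀ a ∈ P, ∀ b ∈ P, mul (z • a) b = z • mul a b
  mul_comm : ∀ a ∈ P, ∀ b ∈ P, mul a b = mul b a
  mul_assoc : ∀ a ∈ P, ∀ b ∈ P, ∀ c ∈ P, mul (mul a b) c = mul a (mul b c)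
  star_add : ∀ a ∈ P, ∀ b ∈ P, star' (a + b) = star' a + star' b
  star_smul : ∀ z : ℂ, ∀ a ∈ P, star' (z • a) = (starRingEnd ℂ) z • star' a
  star_star : ∀ a ∈ P, star' (star' a) = a
  star_mul : ∀ a ∈ P, ∀ b ∈ P, star' (mul a b) = mul (star' b) (star' a)
  br_add : ∀ a ∈ P, ∀ b ∈ P, ∀ c ∈ P, br a (b + c) = br a b + br a c
  br_smul : ∀ z : ℂ, ∀ a ∈ P, ∀ b ∈ P, br a (z • b) = z • br a b
  br_anticomm : ∀ a ∈ P, ∀ b ∈ P, br a b = -br b a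
  br_real : ∀ a ∈ P, ∀ b ∈ P, star' (br a b) = br (star' a) (star' b)
  jacobi : ∀ a ∈ P, ∀ b ∈ P, ∀ c ∈ P, br a (br b c) + br b (br c a) + br c (br a b) = 0
  leibniz : ∀ a ∈ P, ∀ b ∈ P, ∀ c ∈ P, br a (mul b c) = mul (br a b) c + mul b (br a c)

/-- The `ħ`-scaled commutator `(i / ħ) (a b - b a)` with respect to the product `mul`. -/
def scaledCommutator {A : Type*} [AddCommGroup A] [Module ℂ A] (mul : A → A → A) (ħ : ℝ)
    (a b : A) : A :=
  (Complex.I / (ħ : ℂ)) • (mul a b - mul b a)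

/-- Strict deformation quantization of Banach-star-type, over all `ħ ∈ ℝ`, of the Poisson algebra
`P` (sitting in the algebra `A 0`, with the product and the involution of `A 0` and with the
bracket `br`), by the quantization maps `Q ħ : P → A ħ` into Banach-star-algebras `A ħ`. -/
structure IsBanachStrictDeformationQuantization {A : ℝ → Type*}
    [∀ ħ, NormedAddCommGroup (A ħ)] [∀ ħ, NormedSpace ℂ (A ħ)]
    (mul : ∀ ħ, A ħ → A ħ → A ħ) (star' : ∀ ħ, A ħ → A ħ)
    (P : Submodule ℂ (A 0)) (br : A 0 → A 0 → A 0) (Q : ∀ ħ, P →ₗ[ℂ] A ħ) : Prop where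
  banach : ∀ ħ, IsBanachStarAlgebra (mul ħ) (star' ħ)
  poisson : IsPoissonAlgebra P (mul 0) (star' 0) br
  /-- `P` is norm dense in a commutative Banach-star-algebra, namely in its closure. -/
  closure_mul_mem : ∀ a ∈ P.topologicalClosure, ∀ b ∈ P.topologicalClosure,
    mul 0 a b ∈ P.topologicalClosure
  closure_star_mem : ∀ a ∈ P.topologicalClosure, star' 0 a ∈ P.topologicalClosure
  closure_mul_comm : ∀ a ∈ P.topologicalClosure, ∀ b ∈ P.topologicalClosure,
    mul 0 a b = mul 0 b a
  /-- `Q 0` is the identical embedding. -/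
  embedding_zero : ∀ a : P, Q 0 a = a
  /-- The quantization maps preserve the involution. -/
  star_preserving : ∀ (ħ : ℝ) (a : P),
    Q ħ ⟨star' 0 a, poisson.star_mem a a.2⟩ = star' ħ (Q ħ a)
  dirac : ∀ a b : P, Tendsto
    (fun ħ : ℝ => ‖scaledCommutator (mul ħ) ħ (Q ħ a) (Q ħ b)
      - Q ħ ⟨br a b, poisson.br_mem a a.2 b b.2⟩‖) (𝓝[≠] 0) (𝓝 0)
  vonNeumann : ∀ a b : P, Tendsto
    (fun ħ : ℝ => ‖mul ħ (Q ħ a) (Q ħ b)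
      - Q ħ ⟨mul 0 a b, poisson.mul_mem a a.2 b b.2⟩‖) (𝓝 0) (𝓝 0)
  rieffel : ∀ a : P, Continuous fun ħ : ℝ => ‖Q ħ a‖
  injective : ∀ ħ, Function.Injective (Q ħ)
  /-- The image of each quantization map is a sub-star-algebra. -/
  image_mul_mem : ∀ (ħ : ℝ) (a b : P), mul ħ (Q ħ a) (Q ħ b) ∈ LinearMap.range (Q ħ)
  image_star_mem : ∀ (ħ : ℝ) (a : P), star' ħ (Q ħ a) ∈ LinearMap.range (Q ħ)

/-! ## The finest locally convex topology -/

/-- The finest locally convex vector space topology on a real vector space. -/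
abbrev finestLocallyConvexTopology (E : Type*) [AddCommGroup E] [Module ℝ E] :
    TopologicalSpace E :=
  sInf {t | @IsTopologicalAddGroup E t _ ∧ @ContinuousSMul ℝ E _ _ t ∧
    @LocallyConvexSpace ℝ E _ _ _ _ t}

/-- The topology of `E` is the finest locally convex one. -/
class IsFinestLocallyConvex (E : Type*) [AddCommGroup E] [Module ℝ E] [t : TopologicalSpace E] :
    Prop where
  eq_finest : t = finestLocallyConvexTopology E

/-! ## The Banach space of complex measures with the total variation norm -/

section Variation

variable {X : Type*} [MeasurableSpace X]

lemma complexMeasure_variation_lt_top (μ : ComplexMeasure X) : μ.variation Set.univ < ∞ := by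
  have h : μ.variation ≤ (ComplexMeasure.re μ).totalVariation
      + (ComplexMeasure.im μ).totalVariation := by
    apply VectorMeasure.variation_le_of_forall_enorm_le
    intro s _
    rw [Measure.add_apply]
    refine le_trans ?_ (add_le_add (SignedMeasure.enorm_le_totalVariation (ComplexMeasure.re μ) s)
      (SignedMeasure.enorm_le_totalVariation (ComplexMeasure.im μ) s))
    rw [ComplexMeasure.re_apply, ComplexMeasure.im_apply]
    calc ‖μ s‖ₑ = ‖((μ s).re : ℂ) + (μ s).im * Complex.I‖ₑ := by rw [Complex.re_add_im]
      _ ≤ ‖((μ s).re : ℂ)‖ₑ + ‖((μ s).im : ℂ) * Complex.I‖ₑ := enorm_add_le _ _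
      _ = _ := by
        rw [enorm_mul]
        simp [enorm_eq_nnnorm]
        rfl
  calc μ.variation Set.univ ≤ _ := h Set.univ
    _ < ∞ := measure_lt_top _ _

/-- The total variation norm `‖μ‖ = |μ|(X)` on the complex measures on `X`. -/
instance complexMeasureNormedAddCommGroup : NormedAddCommGroup (ComplexMeasure X) :=
  AddGroupNorm.toNormedAddCommGroup
    { toFun := fun μ => (μ.variation Set.univ).toReal
      map_zero' := by simp
      add_le' := fun μ ν => by
        rw [← ENNReal.toReal_add (complexMeasure_variation_lt_top μ).ne
          (complexMeasure_variation_lt_top ν).ne]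
        exact ENNReal.toReal_mono (ENNReal.add_lt_top.2 ⟨complexMeasure_variation_lt_top μ,
          complexMeasure_variation_lt_top ν⟩).ne (VectorMeasure.variation_add_le Set.univ)
      neg' := fun μ => by rw [VectorMeasure.variation_neg]
      eq_zero_of_map_eq_zero' := fun μ h => by
        rw [ENNReal.toReal_eq_zero_iff] at h
        have h0 := h.resolve_right (complexMeasure_variation_lt_top μ).ne
        exact VectorMeasure.variation_eq_zero.1 (Measure.measure_univ_eq_zero.1 h0) }

instance complexMeasureNormedSpace : NormedSpace ℂ (ComplexMeasure X) where
  norm_smul_le z μ := by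
    change ((z • μ).variation Set.univ).toReal ≤ ‖z‖ * (μ.variation Set.univ).toReal
    rw [VectorMeasure.variation_smul, Measure.smul_apply, ENNReal.smul_def, smul_eq_mul,
      ENNReal.toReal_mul]
    simp

end Variation

/-! ## The measure spaces -/

section Spaces

variable (E : Type*) [AddCommGroup E] [Module ℝ E] [MeasurableSpace E]

variable {E} in
/-- `𝓜(E_α)`: the complex measures concentrated on the subspace `α`, that is, vanishing on
the measurable sets disjoint from `α`. -/
def measuresOn (α : Submodule ℝ E) : Submodule ℂ (ComplexMeasure E) where
  carrier := {μ | ∀ Λ, MeasurableSet Λ → Disjoint Λ (α : Set E) → μ Λ = 0}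
  add_mem' := fun {μ ν} hμ hν Λ h d => by simp [hμ Λ h d, hν Λ h d]
  zero_mem' := fun Λ _ _ => by simp
  smul_mem' := fun z μ hμ Λ h d => by simp [hμ Λ h d]

variable {E} in
/-- `𝓜(E_α)_d`: the discrete measures on `α`, concentrated on a countable set. -/
def discreteMeasuresOn (α : Submodule ℝ E) : Submodule ℂ (ComplexMeasure E) where
  carrier := {μ | μ ∈ measuresOn α ∧ ∃ S : Set E, S.Countable ∧
    ∀ Λ, MeasurableSet Λ → Disjoint Λ S → μ Λ = 0}
  add_mem' := by
    rintro μ ν ⟨hμ, S, hS, h⟩ ⟨hν, T, hT, k⟩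
    refine ⟨add_mem hμ hν, S ∪ T, hS.union hT, fun Λ m d => ?_⟩
    rw [Set.disjoint_union_right] at d
    simp [h Λ m d.1, k Λ m d.2]
  zero_mem' := ⟨zero_mem _, ∅, Set.countable_empty, fun Λ _ _ => by simp⟩
  smul_mem' := by
    rintro z μ ⟨hμ, S, hS, h⟩
    exact ⟨Submodule.smul_mem _ z hμ, S, hS, fun Λ m d => by simp [h Λ m d]⟩

variable {E} in
/-- `𝓜(E_α)_c`: the continuous measures on `α`, those without atoms. -/
def continuousMeasuresOn (α : Submodule ℝ E) : Submodule ℂ (ComplexMeasure E) where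
  carrier := {μ | μ ∈ measuresOn α ∧ ∀ f : E, μ {f} = 0}
  add_mem' := fun {μ ν} hμ hν => ⟨add_mem hμ.1 hν.1, fun f => by simp [hμ.2 f, hν.2 f]⟩
  zero_mem' := ⟨zero_mem _, fun f => by simp⟩
  smul_mem' := fun z μ hμ => ⟨Submodule.smul_mem _ z hμ.1, fun f => by simp [hμ.2 f]⟩

variable {E} in
/-- `𝓜(E_α)_a`: the measures on `α` that are absolutely continuous with respect to the Haar measure
of `α` (which is unique up to a positive factor). -/
def absContMeasuresOn [TopologicalSpace E] (α : Submodule ℝ E) :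
    Submodule ℂ (ComplexMeasure E) where
  carrier := {μ | μ ∈ measuresOn α ∧ ∀ m : Measure α, m.IsAddHaarMeasure →
    ∀ Λ : Set E, MeasurableSet Λ → m ((↑) ⁻¹' Λ) = 0 → μ Λ = 0}
  add_mem' := fun {μ ν} hμ hν => ⟨add_mem hμ.1 hν.1, fun m hm Λ hΛ h => by
    simp [hμ.2 m hm Λ hΛ h, hν.2 m hm Λ hΛ h]⟩
  zero_mem' := ⟨zero_mem _, fun m hm Λ hΛ h => by simp⟩
  smul_mem' := fun z μ hμ => ⟨Submodule.smul_mem _ z hμ.1, fun m hm Λ hΛ h => by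
    simp [hμ.2 m hm Λ hΛ h]⟩

/-- `𝓜(E)`: the closure, in the total variation norm, of the union of the `𝓜(E_α)` over all
finite dimensional subspaces `E_α` of `E`. This union is directed, hence equal to the supremum. -/
def regularMeasures : Submodule ℂ (ComplexMeasure E) :=
  (⨆ α : {α : Submodule ℝ E // FiniteDimensional ℝ α}, measuresOn α.1).topologicalClosure

variable {E} in
lemma measuresOn_mono {α β : Submodule ℝ E} (h : α ≤ β) : measuresOn α ≤ measuresOn β :=
  fun _ hμ Λ hΛ hd => hμ Λ hΛ (hd.mono_right h)

/-- The space `𝓜(E)` is literally the closure of the union of the `𝓜(E_α)`. -/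
lemma coe_regularMeasures : (regularMeasures E : Set (ComplexMeasure E)) =
    closure (⋃ α : {α : Submodule ℝ E // FiniteDimensional ℝ α}, (measuresOn α.1 : Set _)) := by
  have : Nonempty {α : Submodule ℝ E // FiniteDimensional ℝ α} := ⟨⊥, inferInstance⟩
  rw [regularMeasures, Submodule.topologicalClosure_coe, Submodule.coe_iSup_of_directed]
  rintro ⟨α, hα⟩ ⟨β, hβ⟩
  exact ⟨⟨α ⊔ β, inferInstance⟩, measuresOn_mono le_sup_left, measuresOn_mono le_sup_right⟩

/-- `𝓜(E)_d` -/
def regularDiscrete : Submodule ℂ (regularMeasures E) :=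
  (⨆ α : {α : Submodule ℝ E // FiniteDimensional ℝ α},
    discreteMeasuresOn α.1).topologicalClosure.comap (regularMeasures E).subtype

/-- `𝓜(E)_c` -/
def regularContinuous : Submodule ℂ (regularMeasures E) :=
  (⨆ α : {α : Submodule ℝ E // FiniteDimensional ℝ α},
    continuousMeasuresOn α.1).topologicalClosure.comap (regularMeasures E).subtype

/-- `𝓜(E)_{df}`: the finite linear combinations of point measures. -/
def regularFinite : Submodule ℂ (regularMeasures E) :=
  (Submodule.span ℂ (Set.range fun f : E => (VectorMeasure.dirac f (1 : ℂ) :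
    ComplexMeasure E))).comap (regularMeasures E).subtype

variable {E} in
/-- `𝓜(E_α)_a` inside `𝓜(E)`. -/
def regularAbsCont [TopologicalSpace E] (α : Submodule ℝ E) : Submodule ℂ (regularMeasures E) :=
  (absContMeasuresOn α).comap (regularMeasures E).subtype

variable {E} in
/-- `𝓜_κ^n(E)`: the measures in `𝓜(E)` with finite absolute `m`-th moments `∫ κ(f)^m d|μ|(f)` for
all `m ≤ n`, where `n ∈ ℕ ∪ {∞}`. -/
def momentMeasures (κ : Seminorm ℝ E) (n : ℕ∞) : Submodule ℂ (regularMeasures E) where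
  carrier := {μ | ∀ m : ℕ, (m : ℕ∞) ≤ n →
    ∫⁻ f, ENNReal.ofReal (κ f ^ m) ∂(μ : ComplexMeasure E).variation < ∞}
  add_mem' := fun {μ ν} hμ hν m hm => by
    refine (lintegral_mono' (VectorMeasure.variation_add_le (μ := (μ : ComplexMeasure E))
      (ν := (ν : ComplexMeasure E))) le_rfl).trans_lt ?_
    rw [lintegral_add_measure]
    exact ENNReal.add_lt_top.2 ⟨hμ m hm, hν m hm⟩
  zero_mem' := fun m _ => by simp
  smul_mem' := fun z μ hμ m hm => by
    rw [Submodule.coe_smul, VectorMeasure.variation_smul, lintegral_smul_measure]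
    exact ENNReal.mul_lt_top ENNReal.coe_lt_top (hμ m hm)

end Spaces

/-! ## The operations on regular measures -/

section Operations

variable {E : Type*} [AddCommGroup E] [Module ℝ E] [MeasurableSpace E]

open Classical in
/-- The measure in `𝓜(E)` with the prescribed values `F Λ` on the measurable sets `Λ` (which is
unique), and `0` if there is none. -/
def measureOfValues (F : Set E → ℂ) : regularMeasures E :=
  if h : ∃ ρ : regularMeasures E, ∀ Λ, MeasurableSet Λ → (ρ : ComplexMeasure E) Λ = F Λ
  then h.choose else 0

/-- The iterated integral `∫ dμ(f) ∫ dν(g) k(f, g) Λ(f + g)`, where `Λ( )` denotes the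
characteristic function of the set `Λ`. -/
def convValue (k : E → E → ℂ) (μ ν : ComplexMeasure E) (Λ : Set E) : ℂ :=
  ∫ᵛ f, (∫ᵛ g, k f g * Λ.indicator (fun _ => (1 : ℂ)) (f + g)
    ∂[ContinuousLinearMap.mul ℝ ℂ; ν]) ∂[ContinuousLinearMap.mul ℝ ℂ; μ]

/-- The multiplier `exp(-(i/2) ħ σ(f, g))`. -/
def multiplier (σ : LinearMap.BilinForm ℝ E) (ħ : ℝ) (f g : E) : ℂ :=
  Complex.exp (-(Complex.I / 2) * ħ * σ f g)

/-- The deformed convolution product `μ ⋆_ħ ν`. -/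
def deformedConv (σ : LinearMap.BilinForm ℝ E) (ħ : ℝ) (μ ν : regularMeasures E) :
    regularMeasures E :=
  measureOfValues (convValue (multiplier σ ħ) μ ν)

/-- The involution `μ^*(Λ) = conj (μ(-Λ))`. -/
def measureStar (μ : regularMeasures E) : regularMeasures E :=
  measureOfValues fun Λ => (starRingEnd ℂ) ((μ : ComplexMeasure E) ((fun f => -f) ⁻¹' Λ))

/-- The Poisson bracket `{μ, ν}_0(Λ) = ∫ dμ(f) ∫ dν(g) σ(f, g) Λ(f + g)`. -/
def poissonBracket (σ : LinearMap.BilinForm ℝ E) (μ ν : regularMeasures E) : regularMeasures E :=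
  measureOfValues (convValue (fun f g => (σ f g : ℂ)) μ ν)

/-- The push-forward `T_* μ (Λ) = μ(T⁻¹(Λ))` along a linear map. -/
def pushMeasure {E' : Type*} [AddCommGroup E'] [Module ℝ E'] [MeasurableSpace E']
    (T : E →ₗ[ℝ] E') (μ : regularMeasures E) : regularMeasures E' :=
  measureOfValues fun Λ => (μ : ComplexMeasure E) (T ⁻¹' Λ)

/-- The seminorm `ς` controls the form `σ`: `|σ(f, g)| ≤ c ς(f) ς(g)` for some constant `c > 0`. -/
def ControlsForm (σ : LinearMap.BilinForm ℝ E) (ς : Seminorm ℝ E) : Prop :=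
  ∃ c : ℝ, 0 < c ∧ ∀ f g, |σ f g| ≤ c * ς f * ς g

/-- The list of the measure Poisson algebras belonging to `ς`. -/
inductive IsMeasurePoissonAlgebra [TopologicalSpace E] (ς : Seminorm ℝ E) :
    Submodule ℂ (regularMeasures E) → Prop
  /-- `𝓜_κ^∞(E)` with a seminorm `κ` stronger than `ς`. -/
  | moment (κ : Seminorm ℝ E) (c : ℝ) (h : ∀ f, ς f ≤ c * κ f) :
      IsMeasurePoissonAlgebra ς (momentMeasures κ ⊤)
  /-- The intersection of the `𝓜_κ^∞(E)` over a collection `K` of seminorms, finitely many of which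
  dominate `ς`. -/
  | moments (K : Set (Seminorm ℝ E)) (Γ : Finset (Seminorm ℝ E)) (hΓ : ∀ κ ∈ Γ, κ ∈ K)
      (c : Seminorm ℝ E → ℝ) (h : ∀ f, ς f ≤ ∑ κ ∈ Γ, c κ * κ f) :
      IsMeasurePoissonAlgebra ς (⨅ κ ∈ K, momentMeasures κ ⊤)
  | inf_discrete (P : Submodule ℂ (regularMeasures E)) (h : IsMeasurePoissonAlgebra ς P) :
      IsMeasurePoissonAlgebra ς (P ⊓ regularDiscrete E)
  | inf_continuous (P : Submodule ℂ (regularMeasures E)) (h : IsMeasurePoissonAlgebra ς P) :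
      IsMeasurePoissonAlgebra ς (P ⊓ regularContinuous E)
  | inf_absCont (P : Submodule ℂ (regularMeasures E)) (h : IsMeasurePoissonAlgebra ς P)
      (α : Submodule ℝ E) (hα : FiniteDimensional ℝ α) :
      IsMeasurePoissonAlgebra ς (P ⊓ regularAbsCont α)
  | finite : IsMeasurePoissonAlgebra ς (regularFinite E)

/-- The push-forward along `T : E → E'` is compatible with all structures of the quantization: it
is a contractive star-homomorphism for every `ħ`, respects the Poisson brackets, and maps the
constituents of the measure Poisson algebras on `E` to the corresponding ones on `E'`. -/
structure IsQuantizationMorphism {E' : Type*} [AddCommGroup E'] [Module ℝ E'] [MeasurableSpace E']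
    [TopologicalSpace E] [TopologicalSpace E'] (σ : LinearMap.BilinForm ℝ E)
    (σ' : LinearMap.BilinForm ℝ E') (T : E →ₗ[ℝ] E') : Prop where
  map_add : ∀ μ ν, pushMeasure T (μ + ν) = pushMeasure T μ + pushMeasure T ν
  map_smul : ∀ (z : ℂ) (μ), pushMeasure T (z • μ) = z • pushMeasure T μ
  norm_le : ∀ μ, ‖pushMeasure T μ‖ ≤ ‖μ‖
  map_star : ∀ μ, pushMeasure T (measureStar μ) = measureStar (pushMeasure T μ)
  map_mul : ∀ (ħ : ℝ) (μ ν), pushMeasure T (deformedConv σ ħ μ ν)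
    = deformedConv σ' ħ (pushMeasure T μ) (pushMeasure T ν)
  map_bracket : ∀ ς : Seminorm ℝ E, ControlsForm σ ς → ∀ μ ∈ momentMeasures ς 1,
    ∀ ν ∈ momentMeasures ς 1, pushMeasure T (poissonBracket σ μ ν)
      = poissonBracket σ' (pushMeasure T μ) (pushMeasure T ν)
  map_moment : ∀ (κ : Seminorm ℝ E) (κ' : Seminorm ℝ E') (c : ℝ), (∀ f, κ' (T f) ≤ c * κ f) →
    ∀ (n : ℕ∞), ∀ μ ∈ momentMeasures κ n, pushMeasure T μ ∈ momentMeasures κ' n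
  map_discrete : ∀ μ ∈ regularDiscrete E, pushMeasure T μ ∈ regularDiscrete E'
  map_continuous : Function.Injective T →
    ∀ μ ∈ regularContinuous E, pushMeasure T μ ∈ regularContinuous E'
  map_absCont : ∀ α : Submodule ℝ E, FiniteDimensional ℝ α →
    ∀ μ ∈ regularAbsCont α, pushMeasure T μ ∈ regularAbsCont (α.map T)
  map_finite : ∀ μ ∈ regularFinite E, pushMeasure T μ ∈ regularFinite E'

end Operations

end

noncomputable section

/-! ## Topology and measurability on spaces with the finest locally convex topology -/

section FinestTopology

variable {E : Type*} [AddCommGroup E] [Module ℝ E] [TopologicalSpace E] [IsFinestLocallyConvex E]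

/-! The difficulty is that `E` may be huge: addition and σ need not be measurable for the product
σ-algebra on `E × E`, so Fubini does not apply directly. What helps is that a measure in 𝓜(E) is a
norm limit of a sequence of measures on finite dimensional subspaces, hence carried by one
increasing sequence of such subspaces; conversely, any complex measure so carried is the limit of
its restrictions (`mem_regularMeasures_iff`). On a finite dimensional subspace everything is
measurable, and `FlagCarried.aemeasurable_prod` transfers this to almost everywhere measurability on
products.

The working tool is `ImageRep`: μ is the image, under a map `s` carried by such a sequence, of a
complex density `w` over a positive measure `m`. Radon-Nikodym provides representations with `s` the
identity. All operations act on these data: a twisted convolution with kernel `k` multiplies spaces,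
adds the maps and has density `k · w · w'` (`ImageRep.exists_conv`), the involution conjugates `w`
and negates `s`, and a push-forward replaces `s` by `T ∘ s`. Equal data give equal measures
(`ImageRep.eq_of`), so each algebraic law becomes a pointwise identity of densities on `E × E` or `E
× E × E`, up to a permutation of the factors: associativity is the cocycle identity of the
multiplier, and Jacobi and Leibniz follow from bilinearity and antisymmetry of σ. Since `‖μ‖ ≤ ∫
‖w‖`, norm estimates and both limits are statements about L¹ densities. The limits follow by
dominated convergence; for Dirac's condition the scaled commutator has kernel (2/ħ) sin(ħσ/2),
bounded by |σ|, which is integrable because of the first moments.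

For the listed Poisson algebras, the moment spaces are stable by an elementary inequality for powers
of a sum. The other classes are described by null sets of the variation, and these conditions
survive convolution with any density whatsoever (`ConvStable`). -/

instance finestLocallyConvex_isTopologicalAddGroup : IsTopologicalAddGroup E := by
  have h := IsFinestLocallyConvex.eq_finest (E := E)
  have : @IsTopologicalAddGroup E (finestLocallyConvexTopology E) _ :=
    topologicalAddGroup_sInf fun t ht => ht.1
  rwa [← h] at this

instance finestLocallyConvex_continuousSMul : ContinuousSMul ℝ E := by
  have h := IsFinestLocallyConvex.eq_finest (E := E)
  have : @ContinuousSMul ℝ E _ _ (finestLocallyConvexTopology E) :=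
    continuousSMul_sInf fun t ht => ht.2.1
  rwa [← h] at this

instance finestLocallyConvex_locallyConvexSpace : LocallyConvexSpace ℝ E := by
  have h := IsFinestLocallyConvex.eq_finest (E := E)
  have : @LocallyConvexSpace ℝ E _ _ _ _ (finestLocallyConvexTopology E) :=
    LocallyConvexSpace.sInf fun t ht => ht.2.2
  rwa [← h] at this

omit [TopologicalSpace E] [IsFinestLocallyConvex E] in
lemma IsFinestLocallyConvex.le_of_locallyConvex {t : TopologicalSpace E}
    (h : @IsFinestLocallyConvex E _ _ t) (s : TopologicalSpace E)
    (h₁ : @IsTopologicalAddGroup E s _) (h₂ : @ContinuousSMul ℝ E _ _ s)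
    (h₃ : @LocallyConvexSpace ℝ E _ _ _ _ s) : t ≤ s := by
  rw [h.eq_finest]
  exact sInf_le ⟨h₁, h₂, h₃⟩

/-- The topology induced along `T` is a locally convex vector space topology on the source, hence
coarser than the finest one. -/
lemma LinearMap.continuous_of_isFinestLocallyConvex {E' : Type*} [AddCommGroup E'] [Module ℝ E']
    [t : TopologicalSpace E'] [IsTopologicalAddGroup E'] [ContinuousSMul ℝ E']
    [LocallyConvexSpace ℝ E'] (T : E →ₗ[ℝ] E') : Continuous T :=
  continuous_iff_le_induced.2 (IsFinestLocallyConvex.le_of_locallyConvex ‹_› (t.induced T)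
    (topologicalAddGroup_induced T) (continuousSMul_induced T) (LocallyConvexSpace.induced T))

lemma Seminorm.continuous_of_isFinestLocallyConvex (κ : Seminorm ℝ E) : Continuous κ := by
  have hE : IsFinestLocallyConvex E := inferInstance
  let p : SeminormFamily ℝ E Unit := fun _ => κ
  let s : TopologicalSpace E := p.moduleFilterBasis.topology
  have hp : WithSeminorms p := ⟨rfl⟩
  have hle := hE.le_of_locallyConvex s hp.topologicalAddGroup hp.continuousSMul
    hp.toLocallyConvexSpace
  exact continuous_le_dom hle (hp.continuous_seminorm ())

/-- The algebraic dual separates points, and all its elements are continuous here. Hausdorffness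
makes finite dimensional subspaces closed, hence Borel. -/
instance finestLocallyConvex_t2Space : T2Space E := by
  refine T2Space.of_injective_continuous (f := fun x (φ : Module.Dual ℝ E) => φ x) ?_
    (continuous_pi fun φ => LinearMap.continuous_of_isFinestLocallyConvex φ)
  intro x y hxy
  refine sub_eq_zero.1 ((Module.forall_dual_apply_eq_zero_iff ℝ (x - y)).1 fun φ => ?_)
  rw [map_sub, sub_eq_zero]
  exact congrFun hxy φ

variable [MeasurableSpace E] [BorelSpace E]

lemma LinearMap.measurable_of_isFinestLocallyConvex {E' : Type*} [AddCommGroup E'] [Module ℝ E']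
    [TopologicalSpace E'] [IsTopologicalAddGroup E'] [ContinuousSMul ℝ E']
    [LocallyConvexSpace ℝ E'] [MeasurableSpace E'] [BorelSpace E'] (T : E →ₗ[ℝ] E') :
    Measurable T :=
  T.continuous_of_isFinestLocallyConvex.measurable

lemma Seminorm.measurable_of_isFinestLocallyConvex (κ : Seminorm ℝ E) : Measurable κ :=
  κ.continuous_of_isFinestLocallyConvex.measurable

lemma Submodule.measurableSet_of_finiteDimensional (α : Submodule ℝ E) [FiniteDimensional ℝ α] :
    MeasurableSet (α : Set E) :=
  (Submodule.closed_of_finiteDimensional α).measurableSet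

omit [MeasurableSpace E] [BorelSpace E] in
lemma Submodule.secondCountable_of_finiteDimensional (α : Submodule ℝ E)
    [FiniteDimensional ℝ α] : SecondCountableTopology α :=
  ((Module.finBasis ℝ α).equivFun.toContinuousLinearEquiv.toHomeomorph).secondCountableTopology

end FinestTopology

/-! ### Joint measurability along increasing sequences of finite dimensional subspaces -/

section FdMeasurable

variable {E : Type*} [AddCommGroup E] [Module ℝ E]

/-- The function `s` takes almost all of its values in the union of an increasing sequence of
finite dimensional subspaces. -/
def FlagCarried {X : Type*} [MeasurableSpace X] (m : Measure X) (s : X → E) : Prop :=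
  ∃ F : ℕ → Submodule ℝ E, (∀ n, FiniteDimensional ℝ (F n)) ∧ Monotone F ∧
    ∀ᵐ x ∂m, ∃ n, s x ∈ F n

/-- The function `φ` of two variables is measurable on the finite dimensional subspaces. -/
def FdMeasurable [MeasurableSpace E] {Z : Type*} [MeasurableSpace Z] (φ : E → E → Z) : Prop :=
  ∀ α : Submodule ℝ E, FiniteDimensional ℝ α → Measurable fun p : α × α => φ p.1 p.2

variable {X Y : Type*} [MeasurableSpace X] [MeasurableSpace Y]

lemma FlagCarried.common {m : Measure X} {m' : Measure Y} {s : X → E} {s' : Y → E}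
    (h : FlagCarried m s) (h' : FlagCarried m' s') :
    ∃ F : ℕ → Submodule ℝ E, (∀ n, FiniteDimensional ℝ (F n)) ∧ Monotone F ∧
      (∀ᵐ x ∂m, ∃ n, s x ∈ F n) ∧ ∀ᵐ y ∂m', ∃ n, s' y ∈ F n := by
  obtain ⟨F, hF, hm, hx⟩ := h
  obtain ⟨G, hG, hm', hy⟩ := h'
  refine ⟨fun n => F n ⊔ G n, fun n => inferInstance, fun i j hij => sup_le_sup (hm hij) (hm' hij),
    ?_, ?_⟩
  · filter_upwards [hx] with x ⟨n, hn⟩ using ⟨n, Submodule.mem_sup_left hn⟩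
  · filter_upwards [hy] with x ⟨n, hn⟩ using ⟨n, Submodule.mem_sup_right hn⟩

lemma FlagCarried.add {m : Measure X} {m' : Measure Y} [SFinite m] [SFinite m'] {s : X → E}
    {s' : Y → E} (h : FlagCarried m s) (h' : FlagCarried m' s') :
    FlagCarried (m.prod m') fun p => s p.1 + s' p.2 := by
  obtain ⟨F, hF, hm, hx, hy⟩ := h.common h'
  refine ⟨F, hF, hm, ?_⟩
  filter_upwards [Measure.quasiMeasurePreserving_fst.ae hx,
    Measure.quasiMeasurePreserving_snd.ae hy] with p ⟨i, hi⟩ ⟨j, hj⟩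
  exact ⟨max i j, add_mem (hm (le_max_left i j) hi) (hm (le_max_right i j) hj)⟩

lemma FlagCarried.linearMap {E' : Type*} [AddCommGroup E'] [Module ℝ E']
    {m : Measure X} {s : X → E} (h : FlagCarried m s) (T : E →ₗ[ℝ] E') :
    FlagCarried m fun x => T (s x) := by
  obtain ⟨F, hF, hm, hx⟩ := h
  refine ⟨fun n => (F n).map T, fun n => inferInstance, fun i j hij => Submodule.map_mono (hm hij),
    ?_⟩
  filter_upwards [hx] with x ⟨n, hn⟩ using ⟨n, Submodule.mem_map_of_mem hn⟩

lemma FlagCarried.sum_measure {m m' : Measure X} {s : X → E} (h : FlagCarried m s)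
    (h' : FlagCarried m' s) : FlagCarried (m + m') s := by
  obtain ⟨F, hF, hm, hx, hy⟩ := h.common h'
  exact ⟨F, hF, hm, ae_add_measure_iff.2 ⟨hx, hy⟩⟩

variable [TopologicalSpace E] [IsFinestLocallyConvex E] [MeasurableSpace E] [BorelSpace E]

/-- Measurability of `φ` is available only on finite dimensional subspaces. Countably many
rectangles over the squares `F n × F n` exhaust the product up to a null set, and a.e. measurability
can be checked on each of them. -/
lemma FlagCarried.aemeasurable_prod {Z : Type*} [MeasurableSpace Z] {m : Measure X}
    {m' : Measure Y} [SFinite m] [SFinite m'] {s : X → E} {s' : Y → E} (h : FlagCarried m s)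
    (h' : FlagCarried m' s') (hs : AEMeasurable s m) (hs' : AEMeasurable s' m') {φ : E → E → Z}
    (hφ : FdMeasurable φ) : AEMeasurable (fun p : X × Y => φ (s p.1) (s' p.2)) (m.prod m') := by
  obtain ⟨F, hF, hm, hx, hy⟩ := h.common h'
  have e₁ := Measure.quasiMeasurePreserving_fst (μ := m) (ν := m') |>.ae hs.ae_eq_mk
  have e₂ := Measure.quasiMeasurePreserving_snd (μ := m) (ν := m') |>.ae hs'.ae_eq_mk
  have c₁ := Measure.quasiMeasurePreserving_fst (μ := m) (ν := m') |>.ae hx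
  have c₂ := Measure.quasiMeasurePreserving_snd (μ := m) (ν := m') |>.ae hy
  let A : ℕ → Set (X × Y) := fun n => (hs.mk s ⁻¹' F n) ×ˢ (hs'.mk s' ⁻¹' F n)
  have hA : ∀ n, MeasurableSet (A n) := fun n =>
    (hs.measurable_mk (F n).measurableSet_of_finiteDimensional).prod
      (hs'.measurable_mk (F n).measurableSet_of_finiteDimensional)
  suffices AEMeasurable (fun p : X × Y => φ (hs.mk s p.1) (hs'.mk s' p.2)) (m.prod m') from
    this.congr (by filter_upwards [e₁, e₂] with p h₁ h₂; rw [h₁, h₂])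
  -- Monotonicity is what puts both coordinates into a single `F n`, with `n` the maximum of their
  -- indices.
  have hU : (m.prod m').restrict (⋃ n, A n) = m.prod m' := by
    rw [Measure.restrict_eq_self_of_ae_mem]
    filter_upwards [e₁, e₂, c₁, c₂] with p h₁ h₂ ⟨i, hi⟩ ⟨j, hj⟩
    refine Set.mem_iUnion.2 ⟨max i j, ?_, ?_⟩
    · rw [Set.mem_preimage, ← h₁]
      exact hm (le_max_left i j) hi
    · rw [Set.mem_preimage, ← h₂]
      exact hm (le_max_right i j) hj
  rw [← hU, aemeasurable_iUnion_iff]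
  intro n
  refine aemeasurable_restrict_of_measurable_subtype (hA n) ?_
  let g : A n → F n × F n := fun p => (⟨hs.mk s p.1.1, p.2.1⟩, ⟨hs'.mk s' p.1.2, p.2.2⟩)
  have hg : Measurable g := by
    refine Measurable.prodMk (Measurable.subtype_mk ?_) (Measurable.subtype_mk ?_)
    · exact hs.measurable_mk.comp (measurable_fst.comp measurable_subtype_coe)
    · exact hs'.measurable_mk.comp (measurable_snd.comp measurable_subtype_coe)
  exact (hφ (F n) (hF n)).comp hg

/-- A finite dimensional subspace is second countable, which makes its addition measurable for the
product σ-algebra. -/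
lemma fdMeasurable_add : FdMeasurable fun f g : E => f + g := by
  intro α _
  have := α.secondCountable_of_finiteDimensional
  have h : Measurable fun p : α × α => p.1 + p.2 := measurable_add
  exact measurable_subtype_coe.comp h

/-- Expanding the first argument in a basis of the subspace leaves a finite sum of products of
measurable functions of one variable. -/
lemma fdMeasurable_bilinForm (σ : LinearMap.BilinForm ℝ E) : FdMeasurable fun f g => σ f g := by
  intro α _
  let b := Module.finBasis ℝ α
  have h : (fun p : α × α => σ p.1 p.2) = fun p => ∑ i, b.coord i p.1 * σ (b i) p.2 := by
    funext p
    have h₁ : (p.1 : E) = ∑ i, b.coord i p.1 • (b i : E) := by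
      conv_lhs => rw [← b.sum_repr p.1]
      simp only [Submodule.coe_sum, Submodule.coe_smul, Module.Basis.coord_apply]
    rw [h₁]
    simp only [map_sum, map_smul, LinearMap.sum_apply, LinearMap.smul_apply, smul_eq_mul]
  rw [h]
  refine Finset.measurable_fun_sum _ fun i _ => Measurable.mul ?_ ?_
  · exact (LinearMap.continuous_of_finiteDimensional (b.coord i)).measurable.comp measurable_fst
  · exact (LinearMap.measurable_of_isFinestLocallyConvex (σ (b i))).comp
      (measurable_subtype_coe.comp measurable_snd)

lemma FlagCarried.aemeasurable_add {m : Measure X} {m' : Measure Y} [SFinite m] [SFinite m']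
    {s : X → E} {s' : Y → E} (h : FlagCarried m s) (h' : FlagCarried m' s')
    (hs : AEMeasurable s m) (hs' : AEMeasurable s' m') :
    AEMeasurable (fun p : X × Y => s p.1 + s' p.2) (m.prod m') :=
  h.aemeasurable_prod h' hs hs' fdMeasurable_add

end FdMeasurable

/-! ## Complex measures: densities and variation -/

section Density

variable {X : Type*} [MeasurableSpace X]

instance isFiniteMeasure_complexMeasure_variation (μ : ComplexMeasure X) :
    IsFiniteMeasure μ.variation :=
  ⟨complexMeasure_variation_lt_top μ⟩

lemma complexMeasure_norm_def (μ : ComplexMeasure X) : ‖μ‖ = (μ.variation Set.univ).toReal := rfl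

lemma complexMeasure_variation_univ (μ : ComplexMeasure X) :
    μ.variation Set.univ = ENNReal.ofReal ‖μ‖ :=
  (ENNReal.ofReal_toReal (complexMeasure_variation_lt_top μ).ne).symm

/-- The Radon-Nikodym theorem for complex measures, with the density of the variation. -/
lemma exists_density {μ : ComplexMeasure X} {m : Measure X} [IsFiniteMeasure m]
    (h : μ.variation ≪ m) : ∃ w : X → ℂ, Measurable w ∧ Integrable w m ∧ m.withDensityᵥ w = μ ∧
      μ.variation = m.withDensity fun x => ‖w x‖ₑ := by
  have hμ : μ ≪ᵥ m.toENNRealVectorMeasure := by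
    refine VectorMeasure.AbsolutelyContinuous.mk fun s hs h0 => ?_
    rw [Measure.toENNRealVectorMeasure_apply_measurable hs] at h0
    have := (VectorMeasure.enorm_measure_le_variation μ s).trans (h h0).le
    simpa using this
  -- The real and the imaginary part have real densities, from which the complex density is
  -- assembled.
  have hre := SignedMeasure.withDensityᵥ_rnDeriv_eq (ComplexMeasure.re μ) m
    ((ComplexMeasure.absolutelyContinuous_ennreal_iff _ _).1 hμ).1
  have him := SignedMeasure.withDensityᵥ_rnDeriv_eq (ComplexMeasure.im μ) m
    ((ComplexMeasure.absolutelyContinuous_ennreal_iff _ _).1 hμ).2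
  have hint : Integrable (μ.rnDeriv m) m := ComplexMeasure.integrable_rnDeriv μ m
  have heq : m.withDensityᵥ (μ.rnDeriv m) = μ := by
    ext s hs
    rw [withDensityᵥ_apply hint hs]
    have h₁ := congrArg (fun ν : SignedMeasure X => ν s) hre
    have h₂ := congrArg (fun ν : SignedMeasure X => ν s) him
    simp only [withDensityᵥ_apply (SignedMeasure.integrable_rnDeriv _ _) hs] at h₁ h₂
    have e₁ : ComplexMeasure.re μ s = (μ s).re := rfl
    have e₂ : ComplexMeasure.im μ s = (μ s).im := rfl
    rw [e₁] at h₁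
    rw [e₂] at h₂
    apply Complex.ext
    · have := setIntegral_re_add_im (𝕜 := ℂ) (i := s) (μ := m) hint.integrableOn
      rw [← this]
      simpa [ComplexMeasure.rnDeriv] using h₁
    · have := setIntegral_re_add_im (𝕜 := ℂ) (i := s) (μ := m) hint.integrableOn
      rw [← this]
      simpa [ComplexMeasure.rnDeriv] using h₂
  refine ⟨μ.rnDeriv m, ?_, hint, heq, ?_⟩
  · have h₁ := SignedMeasure.measurable_rnDeriv (ComplexMeasure.re μ) m
    have h₂ := SignedMeasure.measurable_rnDeriv (ComplexMeasure.im μ) m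
    exact Complex.measurableEquivRealProd.symm.measurable.comp (h₁.prodMk h₂)
  · conv_lhs => rw [← heq]
    exact Measure.variation_withDensityᵥ hint

lemma variation_le_add_norm_sub (μ ν : ComplexMeasure X) (A : Set X) :
    μ.variation A ≤ ν.variation A + ENNReal.ofReal ‖μ - ν‖ := by
  calc μ.variation A = (ν + (μ - ν)).variation A := by rw [add_sub_cancel]
    _ ≤ ν.variation A + (μ - ν).variation A := VectorMeasure.variation_add_le A
    _ ≤ ν.variation A + ENNReal.ofReal ‖μ - ν‖ := by
      rw [← complexMeasure_variation_univ]
      gcongr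
      exact Set.subset_univ A

/-- The variation of a fixed set changes by at most the norm distance of the measures. Thus null-set
conditions are norm closed, which is how the closures in the definitions are computed. -/
lemma variation_eq_zero_of_tendsto {μ : ComplexMeasure X} {u : ℕ → ComplexMeasure X}
    (hu : Tendsto u atTop (𝓝 μ)) {A : Set X} (hA : ∀ n, (u n).variation A = 0) :
    μ.variation A = 0 := by
  have h : Tendsto (fun n => ENNReal.ofReal ‖μ - u n‖) atTop (𝓝 0) := by
    have h₁ : Tendsto (fun n => ‖μ - u n‖) atTop (𝓝 0) := by
      simpa only [norm_sub_rev] using tendsto_iff_norm_sub_tendsto_zero.1 hu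
    simpa using ENNReal.tendsto_ofReal h₁
  refine le_antisymm (ge_of_tendsto' h fun n => ?_) zero_le
  simpa [hA n] using variation_le_add_norm_sub μ (u n) A

/-- The error is the restriction to the complement of `A n`; its norm is the variation of that
complement, which tends to zero by continuity from above. -/
lemma tendsto_restrict_of_monotone {μ : ComplexMeasure X} {A : ℕ → Set X} (hA : Monotone A)
    (hm : ∀ n, MeasurableSet (A n)) (h : μ.variation (⋃ n, A n)ᶜ = 0) :
    Tendsto (fun n => μ.restrict (A n)) atTop (𝓝 μ) := by
  have hsub : ∀ n, μ.restrict (A n) - μ = -μ.restrict (A n)ᶜ := fun n => by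
    rw [sub_eq_iff_eq_add, neg_add_eq_sub, eq_sub_iff_add_eq]
    exact VectorMeasure.restrict_add_restrict_compl (hm n)
  rw [tendsto_iff_norm_sub_tendsto_zero]
  have h₁ : Tendsto (fun n => μ.variation (A n)ᶜ) atTop (𝓝 (μ.variation (⋂ n, (A n)ᶜ))) :=
    tendsto_measure_iInter_atTop (fun n => (hm n).compl.nullMeasurableSet)
      (fun i j hij => Set.compl_subset_compl.2 (hA hij)) ⟨0, measure_ne_top _ _⟩
  rw [← Set.compl_iUnion, h] at h₁
  have h₂ := (ENNReal.tendsto_toReal ENNReal.zero_ne_top).comp h₁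
  refine h₂.congr fun n => ?_
  rw [hsub, norm_neg, complexMeasure_norm_def, VectorMeasure.variation_restrict (hm n).compl]
  simp

/-- The space of complex measures is complete in the total variation norm. -/
instance completeSpace_complexMeasure : CompleteSpace (ComplexMeasure X) := by
  refine NormedAddCommGroup.completeSpace_of_summable_imp_tendsto fun u hu => ?_
  -- The sum of the variations is a finite measure dominating every term, so the whole series lives
  -- isometrically in the complete space L¹(m).
  let m : Measure X := Measure.sum fun n => (u n).variation
  have hm : IsFiniteMeasure m := by
    constructor
    rw [Measure.sum_apply _ MeasurableSet.univ]
    simp only [complexMeasure_variation_univ]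
    rw [← ENNReal.ofReal_tsum_of_nonneg (fun n => norm_nonneg _) hu]
    exact ENNReal.ofReal_lt_top
  have hac : ∀ n, (u n).variation ≪ m := fun n =>
    Measure.absolutelyContinuous_of_le (Measure.le_sum _ n)
  choose w hwm hwi hw hwv using fun n => exists_density (hac n)
  have hnorm : ∀ f : X → ℂ, ∀ hf : Integrable f m, ‖m.withDensityᵥ f‖ = ‖hf.toL1 f‖ := by
    intro f hf
    rw [complexMeasure_norm_def, Measure.variation_withDensityᵥ hf, L1.norm_def]
    rw [withDensity_apply _ MeasurableSet.univ, Measure.restrict_univ]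
    congr 1
    exact (lintegral_congr_ae (hf.coeFn_toL1.mono fun x hx => by rw [hx])).symm
  have hsum : Summable fun n => (hwi n).toL1 (w n) := by
    refine Summable.of_norm (hu.congr fun n => ?_)
    rw [← hnorm, hw]
  refine ⟨m.withDensityᵥ (∑' n, (hwi n).toL1 (w n) : X →₁[m] ℂ), ?_⟩
  rw [tendsto_iff_norm_sub_tendsto_zero]
  have h := tendsto_iff_norm_sub_tendsto_zero.1 hsum.hasSum.tendsto_sum_nat
  refine h.congr fun N => ?_
  have hfin : ∑ n ∈ Finset.range N, u n
      = m.withDensityᵥ (∑ n ∈ Finset.range N, (hwi n).toL1 (w n) : X →₁[m] ℂ) := by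
    induction N with
    | zero =>
      have : m.withDensityᵥ ((0 : X →₁[m] ℂ) : X → ℂ) = 0 := by
        rw [WithDensityᵥEq.congr_ae (Lp.coeFn_zero ℂ 1 m), withDensityᵥ_zero]
      simpa using this.symm
    | succ N ih =>
      rw [Finset.sum_range_succ, Finset.sum_range_succ, ih,
        WithDensityᵥEq.congr_ae (Lp.coeFn_add _ _),
        withDensityᵥ_add (L1.integrable_coeFn _) (L1.integrable_coeFn _),
        WithDensityᵥEq.congr_ae (hwi N).coeFn_toL1, hw]
  rw [hfin, ← withDensityᵥ_sub (L1.integrable_coeFn _) (L1.integrable_coeFn _),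
    ← WithDensityᵥEq.congr_ae (Lp.coeFn_sub _ _), hnorm _ (L1.integrable_coeFn _),
    Integrable.toL1_coeFn]

end Density

/-! ## Representations of complex measures as images of densities -/

section ImageRep

variable {E : Type*} [AddCommGroup E] [Module ℝ E] [MeasurableSpace E]
variable {X : Type*} [MeasurableSpace X]

/-- The complex measure `μ` on `E` is the image under `s` of the measure with density `w` with
respect to `m`, where `s` essentially takes values in a countable union of finite dimensional
subspaces. -/
structure ImageRep (μ : ComplexMeasure E) (m : Measure X) (w : X → ℂ) (s : X → E) : Prop where
  carried : FlagCarried m s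
  aemeas : AEMeasurable s m
  int : Integrable w m
  apply : ∀ Λ, MeasurableSet Λ → μ Λ = ∫ x, Λ.indicator (fun _ => (1 : ℂ)) (s x) * w x ∂m

/-- The positive measure which is the image under `s` of the density `‖w‖` with respect to `m`. -/
def absImage (m : Measure X) (w : X → ℂ) (s : X → E) : Measure E :=
  (m.withDensity fun x => ‖w x‖ₑ).map s

section AbsImage

variable {m : Measure X} {w : X → ℂ} {s : X → E}

omit [AddCommGroup E] [Module ℝ E]

lemma isFiniteMeasure_absImage (hw : Integrable w m) : IsFiniteMeasure (absImage m w s) := by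
  have : IsFiniteMeasure (m.withDensity fun x => ‖w x‖ₑ) := isFiniteMeasure_withDensity hw.2.ne
  exact Measure.isFiniteMeasure_map _ _

lemma lintegral_absImage (hs : AEMeasurable s m) (hw : Integrable w m) {φ : E → ℝ≥0∞}
    (hφ : AEMeasurable φ (absImage m w s)) :
    ∫⁻ f, φ f ∂absImage m w s = ∫⁻ x, ‖w x‖ₑ * φ (s x) ∂m := by
  have hs' : AEMeasurable s (m.withDensity fun x => ‖w x‖ₑ) :=
    hs.mono_ac (withDensity_absolutelyContinuous _ _)
  rw [absImage, lintegral_map' hφ hs']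
  exact lintegral_withDensity_eq_lintegral_mul₀' hw.aestronglyMeasurable.enorm
    (hφ.comp_aemeasurable hs')

lemma ae_absImage_of_ae (hs : AEMeasurable s m) {p : E → Prop}
    (hp : MeasurableSet {f | p f}) (h : ∀ᵐ x ∂m, p (s x)) : ∀ᵐ f ∂absImage m w s, p f := by
  rw [absImage, ae_map_iff (hs.mono_ac (withDensity_absolutelyContinuous _ _)) hp]
  exact (withDensity_absolutelyContinuous _ _).ae_le h

/-- The function `φ ∘ s` is controlled only where `w ≠ 0`; elsewhere the factor `w` kills the
product. -/
lemma aestronglyMeasurable_comp_mul (hs : AEMeasurable s m) (hw : Integrable w m)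
    {φ : E → ℂ} (hφ : AEStronglyMeasurable φ (absImage m w s)) :
    AEStronglyMeasurable (fun x => φ (s x) * w x) m := by
  have hs' : AEMeasurable s (m.withDensity fun x => ‖w x‖ₑ) :=
    hs.mono_ac (withDensity_absolutelyContinuous _ _)
  obtain ⟨g, hg, hφg⟩ := hφ.comp_aemeasurable hs'
  refine (hg.aestronglyMeasurable.mul hw.aestronglyMeasurable).congr ?_
  filter_upwards [(ae_withDensity_iff' hw.aestronglyMeasurable.enorm).1 hφg] with x hx
  by_cases h0 : w x = 0
  · simp [h0]
  · have := hx (by simpa using h0)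
    simp only [Function.comp_apply] at this
    simp only [Pi.mul_apply, this]

lemma integrable_absImage_iff (hs : AEMeasurable s m) (hw : Integrable w m) {φ : E → ℂ}
    (hφ : AEStronglyMeasurable φ (absImage m w s)) :
    Integrable φ (absImage m w s) ↔ Integrable (fun x => φ (s x) * w x) m := by
  have h : ∫⁻ f, ‖φ f‖ₑ ∂absImage m w s = ∫⁻ x, ‖φ (s x) * w x‖ₑ ∂m := by
    rw [lintegral_absImage hs hw hφ.enorm]
    simp only [enorm_mul, mul_comm]
  simp only [Integrable, hφ, aestronglyMeasurable_comp_mul hs hw hφ, true_and,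
    HasFiniteIntegral, h]

end AbsImage

variable {μ ν : ComplexMeasure E} {m : Measure X} {w v : X → ℂ} {s : X → E}

omit [AddCommGroup E] [Module ℝ E] in
lemma aestronglyMeasurable_indicator_comp {Λ : Set E} (hΛ : MeasurableSet Λ)
    (hs : AEMeasurable s m) :
    AEStronglyMeasurable (fun x => Λ.indicator (fun _ => (1 : ℂ)) (s x)) m :=
  ((measurable_const.indicator hΛ).comp_aemeasurable hs).aestronglyMeasurable

omit [AddCommGroup E] [Module ℝ E] in
lemma integrable_indicator_mul {Λ : Set E} (hΛ : MeasurableSet Λ) (hs : AEMeasurable s m)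
    (hw : Integrable w m) :
    Integrable (fun x => Λ.indicator (fun _ => (1 : ℂ)) (s x) * w x) m := by
  refine hw.bdd_mul (c := 1) (aestronglyMeasurable_indicator_comp hΛ hs) ?_
  filter_upwards with x
  by_cases h : s x ∈ Λ <;> simp [h]

namespace ImageRep

lemma isFiniteMeasure_absImage (h : ImageRep μ m w s) : IsFiniteMeasure (absImage m w s) :=
  _root_.isFiniteMeasure_absImage h.int

/-- The variation is the least measure dominating `‖μ Λ‖`, and the triangle inequality for the
integral gives this bound. Only an inequality can be expected, since `s` may superpose mass with
cancelling phases. -/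
lemma variation_le (h : ImageRep μ m w s) : μ.variation ≤ absImage m w s := by
  refine VectorMeasure.variation_le_of_forall_enorm_le fun Λ hΛ => ?_
  rw [h.apply Λ hΛ, ← lintegral_indicator_one hΛ,
    lintegral_absImage h.aemeas h.int (measurable_one.indicator hΛ).aemeasurable]
  refine (enorm_integral_le_lintegral_enorm _).trans (lintegral_mono fun x => ?_)
  by_cases hx : s x ∈ Λ <;> simp [hx]

lemma lintegral_variation_le (h : ImageRep μ m w s) {φ : E → ℝ≥0∞} (hφ : Measurable φ) :
    ∫⁻ f, φ f ∂μ.variation ≤ ∫⁻ x, ‖w x‖ₑ * φ (s x) ∂m := by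
  rw [← lintegral_absImage h.aemeas h.int hφ.aemeasurable]
  exact lintegral_mono' h.variation_le le_rfl

lemma norm_le (h : ImageRep μ m w s) : ‖μ‖ ≤ ∫ x, ‖w x‖ ∂m := by
  rw [complexMeasure_norm_def, integral_norm_eq_lintegral_enorm h.int.aestronglyMeasurable]
  refine ENNReal.toReal_mono h.int.2.ne ?_
  have := h.lintegral_variation_le (φ := fun _ => 1) measurable_const
  simpa using this

lemma congr (h : ImageRep μ m w s) {w' : X → ℂ} (hw : w =ᵐ[m] w') : ImageRep μ m w' s where
  carried := h.carried
  aemeas := h.aemeas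
  int := h.int.congr hw
  apply Λ hΛ := by
    rw [h.apply Λ hΛ]
    refine integral_congr_ae ?_
    filter_upwards [hw] with x hx
    rw [hx]

lemma congr_map (h : ImageRep μ m w s) {s' : X → E} (hs : ∀ x, s x = s' x) :
    ImageRep μ m w s' := by
  obtain rfl : s = s' := funext hs
  exact h

lemma unique (h : ImageRep μ m w s) (h' : ImageRep ν m w s) : μ = ν := by
  ext Λ hΛ
  rw [h.apply Λ hΛ, h'.apply Λ hΛ]

lemma add (h : ImageRep μ m w s) (h' : ImageRep ν m v s) :
    ImageRep (μ + ν) m (fun x => w x + v x) s where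
  carried := h.carried
  aemeas := h.aemeas
  int := h.int.add h'.int
  apply Λ hΛ := by
    rw [FunLike.coe_add, Pi.add_apply, h.apply Λ hΛ, h'.apply Λ hΛ, ← integral_add
      (integrable_indicator_mul hΛ h.aemeas h.int) (integrable_indicator_mul hΛ h.aemeas h'.int)]
    simp only [mul_add]

lemma smul (h : ImageRep μ m w s) (z : ℂ) : ImageRep (z • μ) m (fun x => z * w x) s where
  carried := h.carried
  aemeas := h.aemeas
  int := h.int.const_mul z
  apply Λ hΛ := by
    rw [FunLike.coe_smul, Pi.smul_apply, h.apply Λ hΛ, smul_eq_mul, ← integral_const_mul]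
    simp only [mul_left_comm]

lemma neg (h : ImageRep μ m w s) : ImageRep (-μ) m (fun x => -w x) s := by
  simpa using h.smul (-1)

lemma sub (h : ImageRep μ m w s) (h' : ImageRep ν m v s) :
    ImageRep (μ - ν) m (fun x => w x - v x) s := by
  simpa [sub_eq_add_neg] using h.add h'.neg

/-- Transport along a measure preserving equivalence. -/
lemma comp_equiv {Y : Type*} [MeasurableSpace Y] {m' : Measure Y} (h : ImageRep μ m w s)
    (e : Y ≃ᵐ X) (he : MeasurePreserving e m' m) :
    ImageRep μ m' (fun y => w (e y)) fun y => s (e y) where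
  carried := by
    obtain ⟨F, hF, hm, hx⟩ := h.carried
    exact ⟨F, hF, hm, he.quasiMeasurePreserving.ae hx⟩
  aemeas := h.aemeas.comp_quasiMeasurePreserving he.quasiMeasurePreserving
  int := (he.integrable_comp_emb e.measurableEmbedding).2 h.int
  apply Λ hΛ := by
    rw [h.apply Λ hΛ]
    exact (he.integral_comp e.measurableEmbedding _).symm

/-- Integrals with respect to a represented measure. -/
lemma integral_eq (h : ImageRep μ m w s) {φ : E → ℂ} (hφ : Integrable φ (absImage m w s)) :
    ∫ᵛ f, φ f ∂[ContinuousLinearMap.mul ℝ ℂ; μ] = ∫ x, φ (s x) * w x ∂m := by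
  have hle := h.variation_le
  have hfin := h.isFiniteMeasure_absImage
  have key : ∀ φ : E → ℂ, Integrable φ (absImage m w s) →
      Integrable (fun x => φ (s x) * w x) m := fun φ hφ =>
    (integrable_absImage_iff h.aemeas h.int hφ.aestronglyMeasurable).1 hφ
  refine Integrable.induction (μ := absImage m w s) (fun φ =>
    ∫ᵛ f, φ f ∂[ContinuousLinearMap.mul ℝ ℂ; μ] = ∫ x, φ (s x) * w x ∂m) ?_ ?_ ?_ ?_ hφ
  · intro c Λ hΛ _
    rw [VectorMeasure.integral_indicator_const _ hΛ, h.apply _ hΛ, ContinuousLinearMap.mul_apply',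
      ← integral_const_mul]
    refine integral_congr_ae (Eventually.of_forall fun x => ?_)
    simp only [Set.indicator]
    split_ifs <;> simp
  · intro f g hd hf hg hPf hPg
    simp only [Pi.add_apply, add_mul]
    rw [VectorMeasure.integral_fun_add (hf.mono_measure hle) (hg.mono_measure hle), hPf, hPg,
      integral_add (key _ hf) (key _ hg)]
  -- Both sides are L¹-continuous in `φ`: the left one because the variation is at most `absImage m
  -- w s`, the right one because the change of variables preserves L¹ distances.
  · refine IsSeqClosed.isClosed fun u φ hu hlim => ?_
    simp only [Set.mem_ofPred_eq] at hu ⊢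
    have h₁ := (Lp.tendsto_Lp_iff_tendsto_eLpNorm' _ _).1 hlim
    have t₁ : Tendsto (fun n => ∫ᵛ f, u n f ∂[ContinuousLinearMap.mul ℝ ℂ; μ]) atTop
        (𝓝 (∫ᵛ f, φ f ∂[ContinuousLinearMap.mul ℝ ℂ; μ])) := by
      refine VectorMeasure.tendsto_integral_of_L1' _
        ((L1.integrable_coeFn φ).mono_measure hle).aestronglyMeasurable
        (Eventually.of_forall fun n => (L1.integrable_coeFn (u n)).mono_measure hle) ?_
      exact tendsto_of_tendsto_of_tendsto_of_le_of_le tendsto_const_nhds h₁ (fun _ => zero_le)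
        fun n => eLpNorm_mono_measure _ hle
    have t₂ : Tendsto (fun n => ∫ x, u n (s x) * w x ∂m) atTop (𝓝 (∫ x, φ (s x) * w x ∂m)) := by
      refine tendsto_integral_of_L1 _ (key _ (L1.integrable_coeFn φ)).aestronglyMeasurable
        (Eventually.of_forall fun n => key _ (L1.integrable_coeFn (u n))) (h₁.congr fun n => ?_)
      rw [eLpNorm_one_eq_lintegral_enorm, lintegral_absImage h.aemeas h.int
        ((Lp.aestronglyMeasurable _).sub (Lp.aestronglyMeasurable _)).enorm]
      refine lintegral_congr fun x => ?_
      rw [← sub_mul, enorm_mul, mul_comm, Pi.sub_apply]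
    exact tendsto_nhds_unique (t₁.congr hu) t₂
  · intro f g hfg hf hP
    rw [← VectorMeasure.integral_congr_ae (Measure.absolutelyContinuous_of_le hle |>.ae_le hfg), hP]
    refine integral_congr_ae ?_
    -- Equality almost everywhere for the image measure says nothing where `w = 0`, but the
    -- integrand vanishes there.
    have h₂ := ae_of_ae_map
      (h.aemeas.mono_ac (withDensity_absolutelyContinuous _ fun x => ‖w x‖ₑ)) hfg
    filter_upwards [(ae_withDensity_iff' h.int.aestronglyMeasurable.enorm).1 h₂] with x hx
    by_cases h0 : w x = 0
    · simp [h0]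
    · rw [hx (by simpa using h0)]

end ImageRep

end ImageRep

/-! ## Regular measures -/

section Regular

variable {E : Type*} [AddCommGroup E] [Module ℝ E] [MeasurableSpace E]

lemma coe_topologicalClosure_iSup_finiteDimensional
    {V : Submodule ℝ E → Submodule ℂ (ComplexMeasure E)}
    (hV : Monotone V) :
    ((⨆ α : {α : Submodule ℝ E // FiniteDimensional ℝ α}, V α.1).topologicalClosure :
      Set (ComplexMeasure E))
      = closure (⋃ α : {α : Submodule ℝ E // FiniteDimensional ℝ α}, (V α.1 : Set _)) := by
  have : Nonempty {α : Submodule ℝ E // FiniteDimensional ℝ α} := ⟨⊥, inferInstance⟩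
  rw [Submodule.topologicalClosure_coe, Submodule.coe_iSup_of_directed]
  rintro ⟨α, hα⟩ ⟨β, hβ⟩
  exact ⟨⟨α ⊔ β, inferInstance⟩, hV le_sup_left, hV le_sup_right⟩

/-- An element of the closure of a directed union of spaces of measures is the limit of a
sequence of measures belonging to finite dimensional subspaces. -/
lemma exists_seq_of_mem_closure {V : Submodule ℝ E → Submodule ℂ (ComplexMeasure E)}
    (hV : Monotone V) {μ : ComplexMeasure E}
    (h : μ ∈ (⨆ α : {α : Submodule ℝ E // FiniteDimensional ℝ α}, V α.1).topologicalClosure) :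
    ∃ (u : ℕ → ComplexMeasure E) (α : ℕ → Submodule ℝ E), (∀ n, FiniteDimensional ℝ (α n)) ∧
      (∀ n, u n ∈ V (α n)) ∧ Tendsto u atTop (𝓝 μ) := by
  rw [← SetLike.mem_coe, coe_topologicalClosure_iSup_finiteDimensional hV,
    mem_closure_iff_seq_limit] at h
  obtain ⟨u, hu, hlim⟩ := h
  choose α hα using fun n => Set.mem_iUnion.1 (hu n)
  exact ⟨u, fun n => (α n).1, fun n => (α n).2, hα, hlim⟩

lemma mem_closure_of_tendsto_of_mem {V : Submodule ℝ E → Submodule ℂ (ComplexMeasure E)}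
    {μ : ComplexMeasure E} {u : ℕ → ComplexMeasure E} {F : ℕ → Submodule ℝ E}
    (hF : ∀ n, FiniteDimensional ℝ (F n)) (hu : ∀ n, u n ∈ V (F n))
    (h : Tendsto u atTop (𝓝 μ)) :
    μ ∈ (⨆ α : {α : Submodule ℝ E // FiniteDimensional ℝ α}, V α.1).topologicalClosure :=
  mem_closure_of_tendsto h <| Eventually.of_forall fun n =>
    Submodule.mem_iSup_of_mem (p := fun α : {α : Submodule ℝ E // FiniteDimensional ℝ α} => V α.1)
      ⟨F n, hF n⟩ (hu n)

/-- A complex measure is determined by its values on measurable sets, so the choice in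
`measureOfValues` is harmless. -/
lemma measureOfValues_apply {F : Set E → ℂ} (ρ : regularMeasures E)
    (hρ : ∀ Λ, MeasurableSet Λ → (ρ : ComplexMeasure E) Λ = F Λ) : measureOfValues F = ρ := by
  have h : ∃ ρ : regularMeasures E, ∀ Λ, MeasurableSet Λ → (ρ : ComplexMeasure E) Λ = F Λ :=
    ⟨ρ, hρ⟩
  rw [measureOfValues, dif_pos h]
  refine Subtype.ext (VectorMeasure.ext fun Λ hΛ => ?_)
  rw [h.choose_spec Λ hΛ, hρ Λ hΛ]

variable [TopologicalSpace E] [IsFinestLocallyConvex E] [BorelSpace E]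

lemma measurableSet_iUnion_finiteDimensional {F : ℕ → Submodule ℝ E}
    (hF : ∀ n, FiniteDimensional ℝ (F n)) : MeasurableSet (⋃ n, (F n : Set E)) :=
  MeasurableSet.iUnion fun n => (F n).measurableSet_of_finiteDimensional

lemma mem_measuresOn_iff {α : Submodule ℝ E} [FiniteDimensional ℝ α] {μ : ComplexMeasure E} :
    μ ∈ measuresOn α ↔ μ.variation (α : Set E)ᶜ = 0 := by
  rw [VectorMeasure.variation_apply_eq_zero α.measurableSet_of_finiteDimensional.compl]
  exact ⟨fun h t ht hm => h t hm (Set.disjoint_left.2 fun x hx hxα => ht hx hxα),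
    fun h t hm ht => h t (fun x hx hxα => Set.disjoint_left.1 ht hx hxα) hm⟩

lemma restrict_mem_measuresOn (μ : ComplexMeasure E) (α : Submodule ℝ E)
    [FiniteDimensional ℝ α] : μ.restrict (α : Set E) ∈ measuresOn α := by
  rw [mem_measuresOn_iff,
    VectorMeasure.variation_restrict α.measurableSet_of_finiteDimensional]
  rw [Measure.restrict_apply α.measurableSet_of_finiteDimensional.compl]
  simp

/-- A measure carried by an increasing sequence of finite dimensional subspaces is in the closure
of the union of any spaces containing its restrictions to these subspaces. -/
lemma mem_closure_of_flagCarried {V : Submodule ℝ E → Submodule ℂ (ComplexMeasure E)}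
    {μ : ComplexMeasure E} (h : FlagCarried μ.variation (id : E → E))
    (hV : ∀ α : Submodule ℝ E, FiniteDimensional ℝ α → μ.restrict (α : Set E) ∈ V α) :
    μ ∈ (⨆ α : {α : Submodule ℝ E // FiniteDimensional ℝ α}, V α.1).topologicalClosure := by
  obtain ⟨F, hF, hm, hx⟩ := h
  refine mem_closure_of_tendsto_of_mem hF (fun n => hV (F n) (hF n))
    (tendsto_restrict_of_monotone (fun i j hij => hm hij)
      (fun n => (F n).measurableSet_of_finiteDimensional) ?_)
  rw [← mem_ae_iff]
  filter_upwards [hx] with x hx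
  simpa using hx

/-- An approximating sequence involves only countably many subspaces, and the limit is null off
their union. Conversely, restrictions to the members of the flag converge to the measure. This
replaces a closure by a condition that is easy to propagate. -/
lemma mem_regularMeasures_iff {μ : ComplexMeasure E} :
    μ ∈ regularMeasures E ↔ FlagCarried μ.variation (id : E → E) := by
  refine ⟨fun h => ?_, fun h => mem_closure_of_flagCarried h fun α _ =>
    restrict_mem_measuresOn μ α⟩
  obtain ⟨u, α, hα, hu, hlim⟩ := exists_seq_of_mem_closure (fun _ _ => measuresOn_mono) h
  -- The range goes up to `n + 1` so that `α n` itself is contained in `F n`.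
  let F : ℕ → Submodule ℝ E := fun n => (Finset.range (n + 1)).sup α
  have hF : ∀ n, FiniteDimensional ℝ (F n) := fun n => Submodule.finiteDimensional_finset_sup _ _
  refine ⟨F, hF, fun i j hij => Finset.sup_mono (by gcongr), ?_⟩
  have h0 : μ.variation (⋃ n, (F n : Set E))ᶜ = 0 := by
    refine variation_eq_zero_of_tendsto hlim fun n => ?_
    refine measure_mono_null (Set.compl_subset_compl.2 ?_) (mem_measuresOn_iff.1 (hu n))
    refine Set.subset_iUnion_of_subset n ?_
    exact Finset.le_sup (f := α) (Finset.self_mem_range_succ n)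
  rw [← mem_ae_iff] at h0
  filter_upwards [h0] with x hx
  simpa using hx

lemma flagCarried_variation (μ : regularMeasures E) :
    FlagCarried (μ : ComplexMeasure E).variation (id : E → E) :=
  mem_regularMeasures_iff.1 μ.2

variable {X : Type*} [MeasurableSpace X] {μ : ComplexMeasure E} {m : Measure X} {w : X → ℂ}
  {s : X → E}

lemma ImageRep.mem_regularMeasures (h : ImageRep μ m w s) : μ ∈ regularMeasures E := by
  rw [mem_regularMeasures_iff]
  obtain ⟨F, hF, hm, hx⟩ := h.carried
  refine ⟨F, hF, hm, Measure.absolutelyContinuous_of_le h.variation_le |>.ae_le ?_⟩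
  refine ae_absImage_of_ae h.aemeas ?_ hx
  convert measurableSet_iUnion_finiteDimensional hF using 1
  ext x
  simp

/-- Every admissible triple is realised, by pushing the density measure along a measurable version
of `s`. Existence of products, adjoints, brackets and push-forwards in 𝓜(E) all rests on this. -/
lemma exists_imageRep (hc : FlagCarried m s) (hs : AEMeasurable s m) (hw : Integrable w m) :
    ∃ ρ : regularMeasures E, ImageRep (ρ : ComplexMeasure E) m w s := by
  have h : ImageRep ((m.withDensityᵥ w).map (hs.mk s)) m w s := by
    refine ⟨hc, hs, hw, fun Λ hΛ => ?_⟩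
    rw [VectorMeasure.map_apply _ hs.measurable_mk hΛ,
      withDensityᵥ_apply hw (hs.measurable_mk hΛ), ← integral_indicator (hs.measurable_mk hΛ)]
    refine integral_congr_ae ?_
    filter_upwards [hs.ae_eq_mk] with x hx
    rw [hx]
    by_cases hmem : hs.mk s x ∈ Λ <;> simp [hmem]
  exact ⟨⟨_, h.mem_regularMeasures⟩, h⟩

omit [TopologicalSpace E] [IsFinestLocallyConvex E] [BorelSpace E] in
/-- A regular measure has a density with respect to any dominating finite measure that is carried
by an increasing sequence of finite dimensional subspaces. -/
lemma exists_imageRep_of_absolutelyContinuous (μ : regularMeasures E) {m : Measure E}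
    [IsFiniteMeasure m] (hm : FlagCarried m (id : E → E))
    (h : (μ : ComplexMeasure E).variation ≪ m) :
    ∃ w : E → ℂ, Measurable w ∧ ImageRep (μ : ComplexMeasure E) m w id ∧
      (μ : ComplexMeasure E).variation = m.withDensity fun x => ‖w x‖ₑ := by
  obtain ⟨w, hw, hint, heq, hvar⟩ := exists_density h
  refine ⟨w, hw, ⟨hm, aemeasurable_id, hint, fun Λ hΛ => ?_⟩, hvar⟩
  conv_lhs => rw [← heq]
  rw [withDensityᵥ_apply hint hΛ, ← integral_indicator hΛ]
  refine integral_congr_ae (Eventually.of_forall fun x => ?_)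
  by_cases hx : x ∈ Λ <;> simp [hx]

lemma exists_imageRep_variation (μ : regularMeasures E) :
    ∃ w : E → ℂ, Measurable w ∧
      ImageRep (μ : ComplexMeasure E) (μ : ComplexMeasure E).variation w id ∧
      (μ : ComplexMeasure E).variation
        = (μ : ComplexMeasure E).variation.withDensity fun x => ‖w x‖ₑ :=
  exists_imageRep_of_absolutelyContinuous μ (flagCarried_variation μ)
    Measure.AbsolutelyContinuous.rfl

instance completeSpace_regularMeasures : CompleteSpace (regularMeasures E) :=
  (Submodule.isClosed_topologicalClosure _).completeSpace_coe

end Regular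

/-! ## Twisted convolutions -/

section Conv

variable {E : Type*} [AddCommGroup E] [Module ℝ E] [TopologicalSpace E] [IsFinestLocallyConvex E]
  [MeasurableSpace E] [BorelSpace E]

variable {X Y : Type*} [MeasurableSpace X] [MeasurableSpace Y] {μ ν : ComplexMeasure E}
  {m : Measure X} {m' : Measure Y} {w : X → ℂ} {w' : Y → ℂ} {s : X → E} {s' : Y → E}

lemma ImageRep.flagCarried_absImage (h : ImageRep μ m w s) :
    FlagCarried (absImage m w s) (id : E → E) := by
  obtain ⟨F, hF, hm, hx⟩ := h.carried
  refine ⟨F, hF, hm, ae_absImage_of_ae h.aemeas ?_ hx⟩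
  convert measurableSet_iUnion_finiteDimensional hF using 1
  ext x
  simp

variable [SFinite m] [SFinite m'] {k : E → E → ℂ}

-- Tonelli: integrating the first variable over `absImage` amounts to integrating over `X` with
-- weight `‖w‖`.
omit [SFinite m] in
lemma ImageRep.integrable_kernel (h : ImageRep μ m w s) (h' : ImageRep ν m' w' s')
    (hk : FdMeasurable k)
    (hint : Integrable (fun p : X × Y => k (s p.1) (s' p.2) * (w p.1 * w' p.2)) (m.prod m')) :
    Integrable (fun p : E × Y => k p.1 (s' p.2) * w' p.2) ((absImage m w s).prod m') := by
  have := h.isFiniteMeasure_absImage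
  have hmeas : AEStronglyMeasurable (fun p : E × Y => k p.1 (s' p.2) * w' p.2)
      ((absImage m w s).prod m') :=
    ((h.flagCarried_absImage.aemeasurable_prod h'.carried aemeasurable_id h'.aemeas
      hk).aestronglyMeasurable).mul
      (h'.int.aestronglyMeasurable.comp_quasiMeasurePreserving
        Measure.quasiMeasurePreserving_snd)
  refine ⟨hmeas, ?_⟩
  have h₁ : ∫⁻ p : E × Y, ‖k p.1 (s' p.2) * w' p.2‖ₑ ∂((absImage m w s).prod m')
      = ∫⁻ p : X × Y, ‖k (s p.1) (s' p.2) * (w p.1 * w' p.2)‖ₑ ∂(m.prod m') := by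
    rw [lintegral_prod _ hmeas.enorm, lintegral_absImage h.aemeas h.int
      hmeas.enorm.lintegral_prod_right', lintegral_prod _ hint.aestronglyMeasurable.enorm]
    refine lintegral_congr fun x => ?_
    rw [← lintegral_const_mul' _ _ enorm_ne_top]
    refine lintegral_congr fun y => ?_
    simp only [enorm_mul]
    ring
  rw [HasFiniteIntegral, h₁]
  exact hint.2

/-- The iterated integral defining a twisted convolution, as an integral over a product. -/
lemma ImageRep.convValue_eq (h : ImageRep μ m w s) (h' : ImageRep ν m' w' s')
    (hk : FdMeasurable k) (hk' : ∀ f, Measurable (k f))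
    (hint : Integrable (fun p : X × Y => k (s p.1) (s' p.2) * (w p.1 * w' p.2)) (m.prod m'))
    {Λ : Set E} (hΛ : MeasurableSet Λ) :
    convValue k μ ν Λ = ∫ p : X × Y, Λ.indicator (fun _ => (1 : ℂ)) (s p.1 + s' p.2)
      * (k (s p.1) (s' p.2) * (w p.1 * w' p.2)) ∂(m.prod m') := by
  have := h.isFiniteMeasure_absImage
  -- The inner integral is a function of the point `f` of `E`, not of the parameter in `X`, so
  -- Fubini is first applied over `absImage m w s` times `m'`.
  have hK := h.integrable_kernel h' hk hint
  have hKΛ : Integrable (fun p : E × Y => Λ.indicator (fun _ => (1 : ℂ)) (p.1 + s' p.2)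
      * (k p.1 (s' p.2) * w' p.2)) ((absImage m w s).prod m') :=
    integrable_indicator_mul (s := fun p : E × Y => p.1 + s' p.2) hΛ
      (h.flagCarried_absImage.aemeasurable_add h'.carried aemeasurable_id h'.aemeas) hK
  have hinner : ∀ᵐ f ∂absImage m w s,
      ∫ᵛ g, k f g * Λ.indicator (fun _ => (1 : ℂ)) (f + g) ∂[ContinuousLinearMap.mul ℝ ℂ; ν]
        = ∫ y, Λ.indicator (fun _ => (1 : ℂ)) (f + s' y) * (k f (s' y) * w' y) ∂m' := by
    filter_upwards [hKΛ.prod_right_ae] with f hf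
    have hadd : Measurable fun g : E => f + g := (continuous_const.add continuous_id).measurable
    have hφ : AEStronglyMeasurable (fun g => k f g * Λ.indicator (fun _ => (1 : ℂ)) (f + g))
        (absImage m' w' s') :=
      ((hk' f).mul ((measurable_const.indicator hΛ).comp hadd)).aestronglyMeasurable
    have hcomm : ∀ y, k f (s' y) * Λ.indicator (fun _ => (1 : ℂ)) (f + s' y) * w' y
        = Λ.indicator (fun _ => (1 : ℂ)) (f + s' y) * (k f (s' y) * w' y) := fun y => by ring
    rw [h'.integral_eq ((integrable_absImage_iff h'.aemeas h'.int hφ).2 ?_)]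
    · simp only [hcomm]
    · simpa only [hcomm] using hf
  have hG := hKΛ.integral_prod_left
  rw [convValue, VectorMeasure.integral_congr_ae
    (Measure.absolutelyContinuous_of_le h.variation_le |>.ae_le hinner), h.integral_eq hG,
    integral_prod _ (integrable_indicator_mul (s := fun p : X × Y => s p.1 + s' p.2) hΛ
      (h.carried.aemeasurable_add h'.carried h.aemeas h'.aemeas) hint)]
  refine integral_congr_ae (Eventually.of_forall fun x => ?_)
  simp only
  rw [← integral_mul_const]
  refine integral_congr_ae (Eventually.of_forall fun y => ?_)
  simp only
  ring

/-- Fubini identifies the iterated integral with the values of the measure represented on the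
product, which is therefore the one selected by `measureOfValues`. The deformed products and the
bracket are the instances used. -/
lemma ImageRep.exists_conv (h : ImageRep μ m w s) (h' : ImageRep ν m' w' s')
    (hk : FdMeasurable k) (hk' : ∀ f, Measurable (k f))
    (hint : Integrable (fun p : X × Y => k (s p.1) (s' p.2) * (w p.1 * w' p.2)) (m.prod m')) :
    ImageRep (measureOfValues (convValue k μ ν) : ComplexMeasure E) (m.prod m')
        (fun p => k (s p.1) (s' p.2) * (w p.1 * w' p.2)) (fun p => s p.1 + s' p.2) ∧
      ∀ Λ, MeasurableSet Λ →
        (measureOfValues (convValue k μ ν) : ComplexMeasure E) Λ = convValue k μ ν Λ := by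
  obtain ⟨ρ, hρ⟩ := exists_imageRep (h.carried.add h'.carried)
    (h.carried.aemeasurable_add h'.carried h.aemeas h'.aemeas) hint
  have hv : ∀ Λ, MeasurableSet Λ → (ρ : ComplexMeasure E) Λ = convValue k μ ν Λ := fun Λ hΛ => by
    rw [hρ.apply Λ hΛ, h.convValue_eq h' hk hk' hint hΛ]
  rw [measureOfValues_apply ρ hv]
  exact ⟨hρ, hv⟩

variable {E' : Type*} [AddCommGroup E'] [Module ℝ E'] [TopologicalSpace E']
  [IsFinestLocallyConvex E'] [MeasurableSpace E'] [BorelSpace E']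

omit [SFinite m] in
lemma ImageRep.push {μ : regularMeasures E} (h : ImageRep (μ : ComplexMeasure E) m w s)
    (T : E →ₗ[ℝ] E') : ImageRep (pushMeasure T μ : ComplexMeasure E') m w fun x => T (s x) := by
  have hT := LinearMap.measurable_of_isFinestLocallyConvex T
  obtain ⟨ρ, hρ⟩ := exists_imageRep (h.carried.linearMap T) (hT.comp_aemeasurable h.aemeas) h.int
  rw [pushMeasure, measureOfValues_apply ρ]
  · exact hρ
  · intro Λ hΛ
    rw [hρ.apply Λ hΛ, h.apply _ (hT hΛ)]
    rfl

lemma pushMeasure_apply (T : E →ₗ[ℝ] E') (μ : regularMeasures E) {Λ : Set E'}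
    (hΛ : MeasurableSet Λ) :
    (pushMeasure T μ : ComplexMeasure E') Λ = (μ : ComplexMeasure E) (T ⁻¹' Λ) := by
  obtain ⟨w, -, hw, -⟩ := exists_imageRep_variation μ
  have hT := LinearMap.measurable_of_isFinestLocallyConvex T
  rw [(hw.push T).apply Λ hΛ, hw.apply _ (hT hΛ)]
  rfl

omit [SFinite m] in
lemma ImageRep.measureStar {μ : regularMeasures E} (h : ImageRep (μ : ComplexMeasure E) m w s) :
    ImageRep (measureStar μ : ComplexMeasure E) m (fun x => (starRingEnd ℂ) (w x))
      fun x => -s x := by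
  have hneg : Measurable fun f : E => -f := continuous_neg.measurable
  have hcar : FlagCarried m fun x => -s x := by
    simpa using h.carried.linearMap (-LinearMap.id : E →ₗ[ℝ] E)
  have hint : Integrable (fun x => (starRingEnd ℂ) (w x)) m :=
    (Complex.conjCLE : ℂ →L[ℝ] ℂ).integrable_comp h.int
  obtain ⟨ρ, hρ⟩ := exists_imageRep hcar (hneg.comp_aemeasurable h.aemeas) hint
  rw [_root_.measureStar, measureOfValues_apply ρ]
  · exact hρ
  · intro Λ hΛ
    rw [hρ.apply Λ hΛ, h.apply _ (hneg hΛ), ← integral_conj]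
    refine integral_congr_ae (Eventually.of_forall fun x => ?_)
    by_cases hx : -s x ∈ Λ <;> simp [hx]

lemma measureStar_apply (μ : regularMeasures E) {Λ : Set E} (hΛ : MeasurableSet Λ) :
    (measureStar μ : ComplexMeasure E) Λ
      = (starRingEnd ℂ) ((μ : ComplexMeasure E) ((fun f => -f) ⁻¹' Λ)) := by
  obtain ⟨w, -, hw, -⟩ := exists_imageRep_variation μ
  have hneg : Measurable fun f : E => -f := continuous_neg.measurable
  rw [hw.measureStar.apply Λ hΛ, hw.apply _ (hneg hΛ), ← integral_conj]
  refine integral_congr_ae (Eventually.of_forall fun x => ?_)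
  by_cases hx : -x ∈ Λ <;> simp [hx]

/-! ### The deformed product -/

omit [TopologicalSpace E] [IsFinestLocallyConvex E] [MeasurableSpace E] [BorelSpace E] in
lemma norm_multiplier (σ : LinearMap.BilinForm ℝ E) (ħ : ℝ) (f g : E) :
    ‖multiplier σ ħ f g‖ = 1 := by
  rw [multiplier, show -(Complex.I / 2) * (ħ : ℂ) * (σ f g : ℂ)
    = ((-(ħ * σ f g) / 2 : ℝ) : ℂ) * Complex.I by push_cast; ring]
  exact Complex.norm_exp_ofReal_mul_I _

lemma fdMeasurable_multiplier (σ : LinearMap.BilinForm ℝ E) (ħ : ℝ) :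
    FdMeasurable (multiplier σ ħ) := fun α hα =>
  Complex.measurable_exp.comp
    ((Complex.measurable_ofReal.comp (fdMeasurable_bilinForm σ α hα)).const_mul _)

lemma fdMeasurable_bilinForm_complex (σ : LinearMap.BilinForm ℝ E) :
    FdMeasurable fun f g => (σ f g : ℂ) := fun α hα =>
  Complex.measurable_ofReal.comp (fdMeasurable_bilinForm σ α hα)

lemma measurable_bilinForm_left (σ : LinearMap.BilinForm ℝ E) (f : E) :
    Measurable fun g => σ f g :=
  LinearMap.measurable_of_isFinestLocallyConvex (σ f)

lemma measurable_multiplier_left (σ : LinearMap.BilinForm ℝ E) (ħ : ℝ) (f : E) :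
    Measurable (multiplier σ ħ f) :=
  Complex.measurable_exp.comp
    ((Complex.measurable_ofReal.comp (measurable_bilinForm_left σ f)).const_mul _)

lemma ImageRep.integrable_multiplier (h : ImageRep μ m w s) (h' : ImageRep ν m' w' s')
    (σ : LinearMap.BilinForm ℝ E) (ħ : ℝ) :
    Integrable (fun p : X × Y => multiplier σ ħ (s p.1) (s' p.2) * (w p.1 * w' p.2))
      (m.prod m') :=
  (h.int.mul_prod h'.int).bdd_mul (c := 1)
    (h.carried.aemeasurable_prod h'.carried h.aemeas h'.aemeas
      (fdMeasurable_multiplier σ ħ)).aestronglyMeasurable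
    (Eventually.of_forall fun _ => (norm_multiplier σ ħ _ _).le)

lemma ImageRep.deformedConv {μ ν : regularMeasures E} (h : ImageRep (μ : ComplexMeasure E) m w s)
    (h' : ImageRep (ν : ComplexMeasure E) m' w' s') (σ : LinearMap.BilinForm ℝ E) (ħ : ℝ) :
    ImageRep (deformedConv σ ħ μ ν : ComplexMeasure E) (m.prod m')
      (fun p => multiplier σ ħ (s p.1) (s' p.2) * (w p.1 * w' p.2)) fun p => s p.1 + s' p.2 :=
  (h.exists_conv h' (fdMeasurable_multiplier σ ħ) (measurable_multiplier_left σ ħ)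
    (h.integrable_multiplier h' σ ħ)).1

lemma deformedConv_apply (σ : LinearMap.BilinForm ℝ E) (ħ : ℝ) (μ ν : regularMeasures E)
    {Λ : Set E} (hΛ : MeasurableSet Λ) :
    (deformedConv σ ħ μ ν : ComplexMeasure E) Λ = convValue (multiplier σ ħ) μ ν Λ := by
  obtain ⟨w, -, h, -⟩ := exists_imageRep_variation μ
  obtain ⟨w', -, h', -⟩ := exists_imageRep_variation ν
  exact (h.exists_conv h' (fdMeasurable_multiplier σ ħ) (measurable_multiplier_left σ ħ)
    (h.integrable_multiplier h' σ ħ)).2 Λ hΛ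

/-! ### The Poisson bracket -/

lemma ImageRep.poissonBracket {μ ν : regularMeasures E} (h : ImageRep (μ : ComplexMeasure E) m w s)
    (h' : ImageRep (ν : ComplexMeasure E) m' w' s') (σ : LinearMap.BilinForm ℝ E)
    (hint : Integrable (fun p : X × Y => (σ (s p.1) (s' p.2) : ℂ) * (w p.1 * w' p.2))
      (m.prod m')) :
    ImageRep (poissonBracket σ μ ν : ComplexMeasure E) (m.prod m')
      (fun p => (σ (s p.1) (s' p.2) : ℂ) * (w p.1 * w' p.2)) fun p => s p.1 + s' p.2 :=
  (h.exists_conv h' (fdMeasurable_bilinForm_complex σ)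
    (fun f => Complex.measurable_ofReal.comp (measurable_bilinForm_left σ f)) hint).1

/-- The form is integrable if its controlling seminorm has first moments. -/
lemma integrable_bilinForm_mul {σ : LinearMap.BilinForm ℝ E} {ς : Seminorm ℝ E}
    (hς : ControlsForm σ ς) (hs : FlagCarried m s) (hs' : FlagCarried m' s')
    (hsm : AEMeasurable s m) (hsm' : AEMeasurable s' m') (hw : AEStronglyMeasurable w m)
    (hw' : AEStronglyMeasurable w' m') (h : Integrable (fun x => ς (s x) * ‖w x‖) m)
    (h' : Integrable (fun y => ς (s' y) * ‖w' y‖) m') :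
    Integrable (fun p : X × Y => (σ (s p.1) (s' p.2) : ℂ) * (w p.1 * w' p.2)) (m.prod m') := by
  obtain ⟨c, hc, hσ⟩ := hς
  refine ((h.mul_prod h').const_mul c).mono' ?_ (Eventually.of_forall fun p => ?_)
  · exact ((hs.aemeasurable_prod hs' hsm hsm'
      (fdMeasurable_bilinForm_complex σ)).aestronglyMeasurable).mul
      ((hw.comp_quasiMeasurePreserving Measure.quasiMeasurePreserving_fst).mul
        (hw'.comp_quasiMeasurePreserving Measure.quasiMeasurePreserving_snd))
  · rw [norm_mul, norm_mul, Complex.norm_real, Real.norm_eq_abs]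
    calc |σ (s p.1) (s' p.2)| * (‖w p.1‖ * ‖w' p.2‖)
        ≤ (c * ς (s p.1) * ς (s' p.2)) * (‖w p.1‖ * ‖w' p.2‖) := by gcongr; exact hσ _ _
      _ = _ := by ring

end Conv

/-! ## Algebraic identities -/

section Algebra

/-- This reduces laws for measures to pointwise identities: once both sides are represented over the
same `m`, it suffices to compare densities and maps. -/
lemma ImageRep.eq_of {E X : Type*} [AddCommGroup E] [Module ℝ E] [MeasurableSpace E]
    [MeasurableSpace X] {μ ν : regularMeasures E} {m : Measure X} {w w' : X → ℂ} {s s' : X → E}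
    (h : ImageRep (μ : ComplexMeasure E) m w s) (h' : ImageRep (ν : ComplexMeasure E) m w' s')
    (hw : ∀ x, w x = w' x) (hs : ∀ x, s x = s' x) : μ = ν := by
  obtain rfl : w = w' := funext hw
  obtain rfl : s = s' := funext hs
  exact Subtype.ext (h.unique h')

variable {E : Type*} [AddCommGroup E] [Module ℝ E] [TopologicalSpace E] [IsFinestLocallyConvex E]
  [MeasurableSpace E] [BorelSpace E]

/-- The regular measure `μ` has the density `w` with respect to `m`, and its variation has the
density `‖w‖`. -/
structure HasDensity (μ : regularMeasures E) (m : Measure E) (w : E → ℂ) : Prop where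
  meas : Measurable w
  rep : ImageRep (μ : ComplexMeasure E) m w fun x => x
  variation_eq : (μ : ComplexMeasure E).variation = m.withDensity fun x => ‖w x‖ₑ

lemma exists_hasDensity (μ : regularMeasures E) :
    ∃ w : E → ℂ, HasDensity μ (μ : ComplexMeasure E).variation w := by
  obtain ⟨w, h₁, h₂, h₃⟩ := exists_imageRep_variation μ
  exact ⟨w, h₁, h₂, h₃⟩

/-- Three regular measures have densities with respect to a common finite measure. -/
lemma exists_hasDensity₃ (a b c : regularMeasures E) :
    ∃ (m : Measure E) (_ : IsFiniteMeasure m) (u v w : E → ℂ),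
      HasDensity a m u ∧ HasDensity b m v ∧ HasDensity c m w := by
  let m : Measure E := (a : ComplexMeasure E).variation + (b : ComplexMeasure E).variation
    + (c : ComplexMeasure E).variation
  have hm : FlagCarried m (id : E → E) :=
    ((flagCarried_variation a).sum_measure (flagCarried_variation b)).sum_measure
      (flagCarried_variation c)
  have ha : (a : ComplexMeasure E).variation ≤ m := by
    intro s; simp only [m, Measure.add_apply]; rw [add_assoc]; exact le_self_add
  have hb : (b : ComplexMeasure E).variation ≤ m := by
    intro s; simp only [m, Measure.add_apply]; rw [add_right_comm]; exact le_add_self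
  have hc : (c : ComplexMeasure E).variation ≤ m := by
    intro s; simp only [m, Measure.add_apply]; exact le_add_self
  obtain ⟨u, u₁, u₂, u₃⟩ := exists_imageRep_of_absolutelyContinuous a hm
    (Measure.absolutelyContinuous_of_le ha)
  obtain ⟨v, v₁, v₂, v₃⟩ := exists_imageRep_of_absolutelyContinuous b hm
    (Measure.absolutelyContinuous_of_le hb)
  obtain ⟨w, w₁, w₂, w₃⟩ := exists_imageRep_of_absolutelyContinuous c hm
    (Measure.absolutelyContinuous_of_le hc)
  exact ⟨m, inferInstance, u, v, w, ⟨u₁, u₂, u₃⟩, ⟨v₁, v₂, v₃⟩, ⟨w₁, w₂, w₃⟩⟩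

namespace HasDensity

variable {μ : regularMeasures E} {m : Measure E} {w : E → ℂ}

omit [TopologicalSpace E] [IsFinestLocallyConvex E] [BorelSpace E] in
lemma integral_norm (h : HasDensity μ m w) : ∫ x, ‖w x‖ ∂m = ‖μ‖ := by
  rw [integral_norm_eq_lintegral_enorm h.meas.aestronglyMeasurable, Submodule.coe_norm,
    complexMeasure_norm_def, h.variation_eq, withDensity_apply _ MeasurableSet.univ,
    Measure.restrict_univ]

omit [TopologicalSpace E] [IsFinestLocallyConvex E] [BorelSpace E] in
lemma lintegral_variation (h : HasDensity μ m w) {φ : E → ℝ≥0∞} (hφ : Measurable φ) :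
    ∫⁻ f, φ f ∂(μ : ComplexMeasure E).variation = ∫⁻ x, ‖w x‖ₑ * φ x ∂m := by
  rw [h.variation_eq, lintegral_withDensity_eq_lintegral_mul _ h.meas.enorm hφ]
  rfl

lemma integrable_moment (h : HasDensity μ m w) {κ : Seminorm ℝ E} {n : ℕ∞}
    (hμ : μ ∈ momentMeasures κ n) {j : ℕ} (hj : (j : ℕ∞) ≤ n) :
    Integrable (fun x => κ x ^ j * ‖w x‖) m := by
  have hκ := κ.measurable_of_isFinestLocallyConvex
  have h₁ := hμ j hj
  rw [h.lintegral_variation (hκ.pow_const j).ennreal_ofReal] at h₁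
  refine ⟨((hκ.pow_const j).mul h.meas.norm).aestronglyMeasurable, ?_⟩
  refine lt_of_eq_of_lt (lintegral_congr fun x => ?_) h₁
  rw [Real.enorm_eq_ofReal (by positivity), ENNReal.ofReal_mul (by positivity), ofReal_norm,
    mul_comm]

/-- The product `κ ^ n * ς` is at most the `(n + 1)`-st power of the larger seminorm value, hence at
most the sum of both powers. -/
lemma integrable_mixed_moment (h : HasDensity μ m w) {κ ς : Seminorm ℝ E}
    (hκ : μ ∈ momentMeasures κ ⊤) (hς : μ ∈ momentMeasures ς ⊤) (n : ℕ) :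
    Integrable (fun x => κ x ^ n * ς x * ‖w x‖) m := by
  have mκ := κ.measurable_of_isFinestLocallyConvex
  have mς := ς.measurable_of_isFinestLocallyConvex
  refine ((h.integrable_moment hκ (j := n + 1) le_top).add
    (h.integrable_moment hς (j := n + 1) le_top)).mono'
    (((mκ.pow_const n).mul mς).mul h.meas.norm).aestronglyMeasurable
    (Eventually.of_forall fun x => ?_)
  rw [Real.norm_of_nonneg (by positivity), Pi.add_apply, ← add_mul]
  gcongr
  have h₁ := apply_nonneg κ x
  have h₂ := apply_nonneg ς x
  rcases le_total (κ x) (ς x) with hle | hle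
  · calc κ x ^ n * ς x ≤ ς x ^ n * ς x := by gcongr
      _ ≤ κ x ^ (n + 1) + ς x ^ (n + 1) := by
        rw [← pow_succ]; exact le_add_of_nonneg_left (by positivity)
  · calc κ x ^ n * ς x ≤ κ x ^ n * κ x := by gcongr
      _ ≤ κ x ^ (n + 1) + ς x ^ (n + 1) := by
        rw [← pow_succ]; exact le_add_of_nonneg_right (by positivity)

end HasDensity

lemma ImageRep.mem_momentMeasures {X : Type*} [MeasurableSpace X] {μ : regularMeasures E}
    {m : Measure X} {w : X → ℂ} {s : X → E} (h : ImageRep (μ : ComplexMeasure E) m w s)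
    {κ : Seminorm ℝ E} {n : ℕ∞}
    (hint : ∀ j : ℕ, (j : ℕ∞) ≤ n → Integrable (fun x => κ (s x) ^ j * ‖w x‖) m) :
    μ ∈ momentMeasures κ n := by
  intro j hj
  have hκ := κ.measurable_of_isFinestLocallyConvex
  refine (h.lintegral_variation_le (hκ.pow_const j).ennreal_ofReal).trans_lt ?_
  refine lt_of_eq_of_lt (lintegral_congr fun x => ?_) (hint j hj).2
  rw [Real.enorm_eq_ofReal (by positivity), ENNReal.ofReal_mul (by positivity), ofReal_norm,
    mul_comm]

section Moments

variable {X Y : Type*} [MeasurableSpace X] [MeasurableSpace Y] {m : Measure X} {m' : Measure Y}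
  {w : X → ℂ} {w' : Y → ℂ} {s : X → E} {s' : Y → E}

/-- Moments of the densities of twisted convolutions. -/
lemma integrable_moment_kernel (κ : Seminorm ℝ E) {q : E → ℝ} {k : E → E → ℂ} {c : ℝ}
    (hk : ∀ f g, ‖k f g‖ ≤ c * q f * q g)
    (hadd : AEMeasurable (fun p : X × Y => s p.1 + s' p.2) (m.prod m'))
    (hmeas : AEStronglyMeasurable (fun p : X × Y => k (s p.1) (s' p.2) * (w p.1 * w' p.2))
      (m.prod m')) (n : ℕ)
    (h₀ : Integrable (fun x => q (s x) * ‖w x‖) m)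
    (h₁ : Integrable (fun x => κ (s x) ^ n * q (s x) * ‖w x‖) m)
    (h₀' : Integrable (fun x => q (s' x) * ‖w' x‖) m')
    (h₁' : Integrable (fun x => κ (s' x) ^ n * q (s' x) * ‖w' x‖) m') :
    Integrable (fun p : X × Y => κ (s p.1 + s' p.2) ^ n
      * ‖k (s p.1) (s' p.2) * (w p.1 * w' p.2)‖) (m.prod m') := by
  -- The factor comes from `(x + y) ^ n ≤ 2 ^ (n - 1) * (x ^ n + y ^ n)`, which for `n = 0`, with
  -- truncated subtraction, reads `1 ≤ 2`.
  refine (((h₁.mul_prod h₀').add (h₀.mul_prod h₁')).const_mul (2 ^ (n - 1) * c)).mono' ?_ ?_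
  · exact ((κ.measurable_of_isFinestLocallyConvex.comp_aemeasurable
      hadd).pow_const n).aestronglyMeasurable.mul hmeas.norm
  · refine Eventually.of_forall fun p => ?_
    rw [Real.norm_of_nonneg (by positivity), norm_mul, norm_mul]
    have hx := apply_nonneg κ (s p.1)
    have hy := apply_nonneg κ (s' p.2)
    have h₂ : κ (s p.1 + s' p.2) ^ n ≤ 2 ^ (n - 1) * (κ (s p.1) ^ n + κ (s' p.2) ^ n) :=
      (pow_le_pow_left₀ (apply_nonneg κ _) (map_add_le_add κ _ _) n).trans (add_pow_le hx hy n)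
    calc κ (s p.1 + s' p.2) ^ n * (‖k (s p.1) (s' p.2)‖ * (‖w p.1‖ * ‖w' p.2‖))
        ≤ (2 ^ (n - 1) * (κ (s p.1) ^ n + κ (s' p.2) ^ n))
          * ((c * q (s p.1) * q (s' p.2)) * (‖w p.1‖ * ‖w' p.2‖)) := by
          gcongr
          exact hk _ _
      _ = _ := by simp only [Pi.add_apply]; ring

end Moments

end Algebra

section Algebra

variable {E : Type*} [AddCommGroup E] [Module ℝ E] [TopologicalSpace E] [IsFinestLocallyConvex E]
  [MeasurableSpace E] [BorelSpace E]

/-! ### The Banach-star-algebra of regular measures -/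

section Banach

variable (σ : LinearMap.BilinForm ℝ E) (ħ : ℝ)

/-- Densities can be added only over a common reference measure; after that the law is
distributivity in ℂ. -/
lemma add_deformedConv (a b c : regularMeasures E) :
    deformedConv σ ħ (a + b) c = deformedConv σ ħ a c + deformedConv σ ħ b c := by
  obtain ⟨m, _, u, v, w, ha, hb, hc⟩ := exists_hasDensity₃ a b c
  have hab : ImageRep ((a + b : regularMeasures E) : ComplexMeasure E) m _ fun x => x :=
      ha.rep.add hb.rep
  exact (hab.deformedConv hc.rep σ ħ).eq_of
    ((ha.rep.deformedConv hc.rep σ ħ).add (hb.rep.deformedConv hc.rep σ ħ))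
    (fun p => by ring) fun p => rfl

lemma deformedConv_add (a b c : regularMeasures E) :
    deformedConv σ ħ a (b + c) = deformedConv σ ħ a b + deformedConv σ ħ a c := by
  obtain ⟨m, _, u, v, w, ha, hb, hc⟩ := exists_hasDensity₃ a b c
  have hbc : ImageRep ((b + c : regularMeasures E) : ComplexMeasure E) m _ fun x => x :=
      hb.rep.add hc.rep
  exact (ha.rep.deformedConv hbc σ ħ).eq_of
    ((ha.rep.deformedConv hb.rep σ ħ).add (ha.rep.deformedConv hc.rep σ ħ))
    (fun p => by ring) fun p => rfl

lemma smul_deformedConv (z : ℂ) (a b : regularMeasures E) :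
    deformedConv σ ħ (z • a) b = z • deformedConv σ ħ a b := by
  obtain ⟨u, ha⟩ := exists_hasDensity a
  obtain ⟨v, hb⟩ := exists_hasDensity b
  have hza : ImageRep ((z • a : regularMeasures E) : ComplexMeasure E) _ _ fun x => x :=
      ha.rep.smul z
  exact (hza.deformedConv hb.rep σ ħ).eq_of ((ha.rep.deformedConv hb.rep σ ħ).smul z)
    (fun p => by ring) fun p => rfl

lemma deformedConv_smul (z : ℂ) (a b : regularMeasures E) :
    deformedConv σ ħ a (z • b) = z • deformedConv σ ħ a b := by
  obtain ⟨u, ha⟩ := exists_hasDensity a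
  obtain ⟨v, hb⟩ := exists_hasDensity b
  have hzb : ImageRep ((z • b : regularMeasures E) : ComplexMeasure E) _ _ fun x => x :=
      hb.rep.smul z
  exact (ha.rep.deformedConv hzb σ ħ).eq_of ((ha.rep.deformedConv hb.rep σ ħ).smul z)
    (fun p => by ring) fun p => rfl

-- The 2-cocycle identity, from bilinearity of σ in the exponent; it is the reason for
-- associativity.
omit [TopologicalSpace E] [IsFinestLocallyConvex E] [MeasurableSpace E] [BorelSpace E] in
lemma multiplier_mul_multiplier (x y z : E) :
    multiplier σ ħ (x + y) z * multiplier σ ħ x y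
      = multiplier σ ħ x (y + z) * multiplier σ ħ y z := by
  simp only [multiplier, ← Complex.exp_add, map_add, LinearMap.add_apply]
  congr 1
  push_cast
  ring

lemma deformedConv_assoc (a b c : regularMeasures E) :
    deformedConv σ ħ (deformedConv σ ħ a b) c = deformedConv σ ħ a (deformedConv σ ħ b c) := by
  obtain ⟨u, ha⟩ := exists_hasDensity a
  obtain ⟨v, hb⟩ := exists_hasDensity b
  obtain ⟨w, hc⟩ := exists_hasDensity c
  have h₁ := (ha.rep.deformedConv hb.rep σ ħ).deformedConv hc.rep σ ħ
  have h₂ := ha.rep.deformedConv (hb.rep.deformedConv hc.rep σ ħ) σ ħ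
  refine h₁.eq_of (h₂.comp_equiv MeasurableEquiv.prodAssoc (measurePreserving_prodAssoc _ _ _))
    (fun p => ?_) fun p => add_assoc _ _ _
  have := multiplier_mul_multiplier σ ħ p.1.1 p.1.2 p.2
  simp only [MeasurableEquiv.prodAssoc, MeasurableEquiv.coe_mk, Equiv.prodAssoc_apply]
  linear_combination (u p.1.1 * v p.1.2 * w p.2) * this

lemma norm_deformedConv_le (a b : regularMeasures E) :
    ‖deformedConv σ ħ a b‖ ≤ ‖a‖ * ‖b‖ := by
  obtain ⟨u, ha⟩ := exists_hasDensity a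
  obtain ⟨v, hb⟩ := exists_hasDensity b
  refine (ha.rep.deformedConv hb.rep σ ħ).norm_le.trans ?_
  simp only [norm_mul, norm_multiplier, one_mul]
  rw [integral_prod_mul (fun x => ‖u x‖) (fun y => ‖v y‖), ha.integral_norm, hb.integral_norm]

omit [TopologicalSpace E] [IsFinestLocallyConvex E] [MeasurableSpace E] [BorelSpace E] in
lemma conj_multiplier (hσ : σ.IsAlt) (x y : E) :
    (starRingEnd ℂ) (multiplier σ ħ x y) = multiplier σ ħ y x := by
  rw [multiplier, multiplier, ← Complex.exp_conj, ← hσ.neg_eq x y]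
  congr 1
  simp [Complex.conj_ofNat]
  ring

lemma measureStar_add (a b : regularMeasures E) :
    measureStar (a + b) = measureStar a + measureStar b := by
  obtain ⟨m, _, u, v, w, ha, hb, -⟩ := exists_hasDensity₃ a b b
  have hab : ImageRep ((a + b : regularMeasures E) : ComplexMeasure E) m _ fun x => x :=
      ha.rep.add hb.rep
  exact hab.measureStar.eq_of (ha.rep.measureStar.add hb.rep.measureStar) (fun p => by simp)
    fun p => rfl

lemma measureStar_smul (z : ℂ) (a : regularMeasures E) :
    measureStar (z • a) = (starRingEnd ℂ) z • measureStar a := by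
  obtain ⟨u, ha⟩ := exists_hasDensity a
  have hza : ImageRep ((z • a : regularMeasures E) : ComplexMeasure E) _ _ fun x => x :=
      ha.rep.smul z
  exact hza.measureStar.eq_of (ha.rep.measureStar.smul _) (fun p => by simp) fun p => rfl

lemma measureStar_measureStar (a : regularMeasures E) : measureStar (measureStar a) = a := by
  obtain ⟨u, ha⟩ := exists_hasDensity a
  exact ha.rep.measureStar.measureStar.eq_of ha.rep (fun p => by simp) fun p => by simp

/-- A contractive involution is isometric. -/
lemma norm_measureStar (a : regularMeasures E) : ‖measureStar a‖ = ‖a‖ := by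
  have h : ∀ a : regularMeasures E, ‖measureStar a‖ ≤ ‖a‖ := fun a => by
    obtain ⟨u, ha⟩ := exists_hasDensity a
    refine ha.rep.measureStar.norm_le.trans ?_
    simp only [RCLike.norm_conj]
    rw [ha.integral_norm]
  exact le_antisymm (h a) (by simpa only [measureStar_measureStar] using h (measureStar a))

/-- Conjugating the multiplier exchanges its arguments, which matches the swap of the factors; the
two signs from reflection cancel in σ. -/
lemma measureStar_deformedConv (hσ : σ.IsAlt) (a b : regularMeasures E) :
    measureStar (deformedConv σ ħ a b) = deformedConv σ ħ (measureStar b) (measureStar a) := by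
  obtain ⟨u, ha⟩ := exists_hasDensity a
  obtain ⟨v, hb⟩ := exists_hasDensity b
  have h₁ := (ha.rep.deformedConv hb.rep σ ħ).measureStar
  have h₂ := hb.rep.measureStar.deformedConv ha.rep.measureStar σ ħ
  refine h₁.eq_of (h₂.comp_equiv MeasurableEquiv.prodComm Measure.measurePreserving_swap)
    (fun p => ?_) fun p => ?_
  · simp only [map_mul, conj_multiplier σ ħ hσ, MeasurableEquiv.prodComm,
      MeasurableEquiv.coe_mk, Equiv.prodComm_apply, Prod.fst_swap, Prod.snd_swap]
    simp only [multiplier, map_neg, LinearMap.neg_apply, neg_neg]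
    ring
  · simp [MeasurableEquiv.prodComm, add_comm]

lemma isBanachStarAlgebra_deformedConv (hσ : σ.IsAlt) :
    IsBanachStarAlgebra (A := regularMeasures E) (deformedConv σ ħ) measureStar where
  complete := inferInstance
  add_mul := add_deformedConv σ ħ
  mul_add := deformedConv_add σ ħ
  smul_mul := smul_deformedConv σ ħ
  mul_smul := deformedConv_smul σ ħ
  mul_assoc := deformedConv_assoc σ ħ
  norm_mul_le := norm_deformedConv_le σ ħ
  star_add := measureStar_add
  star_smul := measureStar_smul
  star_star := measureStar_measureStar
  star_mul := measureStar_deformedConv σ ħ hσ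
  norm_star := norm_measureStar

omit [TopologicalSpace E] [IsFinestLocallyConvex E] [MeasurableSpace E] [BorelSpace E] in
lemma multiplier_zero (x y : E) : multiplier σ 0 x y = 1 := by simp [multiplier]

lemma ImageRep.deformedConv_zero {X Y : Type*} [MeasurableSpace X] [MeasurableSpace Y]
    {m : Measure X} {m' : Measure Y} {w : X → ℂ} {w' : Y → ℂ} {s : X → E} {s' : Y → E}
    [SFinite m] [SFinite m'] {μ ν : regularMeasures E} (h : ImageRep (μ : ComplexMeasure E) m w s)
    (h' : ImageRep (ν : ComplexMeasure E) m' w' s') :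
    ImageRep (_root_.deformedConv σ 0 μ ν : ComplexMeasure E) (m.prod m')
      (fun p => w p.1 * w' p.2) fun p => s p.1 + s' p.2 :=
  (h.deformedConv h' σ 0).congr (Eventually.of_forall fun p => by
    simp only [multiplier_zero, one_mul])

lemma deformedConv_zero_comm (a b : regularMeasures E) :
    deformedConv σ 0 a b = deformedConv σ 0 b a := by
  obtain ⟨u, ha⟩ := exists_hasDensity a
  obtain ⟨v, hb⟩ := exists_hasDensity b
  refine (ha.rep.deformedConv hb.rep σ 0).eq_of ((hb.rep.deformedConv ha.rep σ 0).comp_equiv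
    MeasurableEquiv.prodComm Measure.measurePreserving_swap) (fun p => ?_) fun p => ?_
  · simp [multiplier_zero, MeasurableEquiv.prodComm, mul_comm]
  · simp [MeasurableEquiv.prodComm, add_comm]

end Banach

/-! ### The limits of vanishing `ħ` -/

section Limits

lemma tendsto_integral_zero_of_dominated {X : Type*} [MeasurableSpace X] {m : Measure X}
    {l : Filter ℝ} [l.IsCountablyGenerated] {F : ℝ → X → ℝ} (bound : X → ℝ)
    (h₁ : ∀ᶠ t in l, AEStronglyMeasurable (F t) m) (h₂ : ∀ᶠ t in l, ∀ᵐ x ∂m, ‖F t x‖ ≤ bound x)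
    (h₃ : Integrable bound m) (h₄ : ∀ᵐ x ∂m, Tendsto (fun t => F t x) l (𝓝 0)) :
    Tendsto (fun t => ∫ x, F t x ∂m) l (𝓝 0) := by
  simpa using tendsto_integral_filter_of_dominated_convergence (f := fun _ => (0 : ℝ))
    bound h₁ h₂ h₃ h₄

variable (σ : LinearMap.BilinForm ℝ E)

/-- The multipliers are unimodular, so twice the modulus of the density is a majorant for all ħ and
no moments are needed. -/
lemma tendsto_deformedConv_zero (a b : regularMeasures E) :
    Tendsto (fun ħ : ℝ => ‖deformedConv σ ħ a b - deformedConv σ 0 a b‖) (𝓝 0) (𝓝 0) := by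
  obtain ⟨u, ha⟩ := exists_hasDensity a
  obtain ⟨v, hb⟩ := exists_hasDensity b
  have hrep := fun ħ : ℝ => (ha.rep.deformedConv hb.rep σ ħ).sub (ha.rep.deformedConv hb.rep σ 0)
  refine tendsto_of_tendsto_of_tendsto_of_le_of_le tendsto_const_nhds ?_
    (fun ħ => norm_nonneg _) fun ħ => (hrep ħ).norm_le
  refine tendsto_integral_zero_of_dominated
    (fun p => 2 * ‖u p.1 * v p.2‖) (Eventually.of_forall fun ħ =>
      (hrep ħ).int.aestronglyMeasurable.norm) (Eventually.of_forall fun ħ =>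
      Eventually.of_forall fun p => ?_) ((ha.rep.int.mul_prod hb.rep.int).norm.const_mul 2)
    (Eventually.of_forall fun p => ?_)
  · rw [norm_norm, ← sub_mul, norm_mul]
    gcongr
    refine (norm_sub_le _ _).trans ?_
    rw [norm_multiplier, norm_multiplier]
    norm_num
  · have hc : Continuous fun ħ : ℝ => ‖multiplier σ ħ p.1 p.2 * (u p.1 * v p.2)
        - multiplier σ 0 p.1 p.2 * (u p.1 * v p.2)‖ := by
      unfold multiplier
      fun_prop
    simpa using hc.tendsto 0

lemma abs_two_div_mul_sin_le (t ħ : ℝ) : |2 / ħ * Real.sin (ħ * t / 2)| ≤ |t| := by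
  rcases eq_or_ne ħ 0 with rfl | h
  · simp
  · calc |2 / ħ * Real.sin (ħ * t / 2)| = |2 / ħ| * |Real.sin (ħ * t / 2)| := abs_mul _ _
      _ ≤ |2 / ħ| * |ħ * t / 2| :=
        mul_le_mul_of_nonneg_left Real.abs_sin_le_abs (abs_nonneg _)
      _ = |t| := by rw [← abs_mul]; congr 1; field_simp

/-- The expression is the difference quotient at `0` of `2 * sin (ħ * t / 2)`. -/
lemma tendsto_two_div_mul_sin (t : ℝ) :
    Tendsto (fun ħ : ℝ => 2 / ħ * Real.sin (ħ * t / 2)) (𝓝[≠] 0) (𝓝 t) := by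
  have h₁ : HasDerivAt (fun ħ : ℝ => 2 * Real.sin (ħ * t / 2)) t 0 := by
    have h₂ : HasDerivAt (fun ħ : ℝ => ħ * t / 2) (t / 2) 0 := by
      simpa using ((hasDerivAt_id (0 : ℝ)).mul_const t).div_const 2
    have := (h₂.sin).const_mul 2
    simpa [mul_div_cancel₀] using this
  have h₃ := hasDerivAt_iff_tendsto_slope.1 h₁
  refine h₃.congr fun ħ => ?_
  simp [slope_def_field]
  ring

-- By antisymmetry the two multipliers are conjugate phases, whose difference is a multiple of a
-- sine.
omit [TopologicalSpace E] [IsFinestLocallyConvex E] [MeasurableSpace E] [BorelSpace E] in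
lemma scaled_multiplier_sub (hσ : σ.IsAlt) (ħ : ℝ) (x y : E) :
    Complex.I / (ħ : ℂ) * (multiplier σ ħ x y - multiplier σ ħ y x)
      = ((2 / ħ * Real.sin (ħ * σ x y / 2) : ℝ) : ℂ) := by
  rw [multiplier, multiplier, ← hσ.neg_eq x y]
  push_cast
  have h₁ : -(Complex.I / 2) * (ħ : ℂ) * (σ x y : ℂ) = -((ħ * σ x y / 2) * Complex.I) := by ring
  have h₂ : -(Complex.I / 2) * (ħ : ℂ) * -(σ x y : ℂ) = (ħ * σ x y / 2) * Complex.I := by ring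
  rw [h₁, h₂, Complex.sin, neg_mul]
  ring

/-- The density is ((2/ħ) sin(ħσ/2) − σ) times the product of the two densities. It tends to zero
pointwise and is dominated by twice the density of the bracket, integrable by the first moments. -/
lemma tendsto_scaledCommutator (hσ : σ.IsAlt) {ς : Seminorm ℝ E} (hς : ControlsForm σ ς)
    {a b : regularMeasures E} (h₁ : a ∈ momentMeasures ς 1) (h₂ : b ∈ momentMeasures ς 1) :
    Tendsto (fun ħ : ℝ => ‖scaledCommutator (deformedConv σ ħ) ħ a b - poissonBracket σ a b‖)
      (𝓝[≠] 0) (𝓝 0) := by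
  obtain ⟨u, ha⟩ := exists_hasDensity a
  obtain ⟨v, hb⟩ := exists_hasDensity b
  have ia := ha.integrable_moment h₁ (j := 1) le_rfl
  have ib := hb.integrable_moment h₂ (j := 1) le_rfl
  simp only [pow_one] at ia ib
  have hint := integrable_bilinForm_mul hς ha.rep.carried hb.rep.carried ha.rep.aemeas
    hb.rep.aemeas ha.rep.int.aestronglyMeasurable hb.rep.int.aestronglyMeasurable ia ib
  -- The reversed product is transported by the swap, so that all three terms have densities over
  -- the same measure and the same sum map.
  have hrep : ∀ ħ : ℝ, ImageRep
      ((scaledCommutator (deformedConv σ ħ) ħ a b - poissonBracket σ a b : regularMeasures E) :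
        ComplexMeasure E) _ _ _ := fun ħ =>
    (((ha.rep.deformedConv hb.rep σ ħ).sub (((hb.rep.deformedConv ha.rep σ ħ).comp_equiv
      MeasurableEquiv.prodComm Measure.measurePreserving_swap).congr_map
        fun p => add_comm _ _)).smul (Complex.I / ħ)).sub
      (ha.rep.poissonBracket hb.rep σ hint)
  have hval : ∀ (ħ : ℝ) (p : E × E), Complex.I / ħ * (multiplier σ ħ p.1 p.2
      * (u p.1 * v p.2) - multiplier σ ħ p.2 p.1 * (v p.2 * u p.1))
      - (σ p.1 p.2 : ℂ) * (u p.1 * v p.2)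
      = ((2 / ħ * Real.sin (ħ * σ p.1 p.2 / 2) - σ p.1 p.2 : ℝ) : ℂ) * (u p.1 * v p.2) := by
    intro ħ p
    have := scaled_multiplier_sub σ hσ ħ p.1 p.2
    rw [Complex.ofReal_sub, ← this]
    ring
  refine tendsto_of_tendsto_of_tendsto_of_le_of_le tendsto_const_nhds ?_
    (fun ħ => norm_nonneg _) fun ħ => (hrep ħ).norm_le
  refine tendsto_integral_zero_of_dominated
    (fun p => 2 * ‖(σ p.1 p.2 : ℂ) * (u p.1 * v p.2)‖) (Eventually.of_forall fun ħ =>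
      (hrep ħ).int.aestronglyMeasurable.norm) (Eventually.of_forall fun ħ =>
      Eventually.of_forall fun p => ?_) (hint.norm.const_mul 2)
    (Eventually.of_forall fun p => ?_)
  · rw [norm_norm]
    refine (congrArg norm (hval ħ p)).trans_le ?_
    rw [norm_mul, norm_mul (σ _ _ : ℂ), Complex.norm_real, Complex.norm_real, ← mul_assoc]
    gcongr
    refine (norm_sub_le _ _).trans ?_
    have := abs_two_div_mul_sin_le (σ p.1 p.2) ħ
    simp only [Real.norm_eq_abs]
    linarith
  · refine Tendsto.congr (fun ħ => (congrArg norm (hval ħ p)).symm) ?_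
    have h := ((tendsto_two_div_mul_sin (σ p.1 p.2)).sub_const (σ p.1 p.2))
    rw [sub_self] at h
    have h' := (((Complex.continuous_ofReal.tendsto 0).comp h).mul_const (u p.1 * v p.2)).norm
    simpa using h'

end Limits

end Algebra

section Algebra

variable {E : Type*} [AddCommGroup E] [Module ℝ E] [TopologicalSpace E] [IsFinestLocallyConvex E]
  [MeasurableSpace E] [BorelSpace E]

/-! ### The Poisson bracket -/

section Bracket

variable {σ : LinearMap.BilinForm ℝ E} {ς : Seminorm ℝ E} {a b c : regularMeasures E}

lemma momentMeasures_mono {E : Type*} [AddCommGroup E] [Module ℝ E] [MeasurableSpace E]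
    (κ : Seminorm ℝ E) {n n' : ℕ∞} (h : n ≤ n') : momentMeasures κ n' ≤ momentMeasures κ n :=
  fun _ hμ j hj => hμ j (hj.trans h)

lemma HasDensity.integrable_first_moment {m : Measure E} {w : E → ℂ} (h : HasDensity a m w)
    (ha : a ∈ momentMeasures ς 1) : Integrable (fun x => ς x * ‖w x‖) m := by
  simpa only [pow_one] using h.integrable_moment ha (j := 1) le_rfl

lemma HasDensity.integrable_bilinForm {m m' : Measure E} [SFinite m] [SFinite m'] {u v : E → ℂ}
    (ha : HasDensity a m u) (hb : HasDensity b m' v) (hς : ControlsForm σ ς)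
    (h₁ : a ∈ momentMeasures ς 1) (h₂ : b ∈ momentMeasures ς 1) :
    Integrable (fun p : E × E => (σ p.1 p.2 : ℂ) * (u p.1 * v p.2)) (m.prod m') :=
  integrable_bilinForm_mul (s := fun x => x) (s' := fun x => x) (w := u) (w' := v) hς
    ha.rep.carried hb.rep.carried ha.rep.aemeas hb.rep.aemeas
    ha.rep.int.aestronglyMeasurable hb.rep.int.aestronglyMeasurable
    (ha.integrable_first_moment h₁) (hb.integrable_first_moment h₂)

lemma HasDensity.poissonBracket {m m' : Measure E} [SFinite m] [SFinite m'] {u v : E → ℂ}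
    (ha : HasDensity a m u) (hb : HasDensity b m' v) (hς : ControlsForm σ ς)
    (h₁ : a ∈ momentMeasures ς 1) (h₂ : b ∈ momentMeasures ς 1) :
    ImageRep (poissonBracket σ a b : ComplexMeasure E) (m.prod m')
      (fun p => (σ p.1 p.2 : ℂ) * (u p.1 * v p.2)) fun p => p.1 + p.2 :=
  ha.rep.poissonBracket hb.rep σ (ha.integrable_bilinForm hb hς h₁ h₂)

lemma poissonBracket_apply (hς : ControlsForm σ ς) (h₁ : a ∈ momentMeasures ς 1)
    (h₂ : b ∈ momentMeasures ς 1) {Λ : Set E} (hΛ : MeasurableSet Λ) :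
    (poissonBracket σ a b : ComplexMeasure E) Λ = convValue (fun f g => (σ f g : ℂ)) a b Λ := by
  obtain ⟨u, ha⟩ := exists_hasDensity a
  obtain ⟨v, hb⟩ := exists_hasDensity b
  exact (ha.rep.exists_conv hb.rep (fdMeasurable_bilinForm_complex σ)
    (fun f => Complex.measurable_ofReal.comp (measurable_bilinForm_left σ f))
    (ha.integrable_bilinForm hb hς h₁ h₂)).2 Λ hΛ

lemma measureStar_mem_momentMeasures {κ : Seminorm ℝ E} {n : ℕ∞} (h : a ∈ momentMeasures κ n) :
    measureStar a ∈ momentMeasures κ n := by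
  obtain ⟨u, ha⟩ := exists_hasDensity a
  refine ha.rep.measureStar.mem_momentMeasures fun j hj => ?_
  simpa using ha.integrable_moment h hj

lemma deformedConv_mem_momentMeasures {κ : Seminorm ℝ E} {n : ℕ∞} (σ : LinearMap.BilinForm ℝ E)
    (ħ : ℝ) (h₁ : a ∈ momentMeasures κ n) (h₂ : b ∈ momentMeasures κ n) :
    deformedConv σ ħ a b ∈ momentMeasures κ n := by
  obtain ⟨u, ha⟩ := exists_hasDensity a
  obtain ⟨v, hb⟩ := exists_hasDensity b
  have hrep := ha.rep.deformedConv hb.rep σ ħ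
  refine hrep.mem_momentMeasures fun j hj => ?_
  refine integrable_moment_kernel (s := fun x => x) (s' := fun x => x) (w := u) (w' := v) κ
    (k := multiplier σ ħ) (q := fun _ => 1) (c := 1)
    (fun f g => by simp [norm_multiplier]) hrep.aemeas hrep.int.aestronglyMeasurable j ?_ ?_ ?_ ?_
  · simpa using ha.rep.int.norm
  · simpa using ha.integrable_moment h₁ hj
  · simpa using hb.rep.int.norm
  · simpa using hb.integrable_moment h₂ hj

/-- The bound on σ puts one factor ς on each variable, so κ-moments of the bracket cost mixed
moments of `κ ^ j * ς`. This is why moments of all orders are required. -/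
lemma HasDensity.integrable_moment_poissonBracket {m m' : Measure E} [SFinite m] [SFinite m']
    {u v : E → ℂ} (ha : HasDensity a m u) (hb : HasDensity b m' v) (hς : ControlsForm σ ς)
    {κ : Seminorm ℝ E} (h₁ : a ∈ momentMeasures κ ⊤) (h₂ : b ∈ momentMeasures κ ⊤)
    (h₁' : a ∈ momentMeasures ς ⊤) (h₂' : b ∈ momentMeasures ς ⊤) (j : ℕ) :
    Integrable (fun p : E × E => κ (p.1 + p.2) ^ j
      * ‖(σ p.1 p.2 : ℂ) * (u p.1 * v p.2)‖) (m.prod m') := by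
  have k₁ := momentMeasures_mono ς (n := 1) le_top h₁'
  have k₂ := momentMeasures_mono ς (n := 1) le_top h₂'
  have hrep := ha.poissonBracket hb hς k₁ k₂
  have hς' := hς
  obtain ⟨c, hc, hσ⟩ := hς
  refine integrable_moment_kernel (s := fun x => x) (s' := fun x => x) (w := u) (w' := v) κ
    (q := fun f => ς f) (c := c)
    (k := fun f g => (σ f g : ℂ)) (fun f g => ?_) hrep.aemeas
    hrep.int.aestronglyMeasurable j ?_ ?_ ?_ ?_
  · rw [Complex.norm_real]
    exact hσ f g
  · exact ha.integrable_first_moment k₁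
  · exact ha.integrable_mixed_moment h₁ h₁' j
  · exact hb.integrable_first_moment k₂
  · exact hb.integrable_mixed_moment h₂ h₂' j

lemma poissonBracket_mem_momentMeasures (hς : ControlsForm σ ς) {κ : Seminorm ℝ E}
    (h₁ : a ∈ momentMeasures κ ⊤) (h₂ : b ∈ momentMeasures κ ⊤) (h₁' : a ∈ momentMeasures ς ⊤)
    (h₂' : b ∈ momentMeasures ς ⊤) : poissonBracket σ a b ∈ momentMeasures κ ⊤ := by
  obtain ⟨u, ha⟩ := exists_hasDensity a
  obtain ⟨v, hb⟩ := exists_hasDensity b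
  exact (ha.poissonBracket hb hς (momentMeasures_mono ς (n := 1) le_top h₁')
    (momentMeasures_mono ς (n := 1) le_top h₂')).mem_momentMeasures fun j _ =>
      ha.integrable_moment_poissonBracket hb hς h₁ h₂ h₁' h₂' j

lemma poissonBracket_add (hς : ControlsForm σ ς) (h₁ : a ∈ momentMeasures ς 1)
    (h₂ : b ∈ momentMeasures ς 1) (h₃ : c ∈ momentMeasures ς 1) :
    poissonBracket σ a (b + c) = poissonBracket σ a b + poissonBracket σ a c := by
  obtain ⟨m, _, u, v, w, ha, hb, hc⟩ := exists_hasDensity₃ a b c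
  have hbc : ImageRep ((b + c : regularMeasures E) : ComplexMeasure E) m _ fun x => x :=
      hb.rep.add hc.rep
  have hint := (ha.integrable_bilinForm hb hς h₁ h₂).add (ha.integrable_bilinForm hc hς h₁ h₃)
  exact (ha.rep.poissonBracket hbc σ (hint.congr (Eventually.of_forall fun p => by
    simp only [Pi.add_apply]; ring))).eq_of
    ((ha.poissonBracket hb hς h₁ h₂).add (ha.poissonBracket hc hς h₁ h₃))
    (fun p => by ring) fun p => rfl

lemma poissonBracket_smul (hς : ControlsForm σ ς) (h₁ : a ∈ momentMeasures ς 1)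
    (h₂ : b ∈ momentMeasures ς 1) (z : ℂ) :
    poissonBracket σ a (z • b) = z • poissonBracket σ a b := by
  obtain ⟨u, ha⟩ := exists_hasDensity a
  obtain ⟨v, hb⟩ := exists_hasDensity b
  have hzb : ImageRep ((z • b : regularMeasures E) : ComplexMeasure E) _ _ fun x => x :=
      hb.rep.smul z
  have hint := (ha.integrable_bilinForm hb hς h₁ h₂).const_mul z
  exact (ha.rep.poissonBracket hzb σ (hint.congr (Eventually.of_forall fun p => by
    simp only; ring))).eq_of
    ((ha.poissonBracket hb hς h₁ h₂).smul z) (fun p => by ring) fun p => rfl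

lemma poissonBracket_anticomm (hσ : σ.IsAlt) (hς : ControlsForm σ ς) (h₁ : a ∈ momentMeasures ς 1)
    (h₂ : b ∈ momentMeasures ς 1) : poissonBracket σ a b = -poissonBracket σ b a := by
  obtain ⟨u, ha⟩ := exists_hasDensity a
  obtain ⟨v, hb⟩ := exists_hasDensity b
  refine (ha.poissonBracket hb hς h₁ h₂).eq_of ((hb.poissonBracket ha hς h₂ h₁).neg.comp_equiv
    MeasurableEquiv.prodComm Measure.measurePreserving_swap) (fun p => ?_) fun p => ?_
  · have := hσ.neg_eq p.1 p.2
    simp only [MeasurableEquiv.prodComm, MeasurableEquiv.coe_mk, Equiv.prodComm_apply,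
      Prod.fst_swap, Prod.snd_swap, ← this]
    push_cast
    ring
  · simp [MeasurableEquiv.prodComm, add_comm]

lemma measureStar_poissonBracket (hς : ControlsForm σ ς) (h₁ : a ∈ momentMeasures ς 1)
    (h₂ : b ∈ momentMeasures ς 1) :
    measureStar (poissonBracket σ a b) = poissonBracket σ (measureStar a) (measureStar b) := by
  obtain ⟨u, ha⟩ := exists_hasDensity a
  obtain ⟨v, hb⟩ := exists_hasDensity b
  have hrep := (ha.poissonBracket hb hς h₁ h₂).measureStar
  refine hrep.eq_of (ha.rep.measureStar.poissonBracket hb.rep.measureStar σ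
    (hrep.int.congr (Eventually.of_forall fun p => ?_))) (fun p => ?_) fun p => ?_
  · simp
  · simp
  · simp [add_comm]

/-- The representation of an iterated bracket. -/
lemma HasDensity.poissonBracket_poissonBracket {m₁ m₂ m₃ : Measure E} [SFinite m₁] [SFinite m₂]
    [SFinite m₃] {u v w : E → ℂ} (ha : HasDensity a m₁ u) (hb : HasDensity b m₂ v)
    (hc : HasDensity c m₃ w) (hς : ControlsForm σ ς) (h₁ : a ∈ momentMeasures ς ⊤)
    (h₂ : b ∈ momentMeasures ς ⊤) (h₃ : c ∈ momentMeasures ς ⊤) :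
    ImageRep (_root_.poissonBracket σ a (_root_.poissonBracket σ b c) : ComplexMeasure E)
      (m₁.prod (m₂.prod m₃))
      (fun p => (σ p.1 (p.2.1 + p.2.2) : ℂ)
        * (u p.1 * ((σ p.2.1 p.2.2 : ℂ) * (v p.2.1 * w p.2.2))))
      fun p => p.1 + (p.2.1 + p.2.2) := by
  have k₁ := momentMeasures_mono ς (n := 1) le_top h₁
  have hbc := hb.poissonBracket hc hς (momentMeasures_mono ς (n := 1) le_top h₂)
    (momentMeasures_mono ς (n := 1) le_top h₃)
  -- The outer bracket needs the first ς-moment of the density representing the inner one.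
  have hmom := hb.integrable_moment_poissonBracket hc hς h₂ h₃ h₂ h₃ 1
  simp only [pow_one] at hmom
  exact ImageRep.poissonBracket (s := fun x => x) (s' := fun p : E × E => p.1 + p.2) (w := u)
    (w' := fun p : E × E => (σ p.1 p.2 : ℂ) * (v p.1 * w p.2)) ha.rep hbc σ
    (integrable_bilinForm_mul (s := fun x => x) (s' := fun p : E × E => p.1 + p.2) (w := u)
    (w' := fun p : E × E => (σ p.1 p.2 : ℂ) * (v p.1 * w p.2)) hς ha.rep.carried hbc.carried
    ha.rep.aemeas hbc.aemeas ha.rep.int.aestronglyMeasurable hbc.int.aestronglyMeasurable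
    (ha.integrable_first_moment k₁) hmom)

/-- The cyclic permutation of a triple product. -/
def cyclicEquiv (X Y Z : Type*) [MeasurableSpace X] [MeasurableSpace Y] [MeasurableSpace Z] :
    X × (Y × Z) ≃ᵐ Y × (Z × X) :=
  MeasurableEquiv.prodComm.trans MeasurableEquiv.prodAssoc

lemma measurePreserving_cyclicEquiv {X Y Z : Type*} [MeasurableSpace X] [MeasurableSpace Y]
    [MeasurableSpace Z] (m₁ : Measure X) (m₂ : Measure Y) (m₃ : Measure Z) [SFinite m₁]
    [SFinite m₂] [SFinite m₃] :
    MeasurePreserving (cyclicEquiv X Y Z) (m₁.prod (m₂.prod m₃)) (m₂.prod (m₃.prod m₁)) :=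
  (measurePreserving_prodAssoc m₂ m₃ m₁).comp Measure.measurePreserving_swap

/-- Over the common triple product, write p = σ(x,y), q = σ(y,z), r = σ(z,x). The three kernels are
(p − r)q, (q − p)r and (r − q)p, which add up to zero. -/
lemma poissonBracket_jacobi (hσ : σ.IsAlt) (hς : ControlsForm σ ς) (h₁ : a ∈ momentMeasures ς ⊤)
    (h₂ : b ∈ momentMeasures ς ⊤) (h₃ : c ∈ momentMeasures ς ⊤) :
    poissonBracket σ a (poissonBracket σ b c) + poissonBracket σ b (poissonBracket σ c a)
      + poissonBracket σ c (poissonBracket σ a b) = 0 := by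
  obtain ⟨u, ha⟩ := exists_hasDensity a
  obtain ⟨v, hb⟩ := exists_hasDensity b
  obtain ⟨w, hc⟩ := exists_hasDensity c
  have t₁ := ha.poissonBracket_poissonBracket hb hc hς h₁ h₂ h₃
  have t₂ : ImageRep (poissonBracket σ b (poissonBracket σ c a) : ComplexMeasure E) _
      (fun p : E × (E × E) => (σ p.2.1 (p.2.2 + p.1) : ℂ)
        * (v p.2.1 * ((σ p.2.2 p.1 : ℂ) * (w p.2.2 * u p.1)))) fun p => p.2.1 + (p.2.2 + p.1) :=
    (hb.poissonBracket_poissonBracket hc ha hς h₂ h₃ h₁).comp_equiv (cyclicEquiv E E E)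
      (measurePreserving_cyclicEquiv _ _ _)
  have t₃ : ImageRep (poissonBracket σ c (poissonBracket σ a b) : ComplexMeasure E) _
      (fun p : E × (E × E) => (σ p.2.2 (p.1 + p.2.1) : ℂ)
        * (w p.2.2 * ((σ p.1 p.2.1 : ℂ) * (u p.1 * v p.2.1)))) fun p => p.2.2 + (p.1 + p.2.1) :=
    (hc.poissonBracket_poissonBracket ha hb hς h₃ h₁ h₂).comp_equiv
      ((cyclicEquiv E E E).trans (cyclicEquiv E E E))
      ((measurePreserving_cyclicEquiv _ _ _).comp (measurePreserving_cyclicEquiv _ _ _))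
  have t := (t₁.add (t₂.congr_map (s' := fun p => p.1 + (p.2.1 + p.2.2)) fun p => by abel)).add
    (t₃.congr_map (s' := fun p => p.1 + (p.2.1 + p.2.2)) fun p => by abel)
  -- The zero measure is represented over the same data as the left-hand side, as a zero multiple of
  -- the first term.
  have t₀ := t₁.smul 0
  refine ImageRep.eq_of (μ := poissonBracket σ a (poissonBracket σ b c)
    + poissonBracket σ b (poissonBracket σ c a) + poissonBracket σ c (poissonBracket σ a b))
    (ν := (0 : ℂ) • poissonBracket σ a (poissonBracket σ b c)) t t₀
    (fun p => ?_) (fun p => rfl) |>.trans (zero_smul _ _)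
  have s₁ := hσ.neg_eq p.1 p.2.1
  have s₂ := hσ.neg_eq p.2.1 p.2.2
  have s₃ := hσ.neg_eq p.2.2 p.1
  simp only [map_add, ← s₁, ← s₂, ← s₃]
  push_cast
  ring

/-- The representation of the product of a bracket and a measure. -/
lemma HasDensity.poissonBracket_conv {m₁ m₂ m₃ : Measure E} [SFinite m₁] [SFinite m₂]
    [SFinite m₃] {u v w : E → ℂ} (ha : HasDensity a m₁ u) (hb : HasDensity b m₂ v)
    (hc : HasDensity c m₃ w) (hς : ControlsForm σ ς) (h₁ : a ∈ momentMeasures ς 1)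
    (h₂ : b ∈ momentMeasures ς 1) :
    ImageRep (deformedConv σ 0 (_root_.poissonBracket σ a b) c : ComplexMeasure E)
      (m₁.prod (m₂.prod m₃))
      (fun p => (σ p.1 p.2.1 : ℂ) * (u p.1 * v p.2.1) * w p.2.2)
      fun p => p.1 + (p.2.1 + p.2.2) := by
  have t := (ImageRep.deformedConv_zero σ (ha.poissonBracket hb hς h₁ h₂) hc.rep).comp_equiv
    MeasurableEquiv.prodAssoc.symm ((measurePreserving_prodAssoc _ _ _).symm _)
  exact t.congr_map fun p => add_assoc _ _ _

lemma measurePreserving_prodCongr_refl_comm {X Y Z : Type*} [MeasurableSpace X]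
    [MeasurableSpace Y] [MeasurableSpace Z] (m₁ : Measure X) (m₂ : Measure Y) (m₃ : Measure Z)
    [SFinite m₁] [SFinite m₂] [SFinite m₃] :
    MeasurePreserving (MeasurableEquiv.prodCongr (MeasurableEquiv.refl X)
      (MeasurableEquiv.prodComm (α := Y) (β := Z))) (m₁.prod (m₂.prod m₃))
      (m₁.prod (m₃.prod m₂)) :=
  (MeasurePreserving.id m₁).prod Measure.measurePreserving_swap

/-- Convolution adds vectors, so the rule is the additivity σ(x, y + z) = σ(x, y) + σ(x, z). -/
lemma poissonBracket_leibniz (hς : ControlsForm σ ς) (h₁ : a ∈ momentMeasures ς 1)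
    (h₂ : b ∈ momentMeasures ς 1) (h₃ : c ∈ momentMeasures ς 1) :
    poissonBracket σ a (deformedConv σ 0 b c)
      = deformedConv σ 0 (poissonBracket σ a b) c + deformedConv σ 0 b (poissonBracket σ a c) := by
  obtain ⟨u, ha⟩ := exists_hasDensity a
  obtain ⟨v, hb⟩ := exists_hasDensity b
  obtain ⟨w, hc⟩ := exists_hasDensity c
  have t₁ := ha.poissonBracket_conv hb hc hς h₁ h₂
  have t₂ := (ha.poissonBracket_conv hc hb hς h₁ h₃).comp_equiv _
    (measurePreserving_prodCongr_refl_comm _ _ _)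
  have t₂' := t₂.congr_map (s' := fun p => p.1 + (p.2.1 + p.2.2)) fun p =>
    congrArg (p.1 + ·) (add_comm _ _)
  have hval : ∀ p : E × (E × E),
      (σ p.1 p.2.1 : ℂ) * (u p.1 * v p.2.1) * w p.2.2 + (σ p.1 p.2.2 : ℂ) * (u p.1 * w p.2.2)
        * v p.2.1 = (σ p.1 (p.2.1 + p.2.2) : ℂ) * (u p.1 * (v p.2.1 * w p.2.2)) := fun p => by
    rw [map_add]
    push_cast
    ring
  have t₃ := t₁.add t₂'
  have t := t₃.congr (w' := fun p => (σ p.1 (p.2.1 + p.2.2) : ℂ) * (u p.1 * (v p.2.1 * w p.2.2)))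
    (Eventually.of_forall fun p => hval p)
  -- Integrability of the density for the left side is read off from the right side, so moments of
  -- the product `b ⋆ c` are not needed.
  have t' : ImageRep (poissonBracket σ a (deformedConv σ 0 b c) : ComplexMeasure E) _ _ _ :=
    ImageRep.poissonBracket (s := fun x => x) (s' := fun p : E × E => p.1 + p.2) (w := u)
    (w' := fun p : E × E => v p.1 * w p.2) ha.rep (ImageRep.deformedConv_zero σ hb.rep hc.rep) σ
    t.int
  rw [deformedConv_zero_comm σ b (poissonBracket σ a c)]
  exact Subtype.ext (t'.unique t)

end Bracket

end Algebra

/-! ## Discrete, continuous and absolutely continuous measures -/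

section Classes

variable {E : Type*} [AddCommGroup E] [Module ℝ E] [TopologicalSpace E] [IsFinestLocallyConvex E]
  [MeasurableSpace E] [BorelSpace E]

variable {X : Type*} [MeasurableSpace X] {m : Measure X} {w : X → ℂ} {s : X → E}

omit [TopologicalSpace E] [IsFinestLocallyConvex E] [BorelSpace E] in
lemma ImageRep.variation_eq_zero {μ : ComplexMeasure E} (h : ImageRep μ m w s) {Λ : Set E}
    (hΛ : MeasurableSet Λ) (hx : ∀ᵐ x ∂m, s x ∉ Λ) : μ.variation Λ = 0 := by
  have h₁ : ∀ᵐ f ∂μ.variation, f ∉ Λ := Measure.absolutelyContinuous_of_le h.variation_le |>.ae_le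
    (ae_absImage_of_ae h.aemeas hΛ.compl hx)
  exact measure_eq_zero_iff_ae_notMem.2 h₁

lemma variation_compl_eq_zero_of_countable {μ : ComplexMeasure E} {S : Set E} (hS : S.Countable)
    (h : ∀ Λ, MeasurableSet Λ → Disjoint Λ S → μ Λ = 0) : μ.variation Sᶜ = 0 := by
  rw [VectorMeasure.variation_apply_eq_zero hS.measurableSet.compl]
  exact fun t ht hm => h t hm (Set.disjoint_left.2 fun x hx hxα => ht hx hxα)

omit [AddCommGroup E] [Module ℝ E] [TopologicalSpace E] [IsFinestLocallyConvex E] [BorelSpace E] in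
lemma apply_eq_zero_of_variation {μ : ComplexMeasure E} {Λ : Set E} (h : μ.variation Λ = 0) :
    μ Λ = 0 := by
  have := VectorMeasure.enorm_measure_le_variation μ Λ
  rw [h] at this
  simpa using this

omit [AddCommGroup E] [Module ℝ E] [TopologicalSpace E] [IsFinestLocallyConvex E] [BorelSpace E] in
lemma apply_eq_zero_of_disjoint {μ : ComplexMeasure E} {S Λ : Set E} (h : μ.variation Sᶜ = 0)
    (hd : Disjoint Λ S) : μ Λ = 0 :=
  apply_eq_zero_of_variation (measure_mono_null (Set.disjoint_left.1 hd) h)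

lemma variation_singleton_eq_zero_iff {μ : ComplexMeasure E} {f : E} :
    μ.variation {f} = 0 ↔ μ {f} = 0 := by
  refine ⟨apply_eq_zero_of_variation, fun h => ?_⟩
  rw [VectorMeasure.variation_apply_eq_zero (measurableSet_singleton f)]
  intro t ht _
  rcases Set.subset_singleton_iff_eq.1 ht with rfl | rfl
  · simp
  · exact h

/-- The countable sets of an approximating sequence have a countable union, which carries the limit.
Conversely, restrictions to a flag carrying the measure are discrete and converge to it. -/
lemma mem_regularDiscrete_iff {μ : regularMeasures E} : μ ∈ regularDiscrete E ↔
    ∃ S : Set E, S.Countable ∧ (μ : ComplexMeasure E).variation Sᶜ = 0 := by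
  constructor
  · intro h
    obtain ⟨u, α, hα, hu, hlim⟩ := exists_seq_of_mem_closure (V := discreteMeasuresOn)
      (fun α β hαβ ν hν => ⟨measuresOn_mono hαβ hν.1, hν.2⟩) (Submodule.mem_comap.1 h)
    choose S hS hSu using fun n => (hu n).2
    refine ⟨⋃ n, S n, Set.countable_iUnion hS, variation_eq_zero_of_tendsto hlim fun n => ?_⟩
    exact measure_mono_null (Set.compl_subset_compl.2 (Set.subset_iUnion S n))
      (variation_compl_eq_zero_of_countable (hS n) (hSu n))
  · rintro ⟨S, hS, h⟩
    refine Submodule.mem_comap.2 (mem_closure_of_flagCarried (V := discreteMeasuresOn)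
      (flagCarried_variation μ) fun α hα => ⟨restrict_mem_measuresOn _ α, S, hS, fun Λ hΛ hd => ?_⟩)
    rw [VectorMeasure.restrict_apply _ α.measurableSet_of_finiteDimensional hΛ]
    exact apply_eq_zero_of_disjoint h (hd.mono_left Set.inter_subset_left)

lemma mem_regularContinuous_iff {μ : regularMeasures E} : μ ∈ regularContinuous E ↔
    ∀ f : E, (μ : ComplexMeasure E).variation {f} = 0 := by
  constructor
  · intro h f
    obtain ⟨u, α, hα, hu, hlim⟩ := exists_seq_of_mem_closure (V := continuousMeasuresOn)
      (fun α β hαβ ν hν => ⟨measuresOn_mono hαβ hν.1, hν.2⟩) (Submodule.mem_comap.1 h)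
    exact variation_eq_zero_of_tendsto hlim fun n => variation_singleton_eq_zero_iff.2 ((hu n).2 f)
  · intro h
    refine Submodule.mem_comap.2 (mem_closure_of_flagCarried (V := continuousMeasuresOn)
      (flagCarried_variation μ) fun α hα => ⟨restrict_mem_measuresOn _ α, fun f => ?_⟩)
    rw [VectorMeasure.restrict_apply _ α.measurableSet_of_finiteDimensional
      (measurableSet_singleton f)]
    exact apply_eq_zero_of_variation (measure_mono_null Set.inter_subset_left (h f))

lemma mem_regularFinite_iff {μ : regularMeasures E} : μ ∈ regularFinite E ↔
    ∃ S : Set E, S.Finite ∧ (μ : ComplexMeasure E).variation Sᶜ = 0 := by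
  constructor
  · intro h
    refine Submodule.span_induction (p := fun (ν : ComplexMeasure E) _ =>
      ∃ S : Set E, S.Finite ∧ ν.variation Sᶜ = 0) ?_ ?_ ?_ ?_ (Submodule.mem_comap.1 h)
    · rintro _ ⟨f, rfl⟩
      refine ⟨{f}, Set.finite_singleton f, ?_⟩
      rw [VectorMeasure.variation_apply_eq_zero (measurableSet_singleton f).compl]
      intro t ht hm
      rw [VectorMeasure.dirac_apply_of_notMem fun hf => ht hf rfl]
    · exact ⟨∅, Set.finite_empty, by simp⟩
    · rintro ν ν' - - ⟨S, hS, h⟩ ⟨S', hS', h'⟩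
      refine ⟨S ∪ S', hS.union hS', le_antisymm ?_ zero_le⟩
      refine (VectorMeasure.variation_add_le _).trans ?_
      rw [Measure.add_apply, measure_mono_null (Set.compl_subset_compl.2 Set.subset_union_left) h,
        measure_mono_null (Set.compl_subset_compl.2 Set.subset_union_right) h', add_zero]
    · rintro z ν - ⟨S, hS, h⟩
      refine ⟨S, hS, ?_⟩
      rw [VectorMeasure.variation_smul, Measure.smul_apply, h, smul_zero]
  · rintro ⟨S, hS, h⟩
    refine Submodule.mem_comap.2 ?_
    -- A measure carried by a finite set is the sum of its atoms.
    have hsum : (μ : ComplexMeasure E) = ∑ f ∈ hS.toFinset,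
        (μ : ComplexMeasure E) {f} • (VectorMeasure.dirac f (1 : ℂ) : ComplexMeasure E) := by
      ext Λ hΛ
      have h₁ : (μ : ComplexMeasure E) (Λ ∩ S) = ∑ f ∈ hS.toFinset,
          (μ : ComplexMeasure E) (Λ ∩ {f}) := by
        rw [← VectorMeasure.of_biUnion_finset]
        · congr 1
          ext x
          simp [and_comm]
        · intro f _ g _ hfg
          exact (Set.disjoint_singleton.2 hfg).mono Set.inter_subset_right Set.inter_subset_right
        · exact fun f _ => hΛ.inter (measurableSet_singleton f)
      rw [← VectorMeasure.of_add_of_sdiff (hΛ.inter hS.measurableSet) hΛ Set.inter_subset_left,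
        Set.sdiff_self_inter, apply_eq_zero_of_disjoint h Set.disjoint_sdiff_left, add_zero, h₁,
        FunLike.coe_sum, Finset.sum_apply]
      refine Finset.sum_congr rfl fun f _ => ?_
      rw [FunLike.coe_smul, Pi.smul_apply]
      by_cases hf : f ∈ Λ
      · rw [VectorMeasure.dirac_apply_of_mem hΛ hf, Set.inter_eq_right.2
          (Set.singleton_subset_iff.2 hf), smul_eq_mul, mul_one]
      · rw [VectorMeasure.dirac_apply_of_notMem hf, Set.inter_singleton_eq_empty.2 hf,
          VectorMeasure.empty, smul_zero]
    rw [Submodule.subtype_apply, hsum]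
    exact Submodule.sum_mem _ fun f _ => Submodule.smul_mem _ _ (Submodule.subset_span ⟨f, rfl⟩)

lemma mem_regularAbsCont_iff {μ : regularMeasures E} {α : Submodule ℝ E} [FiniteDimensional ℝ α] :
    μ ∈ regularAbsCont α ↔ (μ : ComplexMeasure E).variation (α : Set E)ᶜ = 0 ∧
      ∀ m : Measure α, m.IsAddHaarMeasure → ∀ Λ : Set E, MeasurableSet Λ →
        m ((↑) ⁻¹' Λ) = 0 → (μ : ComplexMeasure E).variation Λ = 0 := by
  constructor
  · rintro ⟨h, h'⟩
    refine ⟨mem_measuresOn_iff.1 h, fun m hm Λ hΛ h0 => ?_⟩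
    rw [VectorMeasure.variation_apply_eq_zero hΛ]
    exact fun t ht hmeas => h' m hm t hmeas (measure_mono_null (Set.preimage_mono ht) h0)
  · rintro ⟨h, h'⟩
    exact ⟨mem_measuresOn_iff.2 h, fun m hm Λ hΛ h0 => apply_eq_zero_of_variation (h' m hm Λ hΛ h0)⟩

/-- A Haar null set of the image of `α` has a null preimage. -/
lemma ae_map_notMem_of_mem_regularAbsCont {E' : Type*} [AddCommGroup E'] [Module ℝ E']
    [TopologicalSpace E'] [IsFinestLocallyConvex E'] [MeasurableSpace E'] [BorelSpace E']
    {μ : regularMeasures E} {α : Submodule ℝ E} [FiniteDimensional ℝ α]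
    (hμ : μ ∈ regularAbsCont α) (T : E →ₗ[ℝ] E') {ν : Measure (α.map T)}
    (hν : ν.IsAddHaarMeasure) {Λ : Set E'} (hΛ : MeasurableSet Λ)
    (h : ν ((↑) ⁻¹' Λ) = 0) : ∀ᵐ x ∂(μ : ComplexMeasure E).variation, T x ∉ Λ := by
  let e := (Module.finBasis ℝ α).equivFun.toContinuousLinearEquiv
  let e' := (Module.finBasis ℝ (α.map T)).equivFun.toContinuousLinearEquiv
  let R : α →ₗ[ℝ] α.map T := T.submoduleMap α
  have hR : Function.Surjective R := T.submoduleMap_surjective α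
  let L := e'.toLinearMap ∘ₗ R ∘ₗ e.symm.toLinearMap
  have hL : Function.Surjective L := e'.surjective.comp (hR.comp e.symm.surjective)
  have hν' : (ν.map e').IsAddHaarMeasure := e'.isAddHaarMeasure_map ν
  have hm : (Measure.map e.symm volume).IsAddHaarMeasure := e.symm.isAddHaarMeasure_map _
  have hT := T.measurable_of_isFinestLocallyConvex
  have hB : MeasurableSet ((fun y => (e'.symm y : E')) ⁻¹' Λ) :=
    (measurable_subtype_coe.comp e'.symm.continuous.measurable) hΛ
  -- In coordinates this is the fact that surjective linear maps of Euclidean spaces pull Haar null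
  -- sets back to null sets. Surjectivity is available because the target is the image of `α`.
  have key := (ae_comp_linearMap_mem_iff L volume (ν.map e') hL hB.compl).2 (by
    refine (ae_map_iff (p := fun y => y ∈ ((fun y => (e'.symm y : E')) ⁻¹' Λ)ᶜ)
      e'.continuous.measurable.aemeasurable hB.compl).2 ?_
    filter_upwards [measure_eq_zero_iff_ae_notMem.1 h] with y hy
    simpa using hy)
  have := (mem_regularAbsCont_iff.1 hμ).2 _ hm (T ⁻¹' Λ) (hT hΛ) (by
    rw [Measure.map_apply e.symm.continuous.measurable (measurable_subtype_coe (hT hΛ))]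
    refine measure_eq_zero_iff_ae_notMem.2 ?_
    filter_upwards [key] with y hy
    simpa [L, R] using hy)
  exact measure_eq_zero_iff_ae_notMem.1 this

omit [TopologicalSpace E] [IsFinestLocallyConvex E] [BorelSpace E] in
/-- Convolutions of regular measures, twisted by a kernel, do not charge `Λ` if almost all
translates of `Λ` are null. -/
lemma ImageRep.variation_eq_zero_of_translates {ρ : ComplexMeasure E} {m m' : Measure E}
    [SFinite m] [SFinite m'] {w : E × E → ℂ} (h : ImageRep ρ (m.prod m') w fun p => p.1 + p.2)
    {Λ : Set E} (hΛ : MeasurableSet Λ) (hx : ∀ᵐ x ∂m, m' ((x + ·) ⁻¹' Λ) = 0) :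
    ρ.variation Λ = 0 := by
  refine h.variation_eq_zero hΛ ?_
  have h₁ : AEMeasurable (fun p : E × E => Λ.indicator (1 : E → ℝ≥0∞) (p.1 + p.2)) (m.prod m') :=
    (measurable_one.indicator hΛ).comp_aemeasurable h.aemeas
  -- By Tonelli the integral over the second variable is the mass of a translate of `Λ`.
  have h₂ : ∫⁻ p : E × E, Λ.indicator (1 : E → ℝ≥0∞) (p.1 + p.2) ∂(m.prod m') = 0 := by
    rw [lintegral_prod _ h₁, ← lintegral_zero (μ := m)]
    refine lintegral_congr_ae ?_
    filter_upwards [hx] with x hx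
    rw [← lintegral_zero (μ := m')]
    refine lintegral_congr_ae ?_
    have hx' : ∀ᵐ y ∂m', x + y ∉ Λ := measure_eq_zero_iff_ae_notMem.1 hx
    filter_upwards [hx'] with y hy
    simp [hy]
  rw [lintegral_eq_zero_iff' h₁] at h₂
  filter_upwards [h₂] with p hp
  intro hmem
  simp [hmem] at hp

/-- A space of regular measures which is stable under the involution and under all twisted
convolutions. -/
structure ConvStable (P : Submodule ℂ (regularMeasures E)) : Prop where
  star_mem : ∀ a ∈ P, measureStar a ∈ P
  conv_mem : ∀ a ∈ P, ∀ b ∈ P, ∀ (ρ : regularMeasures E) (w : E × E → ℂ),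
    ImageRep (ρ : ComplexMeasure E) ((a : ComplexMeasure E).variation.prod
      (b : ComplexMeasure E).variation) w (fun p => p.1 + p.2) → ρ ∈ P

lemma exists_imageRep_measureStar (a : regularMeasures E) : ∃ w : E → ℂ,
    ImageRep (measureStar a : ComplexMeasure E) (a : ComplexMeasure E).variation w fun x => -x := by
  obtain ⟨u, ha⟩ := exists_hasDensity a
  exact ⟨_, ha.rep.measureStar⟩

omit [Module ℝ E] [TopologicalSpace E] [IsFinestLocallyConvex E] [BorelSpace E] in
open scoped Pointwise in
lemma ae_prod_add_mem {m m' : Measure E} [SFinite m] [SFinite m'] {S S' : Set E}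
    (h : m Sᶜ = 0) (h' : m' S'ᶜ = 0) : ∀ᵐ p ∂(m.prod m'), p.1 + p.2 ∈ S + S' := by
  filter_upwards [Measure.quasiMeasurePreserving_fst.ae (mem_ae_iff.2 h),
    Measure.quasiMeasurePreserving_snd.ae (mem_ae_iff.2 h')] with p h₁ h₂
  exact Set.add_mem_add h₁ h₂

lemma convStable_regularDiscrete : ConvStable (regularDiscrete E) where
  star_mem a ha := by
    obtain ⟨S, hS, h⟩ := mem_regularDiscrete_iff.1 ha
    obtain ⟨w, hw⟩ := exists_imageRep_measureStar a
    have hS' : (Neg.neg ⁻¹' S).Countable := hS.preimage neg_injective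
    refine mem_regularDiscrete_iff.2 ⟨_, hS', hw.variation_eq_zero hS'.measurableSet.compl ?_⟩
    filter_upwards [mem_ae_iff.2 h] with x hx
    simpa using hx
  conv_mem a ha b hb ρ w hw := by
    obtain ⟨S, hS, h⟩ := mem_regularDiscrete_iff.1 ha
    obtain ⟨S', hS', h'⟩ := mem_regularDiscrete_iff.1 hb
    have hSS := hS.image2 hS' (· + ·)
    refine mem_regularDiscrete_iff.2 ⟨_, hSS, hw.variation_eq_zero hSS.measurableSet.compl ?_⟩
    filter_upwards [ae_prod_add_mem h h'] with p hp
    simpa using hp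

lemma convStable_regularFinite : ConvStable (regularFinite E) where
  star_mem a ha := by
    obtain ⟨S, hS, h⟩ := mem_regularFinite_iff.1 ha
    obtain ⟨w, hw⟩ := exists_imageRep_measureStar a
    have hS' : (Neg.neg ⁻¹' S).Finite := hS.preimage neg_injective.injOn
    refine mem_regularFinite_iff.2 ⟨_, hS', hw.variation_eq_zero hS'.measurableSet.compl ?_⟩
    filter_upwards [mem_ae_iff.2 h] with x hx
    simpa using hx
  conv_mem a ha b hb ρ w hw := by
    obtain ⟨S, hS, h⟩ := mem_regularFinite_iff.1 ha
    obtain ⟨S', hS', h'⟩ := mem_regularFinite_iff.1 hb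
    refine mem_regularFinite_iff.2 ⟨_, hS.add hS',
      hw.variation_eq_zero (hS.add hS').measurableSet.compl ?_⟩
    filter_upwards [ae_prod_add_mem h h'] with p hp
    simpa using hp

/-- A translate of a point is a point, hence null for the second factor; continuity of one factor
would suffice. -/
lemma convStable_regularContinuous : ConvStable (regularContinuous E) where
  star_mem a ha := by
    obtain ⟨w, hw⟩ := exists_imageRep_measureStar a
    refine mem_regularContinuous_iff.2 fun f => hw.variation_eq_zero (measurableSet_singleton f) ?_
    have h := mem_regularContinuous_iff.1 ha (-f)
    rw [ae_iff]
    convert h using 2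
    ext x
    simp [neg_eq_iff_eq_neg]
  conv_mem a ha b hb ρ w hw := by
    refine mem_regularContinuous_iff.2 fun f =>
      hw.variation_eq_zero_of_translates (measurableSet_singleton f)
        (Eventually.of_forall fun x => ?_)
    convert mem_regularContinuous_iff.1 hb (f - x) using 2
    ext y
    simp [eq_sub_iff_add_eq', eq_neg_add_iff_add_eq]

lemma convStable_regularAbsCont (α : Submodule ℝ E) [FiniteDimensional ℝ α] :
    ConvStable (regularAbsCont α) where
  star_mem a ha := by
    obtain ⟨w, hw⟩ := exists_imageRep_measureStar a
    have hα := α.measurableSet_of_finiteDimensional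
    refine mem_regularAbsCont_iff.2 ⟨hw.variation_eq_zero hα.compl ?_, fun m hm Λ hΛ h0 =>
      hw.variation_eq_zero hΛ ?_⟩
    · filter_upwards [mem_ae_iff.2 (mem_regularAbsCont_iff.1 ha).1] with x hx
      simpa using hx
    · have e : α.map (-LinearMap.id : E →ₗ[ℝ] E) = α := by simp
      -- The image of `α` under negation equals `α` only propositionally; quantifying over `β`
      -- transports the Haar measure along this equality.
      have key : ∀ β : Submodule ℝ E, β = α → ∃ ν : Measure β, ν.IsAddHaarMeasure ∧
          ν ((↑) ⁻¹' Λ) = 0 := by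
        rintro β rfl
        exact ⟨m, hm, h0⟩
      obtain ⟨ν, hν, h⟩ := key _ e
      simpa using ae_map_notMem_of_mem_regularAbsCont ha _ hν hΛ h
  conv_mem a ha b hb ρ w hw := by
    have hα := α.measurableSet_of_finiteDimensional
    have ha' := (mem_regularAbsCont_iff.1 ha).1
    refine mem_regularAbsCont_iff.2 ⟨hw.variation_eq_zero hα.compl ?_, fun m hm Λ hΛ h0 =>
      hw.variation_eq_zero_of_translates hΛ ?_⟩
    · filter_upwards [ae_prod_add_mem ha' (mem_regularAbsCont_iff.1 hb).1] with p hp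
      obtain ⟨x, hx, y, hy, hxy⟩ := hp
      simpa [← hxy] using α.add_mem hx hy
    · filter_upwards [mem_ae_iff.2 ha'] with x hx
      have hadd : Measurable fun y : E => x + y := (continuous_const.add continuous_id).measurable
      refine (mem_regularAbsCont_iff.1 hb).2 m hm _ (hadd hΛ) ?_
      -- Almost every `x` lies in `α`, so translation by `x` preserves Haar measure on `α`.
      have hmeas := measure_preimage_add m ⟨x, hx⟩ ((↑) ⁻¹' Λ)
      rw [h0] at hmeas
      exact hmeas

/-! ### Measure Poisson algebras -/

/-- A space of regular measures which is stable under the operations of the quantization. -/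
structure QuantizationStable (σ : LinearMap.BilinForm ℝ E) (ς : Seminorm ℝ E)
    (P : Submodule ℂ (regularMeasures E)) : Prop where
  le_moment : P ≤ momentMeasures ς ⊤
  star_mem : ∀ a ∈ P, measureStar a ∈ P
  conv_mem : ∀ (ħ : ℝ), ∀ a ∈ P, ∀ b ∈ P, deformedConv σ ħ a b ∈ P
  bracket_mem : ∀ a ∈ P, ∀ b ∈ P, poissonBracket σ a b ∈ P

variable {σ : LinearMap.BilinForm ℝ E} {ς : Seminorm ℝ E} {P Q : Submodule ℂ (regularMeasures E)}

lemma ConvStable.deformedConv_mem (hP : ConvStable P) {a b : regularMeasures E} (ha : a ∈ P)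
    (hb : b ∈ P) (ħ : ℝ) : deformedConv σ ħ a b ∈ P := by
  obtain ⟨u, hu⟩ := exists_hasDensity a
  obtain ⟨v, hv⟩ := exists_hasDensity b
  exact hP.conv_mem a ha b hb _ _ (hu.rep.deformedConv hv.rep σ ħ)

lemma ConvStable.poissonBracket_mem (hP : ConvStable P) (hς : ControlsForm σ ς)
    {a b : regularMeasures E} (ha : a ∈ P) (hb : b ∈ P) (h₁ : a ∈ momentMeasures ς ⊤)
    (h₂ : b ∈ momentMeasures ς ⊤) : poissonBracket σ a b ∈ P := by
  obtain ⟨u, hu⟩ := exists_hasDensity a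
  obtain ⟨v, hv⟩ := exists_hasDensity b
  exact hP.conv_mem a ha b hb _ _ (hu.poissonBracket hv hς
    (momentMeasures_mono ς (n := 1) le_top h₁) (momentMeasures_mono ς (n := 1) le_top h₂))

/-- Stability of `Q` under arbitrary densities settles the operations on its side; the moments that
make the bracket density integrable come from `P`. -/
lemma QuantizationStable.inf (hς : ControlsForm σ ς) (hP : QuantizationStable σ ς P)
    (hQ : ConvStable Q) : QuantizationStable σ ς (P ⊓ Q) where
  le_moment := inf_le_left.trans hP.le_moment
  star_mem a ha := ⟨hP.star_mem a ha.1, hQ.star_mem a ha.2⟩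
  conv_mem ħ a ha b hb := ⟨hP.conv_mem ħ a ha.1 b hb.1, hQ.deformedConv_mem ha.2 hb.2 ħ⟩
  bracket_mem a ha b hb := ⟨hP.bracket_mem a ha.1 b hb.1, hQ.poissonBracket_mem hς ha.2 hb.2
    (hP.le_moment ha.1) (hP.le_moment hb.1)⟩

lemma quantizationStable_iInf_moment (hς : ControlsForm σ ς) (K : Set (Seminorm ℝ E))
    (h : ⨅ κ ∈ K, momentMeasures κ ⊤ ≤ momentMeasures ς ⊤) :
    QuantizationStable σ ς (⨅ κ ∈ K, momentMeasures κ ⊤) where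
  le_moment := h
  star_mem a ha := by
    simp only [Submodule.mem_iInf] at ha ⊢
    exact fun κ hκ => measureStar_mem_momentMeasures (ha κ hκ)
  conv_mem ħ a ha b hb := by
    simp only [Submodule.mem_iInf] at ha hb ⊢
    exact fun κ hκ => deformedConv_mem_momentMeasures σ ħ (ha κ hκ) (hb κ hκ)
  bracket_mem a ha b hb := by
    have h₁ := h ha
    have h₂ := h hb
    simp only [Submodule.mem_iInf] at ha hb ⊢
    exact fun κ hκ => poissonBracket_mem_momentMeasures hς (ha κ hκ) (hb κ hκ) h₁ h₂

/-- Moments with respect to a seminorm dominated by finitely many seminorms. -/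
lemma mem_momentMeasures_of_le_sum {Γ : Finset (Seminorm ℝ E)} {c : Seminorm ℝ E → ℝ}
    (h : ∀ f, ς f ≤ ∑ κ ∈ Γ, c κ * κ f) {a : regularMeasures E} {n : ℕ∞}
    (ha : ∀ κ ∈ Γ, a ∈ momentMeasures κ n) (ha₀ : a ∈ momentMeasures ς 0) :
    a ∈ momentMeasures ς n := by
  intro j hj
  -- Order zero is separate because `Γ` may be empty, and then no sum over `Γ` bounds the constant
  -- 1.
  rcases Nat.eq_zero_or_pos j with rfl | hj0
  · exact ha₀ 0 le_rfl
  obtain ⟨i, rfl⟩ : ∃ i, j = i + 1 := ⟨j - 1, by omega⟩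
  -- The power mean inequality gives the factor `Γ.card ^ i`; absolute values are taken because the
  -- constants may be negative.
  have hb : ∀ f, ENNReal.ofReal (ς f ^ (i + 1)) ≤ ∑ κ ∈ Γ,
      ENNReal.ofReal ((Γ.card : ℝ) ^ i * |c κ| ^ (i + 1)) * ENNReal.ofReal (κ f ^ (i + 1)) := by
    intro f
    simp only [← ENNReal.ofReal_mul (show 0 ≤ (Γ.card : ℝ) ^ i * |c _| ^ (i + 1) by positivity)]
    rw [← ENNReal.ofReal_sum_of_nonneg fun κ _ => by positivity]
    refine ENNReal.ofReal_le_ofReal ?_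
    calc ς f ^ (i + 1) ≤ (∑ κ ∈ Γ, |c κ| * κ f) ^ (i + 1) := by
          gcongr
          refine (h f).trans (Finset.sum_le_sum fun κ _ => ?_)
          gcongr
          exact le_abs_self _
      _ ≤ (Γ.card : ℝ) ^ i * ∑ κ ∈ Γ, (|c κ| * κ f) ^ (i + 1) :=
          pow_sum_le_card_mul_sum_pow (fun κ _ => by positivity) i
      _ = _ := by
          rw [Finset.mul_sum]
          exact Finset.sum_congr rfl fun κ _ => by rw [mul_pow, mul_assoc]
  refine (lintegral_mono hb).trans_lt ?_
  rw [lintegral_finsetSum _ fun κ _ =>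
    ((κ.measurable_of_isFinestLocallyConvex.pow_const _).ennreal_ofReal.const_mul _)]
  refine ENNReal.sum_lt_top.2 fun κ hκ => ?_
  rw [lintegral_const_mul _ (κ.measurable_of_isFinestLocallyConvex.pow_const _).ennreal_ofReal]
  exact ENNReal.mul_lt_top ENNReal.ofReal_lt_top (ha κ hκ _ hj)

omit [TopologicalSpace E] [IsFinestLocallyConvex E] [BorelSpace E] in
lemma mem_momentMeasures_zero (a : regularMeasures E) (κ : Seminorm ℝ E) :
    a ∈ momentMeasures κ 0 := by
  intro j hj
  obtain rfl : j = 0 := by simpa using hj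
  simp [complexMeasure_variation_lt_top (a : ComplexMeasure E)]

lemma regularFinite_le_momentMeasures (κ : Seminorm ℝ E) (n : ℕ∞) :
    regularFinite E ≤ momentMeasures κ n := by
  intro a ha j _
  obtain ⟨S, hS, h⟩ := mem_regularFinite_iff.1 ha
  obtain ⟨C, hC⟩ := (hS.image κ).bddAbove
  refine (lintegral_mono_ae (g := fun _ => ENNReal.ofReal (C ^ j)) ?_).trans_lt ?_
  · filter_upwards [mem_ae_iff.2 h] with x hx
    exact ENNReal.ofReal_le_ofReal
      (pow_le_pow_left₀ (apply_nonneg κ x) (hC (Set.mem_image_of_mem κ hx)) j)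
  · rw [lintegral_const]
    exact ENNReal.mul_lt_top ENNReal.ofReal_lt_top (complexMeasure_variation_lt_top _)

lemma IsMeasurePoissonAlgebra.quantizationStable (hς : ControlsForm σ ς)
    (hP : IsMeasurePoissonAlgebra ς P) : QuantizationStable σ ς P := by
  induction hP with
  | moment κ c h =>
    -- A single seminorm is treated as a one-element collection.
    have key := quantizationStable_iInf_moment hς {κ} (fun a ha => by
      simp only [Submodule.mem_iInf] at ha
      exact mem_momentMeasures_of_le_sum (Γ := {κ}) (c := fun _ => c) (by simpa using h)
        (by simpa using ha) (mem_momentMeasures_zero a ς))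
    simpa using key
  | moments K Γ hΓ c h =>
    refine quantizationStable_iInf_moment hς K fun a ha => ?_
    simp only [Submodule.mem_iInf] at ha
    exact mem_momentMeasures_of_le_sum h (fun κ hκ => ha κ (hΓ κ hκ)) (mem_momentMeasures_zero a ς)
  | inf_discrete P h ih => exact ih.inf hς convStable_regularDiscrete
  | inf_continuous P h ih => exact ih.inf hς convStable_regularContinuous
  | inf_absCont P h α hα ih => exact ih.inf hς (convStable_regularAbsCont α)
  | finite =>
    have h := convStable_regularFinite (E := E)
    have hle := regularFinite_le_momentMeasures (E := E) ς ⊤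
    exact ⟨hle, h.star_mem, fun ħ a ha b hb => h.deformedConv_mem ha hb ħ,
      fun a ha b hb => h.poissonBracket_mem hς ha hb (hle ha) (hle hb)⟩

end Classes

/-! ## The strict deformation quantization -/

section BanachStar

variable {A : Type*} [NormedAddCommGroup A] [NormedSpace ℂ A] {mul : A → A → A} {star' : A → A}

lemma IsBanachStarAlgebra.continuous_star (h : IsBanachStarAlgebra mul star') :
    Continuous star' :=
  (Isometry.of_dist_eq fun a b => by
    have : star' (a - b) = star' a - star' b := by
      have h₁ := h.star_smul (-1) b
      rw [sub_eq_add_neg, h.star_add, ← neg_one_smul ℂ b, h₁]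
      simp [sub_eq_add_neg]
    rw [dist_eq_norm, dist_eq_norm, ← this, h.norm_star]).continuous

lemma IsBanachStarAlgebra.continuous_mul (h : IsBanachStarAlgebra mul star') :
    Continuous (Function.uncurry mul) :=
  ((LinearMap.mk₂ ℂ mul h.add_mul h.smul_mul h.mul_add h.mul_smul).mkContinuous₂ 1 fun a b => by
    simpa using h.norm_mul_le a b).continuous₂

end BanachStar

section Quantization

variable {E : Type*} [AddCommGroup E] [Module ℝ E] [TopologicalSpace E] [IsFinestLocallyConvex E]
  [MeasurableSpace E] [BorelSpace E] {σ : LinearMap.BilinForm ℝ E} {ς : Seminorm ℝ E}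
  {P : Submodule ℂ (regularMeasures E)}

lemma QuantizationStable.isPoissonAlgebra (hσ : σ.IsAlt) (hς : ControlsForm σ ς)
    (hP : QuantizationStable σ ς P) :
    IsPoissonAlgebra P (deformedConv σ 0) measureStar (poissonBracket σ) :=
  have hm : ∀ a ∈ P, a ∈ momentMeasures ς 1 := fun _ ha =>
    momentMeasures_mono ς (n := 1) le_top (hP.le_moment ha)
  { mul_mem := hP.conv_mem 0
    star_mem := hP.star_mem
    br_mem := hP.bracket_mem
    add_mul := fun a _ b _ c _ => add_deformedConv σ 0 a b c
    smul_mul := fun z a _ b _ => smul_deformedConv σ 0 z a b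
    mul_comm := fun a _ b _ => deformedConv_zero_comm σ a b
    mul_assoc := fun a _ b _ c _ => deformedConv_assoc σ 0 a b c
    star_add := fun a _ b _ => measureStar_add a b
    star_smul := fun z a _ => measureStar_smul z a
    star_star := fun a _ => measureStar_measureStar a
    star_mul := fun a _ b _ => measureStar_deformedConv σ 0 hσ a b
    br_add := fun a ha b hb c hc => poissonBracket_add hς (hm a ha) (hm b hb) (hm c hc)
    br_smul := fun z a ha b hb => poissonBracket_smul hς (hm a ha) (hm b hb) z
    br_anticomm := fun a ha b hb => poissonBracket_anticomm hσ hς (hm a ha) (hm b hb)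
    br_real := fun a ha b hb => measureStar_poissonBracket hς (hm a ha) (hm b hb)
    jacobi := fun _ ha _ hb _ hc => poissonBracket_jacobi hσ hς (hP.le_moment ha)
      (hP.le_moment hb) (hP.le_moment hc)
    leibniz := fun a ha b hb c hc => poissonBracket_leibniz hς (hm a ha) (hm b hb) (hm c hc) }

/-- All the algebras share one normed space with one involution, and only the product varies. Hence
Rieffel's condition is constancy of the norm, and the closure statements follow from continuity of
the operations. -/
lemma QuantizationStable.isBanachStrictDeformationQuantization (hσ : σ.IsAlt)
    (hς : ControlsForm σ ς) (hP : QuantizationStable σ ς P) :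
    IsBanachStrictDeformationQuantization (A := fun _ : ℝ => regularMeasures E)
      (fun ħ => deformedConv σ ħ) (fun _ => measureStar) P (poissonBracket σ)
      (fun _ => P.subtype) where
  banach ħ := isBanachStarAlgebra_deformedConv σ ħ hσ
  poisson := hP.isPoissonAlgebra hσ hς
  closure_mul_mem a ha b hb :=
    map_mem_closure₂ (isBanachStarAlgebra_deformedConv σ 0 hσ).continuous_mul ha hb
      (hP.conv_mem 0)
  closure_star_mem a ha :=
    map_mem_closure (isBanachStarAlgebra_deformedConv σ 0 hσ).continuous_star ha hP.star_mem
  closure_mul_comm a _ b _ := deformedConv_zero_comm σ a b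
  embedding_zero a := rfl
  star_preserving ħ a := rfl
  dirac a b := tendsto_scaledCommutator σ hσ hς
    (momentMeasures_mono ς (n := 1) le_top (hP.le_moment a.2))
    (momentMeasures_mono ς (n := 1) le_top (hP.le_moment b.2))
  vonNeumann a b := tendsto_deformedConv_zero σ (a : regularMeasures E) b
  rieffel a := continuous_const
  injective ħ := P.injective_subtype
  image_mul_mem ħ a b := by
    rw [Submodule.range_subtype]
    exact hP.conv_mem ħ a a.2 b b.2
  image_star_mem ħ a := by
    rw [Submodule.range_subtype]
    exact hP.star_mem a a.2

end Quantization

/-! ## Functoriality -/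

section Functoriality

variable {E : Type*} [AddCommGroup E] [Module ℝ E] [TopologicalSpace E] [IsFinestLocallyConvex E]
  [MeasurableSpace E] [BorelSpace E]
  {E' : Type*} [AddCommGroup E'] [Module ℝ E'] [TopologicalSpace E'] [IsFinestLocallyConvex E']
  [MeasurableSpace E'] [BorelSpace E']

omit [TopologicalSpace E] [IsFinestLocallyConvex E] [BorelSpace E] in
lemma pushMeasure_id : pushMeasure (LinearMap.id : E →ₗ[ℝ] E) = id :=
  funext fun μ => measureOfValues_apply μ fun _ _ => rfl

lemma pushMeasure_comp {E'' : Type*} [AddCommGroup E''] [Module ℝ E''] [TopologicalSpace E'']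
    [IsFinestLocallyConvex E''] [MeasurableSpace E''] [BorelSpace E''] (S : E' →ₗ[ℝ] E'')
    (T : E →ₗ[ℝ] E') (μ : regularMeasures E) :
    pushMeasure (S ∘ₗ T) μ = pushMeasure S (pushMeasure T μ) := by
  obtain ⟨w, h⟩ := exists_hasDensity μ
  exact (h.rep.push (S ∘ₗ T)).eq_of ((h.rep.push T).push S) (fun _ => rfl) fun _ => rfl

variable {σ : LinearMap.BilinForm ℝ E} {σ' : LinearMap.BilinForm ℝ E'} {T : E →ₗ[ℝ] E'}

lemma pushMeasure_deformedConv (h : ∀ f g, σ' (T f) (T g) = σ f g) (ħ : ℝ)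
    (μ ν : regularMeasures E) : pushMeasure T (deformedConv σ ħ μ ν)
      = deformedConv σ' ħ (pushMeasure T μ) (pushMeasure T ν) := by
  obtain ⟨u, hu⟩ := exists_hasDensity μ
  obtain ⟨v, hv⟩ := exists_hasDensity ν
  refine ((hu.rep.deformedConv hv.rep σ ħ).push T).eq_of
    ((hu.rep.push T).deformedConv (hv.rep.push T) σ' ħ) (fun p => ?_) fun p => map_add T _ _
  simp only [multiplier, h]

/-- Integrability is inherited from the source, where the densities coincide, so no seminorm
controlling σ' is needed. -/
lemma pushMeasure_poissonBracket (h : ∀ f g, σ' (T f) (T g) = σ f g) {ς : Seminorm ℝ E}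
    (hς : ControlsForm σ ς) {μ ν : regularMeasures E} (hμ : μ ∈ momentMeasures ς 1)
    (hν : ν ∈ momentMeasures ς 1) : pushMeasure T (poissonBracket σ μ ν)
      = poissonBracket σ' (pushMeasure T μ) (pushMeasure T ν) := by
  obtain ⟨u, hu⟩ := exists_hasDensity μ
  obtain ⟨v, hv⟩ := exists_hasDensity ν
  have hint := hu.integrable_bilinForm hv hς hμ hν
  refine ((hu.poissonBracket hv hς hμ hν).push T).eq_of
    ((hu.rep.push T).poissonBracket (hv.rep.push T) σ' (by simpa only [h] using hint))
    (fun p => ?_) fun p => map_add T _ _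
  simp only [h]

lemma pushMeasure_mem_momentMeasures {κ : Seminorm ℝ E} {κ' : Seminorm ℝ E'} {c : ℝ}
    (h : ∀ f, κ' (T f) ≤ c * κ f) {n : ℕ∞} {μ : regularMeasures E} (hμ : μ ∈ momentMeasures κ n) :
    pushMeasure T μ ∈ momentMeasures κ' n := by
  obtain ⟨u, hu⟩ := exists_hasDensity μ
  refine (hu.rep.push T).mem_momentMeasures fun j hj => ?_
  -- The absolute value covers a negative constant `c`.
  refine ((hu.integrable_moment hμ hj).const_mul (|c| ^ j)).mono' ?_
    (Eventually.of_forall fun x => ?_)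
  · exact (((κ'.measurable_of_isFinestLocallyConvex.comp
      T.measurable_of_isFinestLocallyConvex).pow_const j).mul hu.meas.norm).aestronglyMeasurable
  · rw [Real.norm_of_nonneg (by positivity), ← mul_assoc, ← mul_pow]
    gcongr
    exact (h x).trans (by gcongr; exact le_abs_self c)

lemma exists_imageRep_pushMeasure (T : E →ₗ[ℝ] E') (μ : regularMeasures E) : ∃ w : E → ℂ,
    ImageRep (pushMeasure T μ : ComplexMeasure E') (μ : ComplexMeasure E).variation w
      fun x => T x := by
  obtain ⟨u, hu⟩ := exists_hasDensity μ
  exact ⟨u, hu.rep.push T⟩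

lemma pushMeasure_mem_regularDiscrete {μ : regularMeasures E} (hμ : μ ∈ regularDiscrete E) :
    pushMeasure T μ ∈ regularDiscrete E' := by
  obtain ⟨S, hS, h⟩ := mem_regularDiscrete_iff.1 hμ
  obtain ⟨w, hw⟩ := exists_imageRep_pushMeasure T μ
  have hTS := hS.image T
  refine mem_regularDiscrete_iff.2 ⟨_, hTS, hw.variation_eq_zero hTS.measurableSet.compl ?_⟩
  filter_upwards [mem_ae_iff.2 h] with x hx hxS
  exact hxS (Set.mem_image_of_mem T hx)

lemma pushMeasure_mem_regularFinite {μ : regularMeasures E} (hμ : μ ∈ regularFinite E) :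
    pushMeasure T μ ∈ regularFinite E' := by
  obtain ⟨S, hS, h⟩ := mem_regularFinite_iff.1 hμ
  obtain ⟨w, hw⟩ := exists_imageRep_pushMeasure T μ
  have hTS := hS.image T
  refine mem_regularFinite_iff.2 ⟨_, hTS, hw.variation_eq_zero hTS.measurableSet.compl ?_⟩
  filter_upwards [mem_ae_iff.2 h] with x hx hxS
  exact hxS (Set.mem_image_of_mem T hx)

/-- Under an injective map the preimage of a point has at most one element; otherwise a fibre of
positive mass could create an atom. -/
lemma pushMeasure_mem_regularContinuous (hT : Function.Injective T) {μ : regularMeasures E}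
    (hμ : μ ∈ regularContinuous E) : pushMeasure T μ ∈ regularContinuous E' := by
  obtain ⟨w, hw⟩ := exists_imageRep_pushMeasure T μ
  refine mem_regularContinuous_iff.2 fun f => hw.variation_eq_zero (measurableSet_singleton f) ?_
  suffices h : (μ : ComplexMeasure E).variation (T ⁻¹' {f}) = 0 from
    measure_eq_zero_iff_ae_notMem.1 h
  rcases (Set.subsingleton_singleton.preimage hT).eq_empty_or_singleton with h | ⟨g, h⟩
  · rw [h, measure_empty]
  · rw [h]
    exact mem_regularContinuous_iff.1 hμ g

lemma pushMeasure_mem_regularAbsCont {α : Submodule ℝ E} [FiniteDimensional ℝ α]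
    {μ : regularMeasures E} (hμ : μ ∈ regularAbsCont α) :
    pushMeasure T μ ∈ regularAbsCont (α.map T) := by
  obtain ⟨w, hw⟩ := exists_imageRep_pushMeasure T μ
  refine mem_regularAbsCont_iff.2 ⟨hw.variation_eq_zero
    (α.map T).measurableSet_of_finiteDimensional.compl ?_, fun ν hν Λ hΛ h0 =>
      hw.variation_eq_zero hΛ (ae_map_notMem_of_mem_regularAbsCont hμ T hν hΛ h0)⟩
  filter_upwards [mem_ae_iff.2 (mem_regularAbsCont_iff.1 hμ).1] with x hx hxS
  exact hxS (Submodule.mem_map_of_mem hx)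

lemma isQuantizationMorphism_pushMeasure (h : ∀ f g, σ' (T f) (T g) = σ f g) :
    IsQuantizationMorphism σ σ' T where
  map_add μ ν := by
    obtain ⟨m, _, u, v, w, hu, hv, -⟩ := exists_hasDensity₃ μ ν ν
    have huv : ImageRep ((μ + ν : regularMeasures E) : ComplexMeasure E) m _ fun x => x :=
      hu.rep.add hv.rep
    exact (huv.push T).eq_of ((hu.rep.push T).add (hv.rep.push T)) (fun _ => rfl) fun _ => rfl
  map_smul z μ := by
    obtain ⟨u, hu⟩ := exists_hasDensity μ
    have hzu : ImageRep ((z • μ : regularMeasures E) : ComplexMeasure E) _ _ fun x => x :=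
      hu.rep.smul z
    exact (hzu.push T).eq_of ((hu.rep.push T).smul z) (fun _ => rfl) fun _ => rfl
  norm_le μ := by
    obtain ⟨u, hu⟩ := exists_hasDensity μ
    exact (hu.rep.push T).norm_le.trans_eq hu.integral_norm
  map_star μ := by
    obtain ⟨u, hu⟩ := exists_hasDensity μ
    exact (hu.rep.measureStar.push T).eq_of (hu.rep.push T).measureStar (fun _ => rfl)
      fun _ => map_neg T _
  map_mul := pushMeasure_deformedConv h
  map_bracket ς hς μ hμ ν hν := pushMeasure_poissonBracket h hς hμ hν
  map_moment κ κ' c hc n μ hμ := pushMeasure_mem_momentMeasures hc hμ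
  map_discrete μ hμ := pushMeasure_mem_regularDiscrete hμ
  map_continuous hT μ hμ := pushMeasure_mem_regularContinuous hT hμ
  map_absCont α hα μ hμ := pushMeasure_mem_regularAbsCont hμ
  map_finite μ hμ := pushMeasure_mem_regularFinite hμ

end Functoriality

end

theorem mainTheorem1 {E : Type*} [AddCommGroup E] [Module ℝ E]
    [TopologicalSpace E] [IsFinestLocallyConvex E] [MeasurableSpace E] [BorelSpace E]
    (σ : LinearMap.BilinForm ℝ E) (hσ : σ.IsAlt) :
    -- the deformed convolution, the involution and the bracket have their defining values
    (∀ (ħ : ℝ) (μ ν : regularMeasures E) (Λ : Set E), MeasurableSet Λ →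
      (deformedConv σ ħ μ ν : ComplexMeasure E) Λ = convValue (multiplier σ ħ) μ ν Λ) ∧
    (∀ (μ : regularMeasures E) (Λ : Set E), MeasurableSet Λ →
      (measureStar μ : ComplexMeasure E) Λ
        = (starRingEnd ℂ) ((μ : ComplexMeasure E) ((fun f => -f) ⁻¹' Λ))) ∧
    (∀ ς : Seminorm ℝ E, ControlsForm σ ς → ∀ μ ∈ momentMeasures ς 1, ∀ ν ∈ momentMeasures ς 1,
      ∀ Λ : Set E, MeasurableSet Λ → (poissonBracket σ μ ν : ComplexMeasure E) Λ
        = convValue (fun f g => (σ f g : ℂ)) μ ν Λ) ∧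
    -- Banach-star-algebras
    (∀ ħ : ℝ, IsBanachStarAlgebra (deformedConv σ ħ) measureStar) ∧
    -- von Neumann's condition
    (∀ μ ν : regularMeasures E,
      Tendsto (fun ħ : ℝ => ‖deformedConv σ ħ μ ν - deformedConv σ 0 μ ν‖) (𝓝 0) (𝓝 0)) ∧
    -- Dirac's condition
    (∀ ς : Seminorm ℝ E, ControlsForm σ ς → ∀ μ ∈ momentMeasures ς 1, ∀ ν ∈ momentMeasures ς 1,
      Tendsto (fun ħ : ℝ => ‖scaledCommutator (deformedConv σ ħ) ħ μ ν - poissonBracket σ μ ν‖)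
        (𝓝[≠] 0) (𝓝 0)) ∧
    -- the identical embeddings form a strict deformation quantization of Banach-star-type
    (∀ ς : Seminorm ℝ E, ControlsForm σ ς →
      ∀ P : Submodule ℂ (regularMeasures E), IsMeasurePoissonAlgebra ς P →
        P ≤ momentMeasures ς ⊤ ∧
        IsBanachStrictDeformationQuantization (A := fun _ : ℝ => regularMeasures E)
          (fun ħ => deformedConv σ ħ) (fun _ => measureStar) P (poissonBracket σ)
          (fun _ => P.subtype)) ∧
    -- functoriality in the pre-symplectic space with chosen seminorms
    (pushMeasure (LinearMap.id : E →ₗ[ℝ] E) = id) ∧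
    (∀ {E' : Type*} [AddCommGroup E'] [Module ℝ E'] [TopologicalSpace E']
      [IsFinestLocallyConvex E'] [MeasurableSpace E'] [BorelSpace E'] (T : E →ₗ[ℝ] E'),
      (∀ (μ : regularMeasures E) (Λ : Set E'), MeasurableSet Λ →
        (pushMeasure T μ : ComplexMeasure E') Λ = (μ : ComplexMeasure E) (T ⁻¹' Λ)) ∧
      (∀ {E'' : Type*} [AddCommGroup E''] [Module ℝ E''] [TopologicalSpace E'']
        [IsFinestLocallyConvex E''] [MeasurableSpace E''] [BorelSpace E''] (S : E' →ₗ[ℝ] E'')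
        (μ : regularMeasures E), pushMeasure (S ∘ₗ T) μ = pushMeasure S (pushMeasure T μ)) ∧
      (∀ (σ' : LinearMap.BilinForm ℝ E'), σ'.IsAlt → (∀ f g, σ' (T f) (T g) = σ f g) →
        IsQuantizationMorphism σ σ' T)) := by
  refine ⟨fun ħ μ ν Λ hΛ => deformedConv_apply σ ħ μ ν hΛ, fun μ Λ hΛ => measureStar_apply μ hΛ,
    fun ς hς μ hμ ν hν Λ hΛ => poissonBracket_apply hς hμ hν hΛ,
    fun ħ => isBanachStarAlgebra_deformedConv σ ħ hσ, tendsto_deformedConv_zero σ,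
    fun ς hς μ hμ ν hν => tendsto_scaledCommutator σ hσ hς hμ hν, fun ς hς P hP => ?_,
    pushMeasure_id, fun T => ⟨fun μ Λ hΛ => pushMeasure_apply T μ hΛ,
      fun S μ => pushMeasure_comp S T μ, fun σ' _ h => isQuantizationMorphism_pushMeasure h⟩⟩
  have hstable := hP.quantizationStable hς
  exact ⟨hstable.le_moment, hstable.isBanachStrictDeformationQuantization hσ hς⟩
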